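/- Let $\beta>0$, $r=1/\beta$, and let $J$ denote the counterclockwise rotation of $\mathbb{R}^2$ by a right angle. Let $\Omega\subset\mathbb{R}^2$ be a non-empty bounded convex domain whose boundary is a simple closed curve, oriented counterclockwise, which consists of finitely many arcs ("smooth pieces") $\gamma$, each $C^\infty$ up to its end points, parametrized by arc length, and with curvature at least $\beta$ at every point. In the magnetic billiard in $\Omega$ a particle moves with unit speed inside $\Omega$ along circles of radius $r$ counterclockwise (that is, $\dot x=v$, $\dot v=\beta Jv$), and is reflected at smooth boundary points by $v\mapsto v-2\langle n,v\rangle n$, where $n$ is the unit normal. A polynomial integral is a function $\Phi(x,v)=\sum_{k+l\le N}a_{kl}(x)v_1^kv_2^l$, $|v|=1$, with $a_{kl}\in C(\overline\Omega)$, which is constant along the motion inside $\Omega$ and satisfies $\Phi(x,v)=\Phi(x,v-2\langle n,v\rangle n)$ for every smooth boundary point $x$ and every unit vector $v$. Suppose that the magnetic billiard in $\Omega$ has a polynomial integral $\Phi$ that is not constant on the unit tangent bundle of $\Omega$. Then either $\partial\Omega$ is a circle, or for every smooth piece $\gamma$ of $\partial\Omega$, with unit tangent vector $\tau=\dot\gamma$,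 the following holds. (a) $\gamma$ is not contained in a circle. (b) Each of the two parallel curves $\gamma_{+r}=\gamma+rJ\tau$ and $\gamma_{-r}=\gamma-rJ\tau$ has as its Zariski closure in $\mathbb{C}^2$ an irreducible algebraic curve, whose minimal defining polynomial $f_{+r}$, respectively $f_{-r}$ (irreducible over $\mathbb{C}$, unique up to a constant factor), can be chosen with real coefficients, and the affine curves $\{f_{\pm r}=0\}$ are smooth in $\mathbb{C}^2$: the gradient of $f_{\pm r}$ does not vanish at any point of the curve. (c) Let $\tilde f_{\pm r}(x,y,z)$ be the homogenization of $f_{\pm r}$. At every non-singular point of the projective curve $\{\tilde f_{\pm r}=0\}\subset\mathbb{C}P^2$ that lies on the line at infinity $\{z=0\}$ and is different from the isotropic points $(1:\pm i:0)$, the tangent line of the curve is the line at infinity. -/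

import Mathlib

open scoped ContDiff

noncomputable section

namespace MagneticBilliard

/-! The Euclidean plane is `ℂ` with its real inner product; the rotation `J` by a right angle is
multiplication by `Complex.I`, and `(x₁, x₂) = (x.re, x.im)`. -/

/-- A piecewise smooth, simple closed parametrization of the boundary of a plane domain `Ω`.
The parameter interval `[node 0, node n]` is cut into `n` pieces, on each of which the curve is
smooth up to the end points and parametrized by arc length. The orientation is counterclockwise:
`Ω` lies to the left of the (one-sided) tangent lines. -/
structure PiecewiseSmoothBoundary (Ω : Set ℂ) where
  /-- number of smooth pieces -/
  n : ℕ
  n_pos : 0 < n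
  /-- the parameter values at which the pieces are joined -/
  node : Fin (n + 1) → ℝ
  node_strictMono : StrictMono node
  /-- the parametrization of the boundary -/
  curve : ℝ → ℂ
  closed : curve (node 0) = curve (node (Fin.last n))
  simple : Set.InjOn curve (Set.Ico (node 0) (node (Fin.last n)))
  image_eq : curve '' Set.Icc (node 0) (node (Fin.last n)) = frontier Ω
  smooth : ∀ i : Fin n, ContDiffOn ℝ ∞ curve (Set.Icc (node i.castSucc) (node i.succ))
  unit_speed : ∀ i : Fin n, ∀ s ∈ Set.Icc (node i.castSucc) (node i.succ),
    ‖derivWithin curve (Set.Icc (node i.castSucc) (node i.succ)) s‖ = 1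
  counterclockwise : ∀ i : Fin n, ∀ s ∈ Set.Icc (node i.castSucc) (node i.succ), ∀ x ∈ Ω,
    0 < inner ℝ
      (Complex.I * derivWithin curve (Set.Icc (node i.castSucc) (node i.succ)) s) (x - curve s)

namespace PiecewiseSmoothBoundary

variable {Ω : Set ℂ} (B : PiecewiseSmoothBoundary Ω)

/-- The closed parameter interval of the `i`-th smooth piece. -/
def interval (i : Fin B.n) : Set ℝ := Set.Icc (B.node i.castSucc) (B.node i.succ)

/-- The open parameter interval of the `i`-th smooth piece. -/
def openInterval (i : Fin B.n) : Set ℝ := Set.Ioo (B.node i.castSucc) (B.node i.succ)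

/-- The `i`-th smooth piece `γ` of the boundary, as a set of points. -/
def piece (i : Fin B.n) : Set ℂ := B.curve '' B.interval i

/-- The positive unit tangent vector `τ` along the `i`-th piece. -/
def tangent (i : Fin B.n) (s : ℝ) : ℂ := derivWithin B.curve (B.interval i) s

/-- The unit normal `n = J τ` along the `i`-th piece; `(τ, n)` is a positive orthonormal basis. -/
def normal (i : Fin B.n) (s : ℝ) : ℂ := Complex.I * B.tangent i s

/-- The signed curvature `k = ⟨n, τ'⟩` along the `i`-th piece. -/
def curvature (i : Fin B.n) (s : ℝ) : ℝ :=
  inner ℝ (B.normal i s) (derivWithin (B.tangent i) (B.interval i) s)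

end PiecewiseSmoothBoundary

/-- A set of points in the plane is circular if it lies on a circle. -/
def IsCircular (S : Set ℂ) : Prop := ∃ (o : ℂ) (d : ℝ), 0 < d ∧ S ⊆ Metric.sphere o d

/-- The Larmor centre `𝓛(x, v) = x + r J v`, with `r = 1 / β`. -/
def larmorCenter (β : ℝ) (x v : ℂ) : ℂ := x + ((1 / β : ℝ) : ℂ) * (Complex.I * v)

/-- Velocity at time `t` on the counterclockwise Larmor circle with initial velocity `v`. -/
def flowVelocity (β t : ℝ) (v : ℂ) : ℂ := Complex.exp (((β * t : ℝ) : ℂ) * Complex.I) * v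

/-- Position at time `t` on the counterclockwise Larmor circle with initial condition `(x, v)`. -/
def flowPosition (β t : ℝ) (x v : ℂ) : ℂ :=
  larmorCenter β x v - ((1 / β : ℝ) : ℂ) * (Complex.I * flowVelocity β t v)

/-- Reflection `v ↦ v - 2 ⟨n, v⟩ n` in the line orthogonal to the unit vector `n`. -/
def reflect (n v : ℂ) : ℂ := v - (2 * inner ℝ n v) • n

/-- `Φ(x, v)` is a polynomial integral of the magnetic billiard in `Ω` with magnetic field `β`. Only
the values for `x` in the closure of `Ω` and unit vectors `v` matter. -/
structure IsPolynomialIntegral (β : ℝ) {Ω : Set ℂ} (B : PiecewiseSmoothBoundary Ω)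
    (Φ : ℂ → ℂ → ℝ) : Prop where
  /-- `Φ = ∑_{k + l ≤ N} a_{kl}(x) v₁ᵏ v₂ˡ` with coefficients continuous up to the boundary -/
  polynomial : ∃ (N : ℕ) (a : ℕ → ℕ → ℂ → ℝ),
    (∀ k l, ContinuousOn (a k l) (closure Ω)) ∧
    ∀ x ∈ closure Ω, ∀ v : ℂ, ‖v‖ = 1 →
      Φ x v = ∑ k ∈ Finset.range (N + 1), ∑ l ∈ Finset.range (N + 1 - k),
        a k l x * v.re ^ k * v.im ^ l
  /-- `Φ` is preserved by the magnetic flow as long as the particle stays inside `Ω` -/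
  flow_invariant : ∀ x ∈ Ω, ∀ v : ℂ, ‖v‖ = 1 → ∀ t : ℝ, 0 ≤ t →
    (∀ s ∈ Set.Icc 0 t, flowPosition β s x v ∈ Ω) →
      Φ (flowPosition β t x v) (flowVelocity β t v) = Φ x v
  /-- `Φ` is preserved by the reflections at the smooth points of the boundary -/
  reflection_invariant : ∀ i, ∀ s ∈ B.openInterval i, ∀ v : ℂ, ‖v‖ = 1 →
    Φ (B.curve s) v = Φ (B.curve s) (reflect (B.normal i s) v)

/-- The parallel curves of the `i`-th piece: `γ_{+r} = 𝓛(γ, τ)` for `σ = 1` and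
`γ_{-r} = 𝓛(γ, -τ)` for `σ = -1`. -/
def parallelCurve (β : ℝ) {Ω : Set ℂ} (B : PiecewiseSmoothBoundary Ω) (i : Fin B.n) (σ : ℝ) :
    Set ℂ :=
  (fun s => larmorCenter β (B.curve s) ((σ : ℂ) * B.tangent i s)) '' B.interval i

/-- A real plane point regarded as a point of the affine plane `ℂ²`. -/
def toC2 (x : ℂ) : Fin 2 → ℂ := ![(x.re : ℂ), (x.im : ℂ)]

/-- A real polynomial in two variables regarded as a complex one. -/
def complexify (f : MvPolynomial (Fin 2) ℝ) : MvPolynomial (Fin 2) ℂ :=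
  MvPolynomial.map (algebraMap ℝ ℂ) f

/-- `f` is the (real) minimal defining polynomial of an irreducible algebraic curve in `ℂ²` that is
the Zariski closure of the set `S` of real points: `f` is irreducible over `ℂ` and generates the
ideal of all complex polynomials vanishing on `S`. It is unique up to a non-zero factor. -/
def IsMinimalDefiningPolynomial (f : MvPolynomial (Fin 2) ℝ) (S : Set ℂ) : Prop :=
  Irreducible (complexify f) ∧
    MvPolynomial.vanishingIdeal ℂ (toC2 '' S) = Ideal.span {complexify f}

/-- The affine curve `{f = 0}` has no singular points in `ℂ²`. -/
def IsSmoothAffineCurve (f : MvPolynomial (Fin 2) ℂ) : Prop :=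
  ∀ p : Fin 2 → ℂ, MvPolynomial.eval p f = 0 →
    ∃ j, MvPolynomial.eval p (MvPolynomial.pderiv j f) ≠ 0

/-- The homogenization `z ^ deg f * f (x / z, y / z)` of a polynomial `f(x, y)`. -/
def homogenization (f : MvPolynomial (Fin 2) ℂ) : MvPolynomial (Fin 3) ℂ :=
  ∑ m ∈ f.support, MvPolynomial.C (f.coeff m) * MvPolynomial.X 0 ^ m 0 * MvPolynomial.X 1 ^ m 1 *
    MvPolynomial.X 2 ^ (f.totalDegree - (m 0 + m 1))

/-- `P ≠ 0` are homogeneous coordinates of one of the isotropic points `(1 : ±i : 0)`. -/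
def IsIsotropic (P : Fin 3 → ℂ) : Prop :=
  ∃ c : ℂ, c ≠ 0 ∧ (P = c • ![1, Complex.I, 0] ∨ P = c • ![1, -Complex.I, 0])

/-- The point with homogeneous coordinates `P` is a non-singular point of `{g = 0}`. -/
def IsNonsingularPoint (g : MvPolynomial (Fin 3) ℂ) (P : Fin 3 → ℂ) : Prop :=
  MvPolynomial.eval P g = 0 ∧ ∃ j, MvPolynomial.eval P (MvPolynomial.pderiv j g) ≠ 0

/-- The projective line `{z = 0}` is contained in the tangent line
`{Q | ∑ j, ∂_j g (P) Q_j = 0}` of the curve `{g = 0}` at `P`. For a non-singular point `P` of the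
curve this says that the tangent line at `P` is the line at infinity. -/
def IsTangentToLineAtInfinity (g : MvPolynomial (Fin 3) ℂ) (P : Fin 3 → ℂ) : Prop :=
  ∀ Q : Fin 3 → ℂ, Q 2 = 0 → ∑ j, MvPolynomial.eval P (MvPolynomial.pderiv j g) * Q j = 0

end MagneticBilliard

end

open scoped ContDiff

noncomputable section

namespace MagneticBilliard

/-! ### Plane algebraic curves: common zeros, vanishing ideals, real equations. -/

section

section Bivariate

open Polynomial Polynomial.Bivariate

/-! Multiplied by `v ^ N`, the integral is a polynomial in the complex unit vector `v`, with
coefficients depending on `x`. Invariance under the flow is a recursion between the `∂` and `∂̄`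
derivatives of neighbouring coefficients; it stops on both sides, so high derivatives vanish and the
coefficients are polynomials in `x`. They are only known to be continuous, so this is done for
mollifications and carried to the limit by an interpolation identity
(`FlowInvariantOn.exists_mvPolynomial`). Flowing until the velocity is 1 gives `Φ(x, v) = F(𝓛(x,
v))` with a polynomial `F` (`IsPolynomialIntegral.exists_mvPolynomial`).

The reflection law now says that on the circle of radius `r` about a boundary point, `F` is
symmetric in the normal line. The symmetry fixes the points `γ ± r J τ`, so there the derivative of
`F` along `τ` vanishes. Since `τ` is tangent to the parallel curves, `F` is constant on each of
them.

If an arc lies on a circle about `o`, the symmetry extends algebraically to all points of that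
circle, and `F` becomes invariant under rotations about `o` of small angle, hence radial
(`radial_of_symmetric`). Constancy of `F` on `γ_{-r}` then puts every piece on a circle about `o`,
and the boundary is a circle (`frontier_eq_sphere_of_arc`).

Otherwise let `G = F - c` vanish on a parallel curve and write `G = f ^ (m + 1) * g`, with `f`
irreducible, vanishing on an arc and not dividing `g`. With `λ` the normal derivative of `f` and `φ`
the restriction of `f` to the tangent circle, the symmetry to third order says that `g ^ 3 * (λ ^ 2
* φ'') ^ (m + 1)` is a nonzero constant along the arc (`IsFrenet.exists_const`). As `λ ^ 2` is a
polynomial, squaring away `λ` gives an identity on the whole complex curve `f = 0`, which fails at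
singular points and at zeros of `g` (`IsFrenet.exists_identity`). So the curve is smooth, it does
not meet `g = 0`, and by connectedness it contains the entire parallel curve.

For the points at infinity, suppose that the tangent at a non-isotropic point `(a : b : 0)` is not
the line at infinity. Then a branch of `f = 0` runs to infinity along a finite asymptote. Two
symmetric points of the tangent circles differ essentially by a bounded multiple of `(a, b)`, and
comparing the growth of `G` at them shows that `G` does not depend on the coordinate along `(a, b)`
(`natDegree_rotated_eq_zero`). Then `G = 0` is a union of lines, which cannot contain a parallel
curve of a curved arc (`IsFrenet.natDegree_rotated_ne_zero`). -/

theorem exists_combination_eq_C {f h : ℂ[X][X]} (hf : Irreducible f) (hdeg : f.natDegree ≠ 0)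
    (hfh : ¬ f ∣ h) : ∃ (d : ℂ[X]) (u v : ℂ[X][X]), d ≠ 0 ∧ u * f + v * h = C d := by
  -- By Gauss's lemma `f` stays irreducible over the field `ℂ(x)`, where it is coprime to `h`;
  -- clearing denominators in a Bézout relation leaves a polynomial in `x` alone.
  have hprim : f.IsPrimitive := hf.isPrimitive hdeg
  let K := FractionRing ℂ[X]
  have hirr := (hprim.irreducible_iff_irreducible_map_fraction_map (K := K)).1 hf
  have hnd : ¬ f.map (algebraMap ℂ[X] K) ∣ h.map (algebraMap ℂ[X] K) := fun hd =>
    hfh ((hprim.dvd_iff_fraction_map_dvd_fraction_map K).2 hd)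
  obtain ⟨a, b, hab⟩ := (hirr.coprime_iff_not_dvd).2 hnd
  obtain ⟨c, hc0, hc⟩ := IsLocalization.integerNormalization_spec (nonZeroDivisors ℂ[X]) a
  obtain ⟨d, hd0, hd⟩ := IsLocalization.integerNormalization_spec (nonZeroDivisors ℂ[X]) b
  set A := IsLocalization.integerNormalization (nonZeroDivisors ℂ[X]) a
  set B := IsLocalization.integerNormalization (nonZeroDivisors ℂ[X]) b
  rw [Algebra.smul_def, Polynomial.algebraMap_apply] at hc hd
  rw [mem_nonZeroDivisors_iff_ne_zero] at hc0 hd0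
  refine ⟨c * d, C d * A, C c * B, mul_ne_zero hc0 hd0, ?_⟩
  apply Polynomial.map_injective (algebraMap ℂ[X] K) (IsFractionRing.injective _ _)
  simp only [Polynomial.map_add, Polynomial.map_mul, Polynomial.map_C, hc, hd, map_mul]
  linear_combination (C (algebraMap ℂ[X] K c) * C (algebraMap ℂ[X] K d)) * hab

theorem C_X_sub_C_dvd_iff (h : ℂ[X][X]) (x : ℂ) :
    C (X - C x) ∣ h ↔ h.map (evalRingHom x) = 0 := by
  rw [Polynomial.C_dvd_iff_dvd_coeff, Polynomial.ext_iff]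
  simp [Polynomial.dvd_iff_isRoot, Polynomial.IsRoot]

theorem evalEval_eq_eval_map (h : ℂ[X][X]) (x y : ℂ) :
    h.evalEval x y = (h.map (evalRingHom x)).eval y := by
  induction h using Polynomial.induction_on' with
  | add p q hp hq => rw [evalEval_add, Polynomial.map_add, eval_add, hp, hq]
  | monomial n a => simp [evalEval, ← C_mul_X_pow_eq_monomial]

/-- A polynomial `d(x)` bounds the possible abscissae, and a second polynomial `k` that vanishes on
no vertical line over a root of `d` bounds the ordinates. If `f` involves `y`, then `d` comes from
elimination and `k = f`, which is primitive; otherwise `f = 0` is itself a vertical line, and `k =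
h`. -/
theorem finite_common_zeros_bivariate {f h : ℂ[X][X]} (hf : Irreducible f) (hfh : ¬ f ∣ h) :
    {p : Fin 2 → ℂ | f.evalEval (p 0) (p 1) = 0 ∧ h.evalEval (p 0) (p 1) = 0}.Finite := by
  have key : ∃ (d : ℂ[X]) (k : ℂ[X][X]), d ≠ 0 ∧ (∀ x, d.eval x = 0 → k.map (evalRingHom x) ≠ 0) ∧
      ∀ x y, f.evalEval x y = 0 → h.evalEval x y = 0 → d.eval x = 0 ∧ k.evalEval x y = 0 := by
    by_cases hdeg : f.natDegree = 0
    · obtain ⟨q, rfl⟩ : ∃ q, f = C q := ⟨_, eq_C_of_natDegree_eq_zero hdeg⟩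
      have hq : Irreducible q := by
        refine ⟨fun hu => hf.not_isUnit (hu.map C), fun a b hab => ?_⟩
        have := hf.isUnit_or_isUnit (a := C a) (b := C b) (by rw [hab, C_mul])
        simpa [Polynomial.isUnit_C] using this
      refine ⟨q, h, hq.ne_zero, fun x hx h0 => hfh ?_, fun x y h1 h2 => ⟨by rwa [evalEval_C] at h1, h2⟩⟩
      rw [← C_X_sub_C_dvd_iff] at h0
      obtain ⟨k, hk⟩ := (irreducible_X_sub_C x).dvd_symm hq (dvd_iff_isRoot.2 hx)
      obtain ⟨l, hl⟩ := h0
      exact ⟨C k * l, by rw [hl, hk, C_mul, mul_assoc]⟩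
    · obtain ⟨d, u, v, hd, huv⟩ := exists_combination_eq_C hf hdeg hfh
      refine ⟨d, f, hd, fun x _ h0 => ?_, fun x y h1 h2 => ⟨?_, h1⟩⟩
      · rw [← C_X_sub_C_dvd_iff] at h0
        exact not_isUnit_X_sub_C x ((hf.isPrimitive hdeg) _ h0)
      · have := congrArg (evalEval x y) huv
        rw [evalEval_add, evalEval_mul, evalEval_mul, h1, h2, evalEval_C] at this
        simpa using this.symm
  obtain ⟨d, k, hd, hk, hdk⟩ := key
  have hfin : (⋃ x ∈ {x | d.eval x = 0},
      (fun y => (![x, y] : Fin 2 → ℂ)) '' {y | (k.map (evalRingHom x)).eval y = 0}).Finite := by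
    refine Set.Finite.biUnion ?_ fun x hx => Set.Finite.image _ ?_
    · exact (d.roots.toFinset.finite_toSet).subset fun x hx => by simpa [hd] using hx
    · exact ((k.map (evalRingHom x)).roots.toFinset.finite_toSet).subset
        fun y hy => by simpa [hk x hx] using hy
  refine hfin.subset ?_
  rintro p ⟨h1, h2⟩
  obtain ⟨h3, h4⟩ := hdk _ _ h1 h2
  simp only [Set.mem_iUnion]
  refine ⟨p 0, h3, p 1, ?_, ?_⟩
  · rwa [Set.mem_ofPred, ← evalEval_eq_eval_map]
  · ext i; fin_cases i <;> rfl

theorem eval_eq_evalEval (h : MvPolynomial (Fin 2) ℂ) (p : Fin 2 → ℂ) :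
    MvPolynomial.eval p h = ((equivMvPolynomial ℂ).symm h).evalEval (p 0) (p 1) := by
  induction h using MvPolynomial.induction_on with
  | C a => simp [equivMvPolynomial_symm_C]
  | add p q hp hq => simp only [map_add, hp, hq, evalEval_add]
  | mul_X q i hq =>
    rw [map_mul, map_mul, evalEval_mul, hq]
    fin_cases i <;> simp [equivMvPolynomial_symm_X_0, equivMvPolynomial_symm_X_1, evalEval]

end Bivariate

open MvPolynomial

theorem finite_common_zeros {f h : MvPolynomial (Fin 2) ℂ} (hf : Irreducible f) (hfh : ¬ f ∣ h) :
    {p : Fin 2 → ℂ | eval p f = 0 ∧ eval p h = 0}.Finite := by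
  let e := (Polynomial.Bivariate.equivMvPolynomial ℂ).symm
  have h1 : Irreducible (e f) := (MulEquiv.irreducible_iff e.toMulEquiv).2 hf
  have h2 : ¬ e f ∣ e h := fun hd => hfh ((map_dvd_iff e).1 hd)
  simpa only [eval_eq_evalEval] using finite_common_zeros_bivariate h1 h2

/-- A polynomial that vanishes at infinitely many zeros of an irreducible polynomial is a multiple
of it. -/
theorem dvd_of_infinite {f h : MvPolynomial (Fin 2) ℂ} (hf : Irreducible f)
    {S : Set (Fin 2 → ℂ)} (hS : S.Infinite) (hfS : ∀ p ∈ S, eval p f = 0)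
    (hhS : ∀ p ∈ S, eval p h = 0) : f ∣ h := by
  by_contra hd
  exact hS ((finite_common_zeros hf hd).subset fun p hp => ⟨hfS p hp, hhS p hp⟩)

theorem vanishingIdeal_eq_span {f : MvPolynomial (Fin 2) ℂ} (hf : Irreducible f)
    {S : Set (Fin 2 → ℂ)} (hS : S.Infinite) (hfS : ∀ p ∈ S, eval p f = 0) :
    vanishingIdeal ℂ S = Ideal.span {f} := by
  ext h
  rw [mem_vanishingIdeal_iff, Ideal.mem_span_singleton]
  constructor
  · intro hh
    exact dvd_of_infinite hf hS hfS fun p hp => by simpa [aeval_eq_eval] using hh p hp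
  · rintro ⟨k, rfl⟩ p hp
    simp [aeval_eq_eval, hfS p hp]

theorem toC2_injective : Function.Injective toC2 := by
  intro x y h
  have h0 := congrFun h 0
  have h1 := congrFun h 1
  simp only [toC2, Matrix.cons_val_zero, Matrix.cons_val_one, Complex.ofReal_inj] at h0 h1
  exact Complex.ext h0 h1

/-- The polynomial with complex conjugate coefficients. -/
def conjPoly : MvPolynomial (Fin 2) ℂ ≃+* MvPolynomial (Fin 2) ℂ :=
  mapEquiv (Fin 2) (starRingAut : ℂ ≃+* ℂ)

theorem coeff_conjPoly (f : MvPolynomial (Fin 2) ℂ) (m : Fin 2 →₀ ℕ) :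
    coeff m (conjPoly f) = star (coeff m f) := by
  simp [conjPoly, coeff_map]

theorem eval_conjPoly (f : MvPolynomial (Fin 2) ℂ) (z : ℂ) :
    eval (toC2 z) (conjPoly f) = star (eval (toC2 z) f) := by
  induction f using MvPolynomial.induction_on with
  | C a => simp [conjPoly]
  | add p q hp hq => simp only [map_add, hp, hq, star_add]
  | mul_X q i hq =>
    rw [map_mul, map_mul, map_mul, hq, star_mul']
    congr 1
    fin_cases i <;> simp [conjPoly, toC2]

/-- An irreducible complex polynomial that vanishes at infinitely many real points is real up to a
scalar factor. -/
theorem exists_real_multiple {f : MvPolynomial (Fin 2) ℂ} (hf : Irreducible f) {S : Set ℂ}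
    (hS : S.Infinite) (hfS : ∀ z ∈ S, eval (toC2 z) f = 0) :
    ∃ f₀ : MvPolynomial (Fin 2) ℝ, Associated f (complexify f₀) := by
  have hS' : (toC2 '' S).Infinite := hS.image toC2_injective.injOn
  have hd : f ∣ conjPoly f := by
    refine dvd_of_infinite hf hS' ?_ ?_
    · rintro _ ⟨z, hz, rfl⟩; exact hfS z hz
    · rintro _ ⟨z, hz, rfl⟩; rw [eval_conjPoly, hfS z hz, star_zero]
  have hirr : Irreducible (conjPoly f) := (MulEquiv.irreducible_iff conjPoly.toMulEquiv).2 hf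
  obtain ⟨u, hu⟩ := (hf.associated_of_dvd hirr hd)
  obtain ⟨c, hcu, hc⟩ : ∃ c : ℂ, IsUnit c ∧ (u : MvPolynomial (Fin 2) ℂ) = C c := by
    have h1 := MvPolynomial.isUnit_iff_eq_C_of_isReduced.1 u.isUnit
    obtain ⟨c, hc, h⟩ := h1
    exact ⟨c, hc, h⟩
  rw [hc] at hu
  have hcoef : ∀ m, star (coeff m f) = coeff m f * c := fun m => by
    rw [← coeff_conjPoly, ← hu, mul_comm f, coeff_C_mul, mul_comm]
  obtain ⟨m₀, hm₀⟩ := MvPolynomial.ne_zero_iff.1 hf.ne_zero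
  have hstar : star (coeff m₀ f) ≠ 0 := star_ne_zero.2 hm₀
  -- Conjugation multiplies all coefficients by the same constant `c`, so multiplication by the
  -- conjugate of one nonzero coefficient makes all of them real.
  have hreal : ∀ m, star (coeff m f * star (coeff m₀ f)) = coeff m f * star (coeff m₀ f) := by
    intro m
    rw [star_mul', star_star, hcoef m, hcoef m₀]; ring
  generalize star (coeff m₀ f) = d at hstar hreal
  refine ⟨∑ m ∈ f.support, monomial m (coeff m f * d).re, ?_⟩
  have heq : complexify (∑ m ∈ f.support, monomial m (coeff m f * d).re) = f * C d := by
    simp only [complexify, map_sum, map_monomial]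
    conv_rhs => rw [f.as_sum, Finset.sum_mul]
    refine Finset.sum_congr rfl fun m _ => ?_
    rw [mul_comm (monomial m _), C_mul_monomial, mul_comm d]
    congr 1
    exact (Complex.conj_eq_iff_re.1 (hreal m))
  rw [heq]
  exact (associated_mul_unit_right _ _ ((isUnit_iff_ne_zero.2 hstar).map C))

/-- A nonzero partial derivative has smaller degree and cannot be a multiple of `f`; in
characteristic zero both partial derivatives vanish only for constants. -/
theorem exists_pderiv_not_dvd {f : MvPolynomial (Fin 2) ℂ} (hf : Irreducible f) :
    ∃ j, ¬ f ∣ pderiv j f := by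
  by_contra! hall
  have hz : ∀ j, pderiv j f = 0 := by
    intro j
    by_contra h0
    obtain ⟨k, hk⟩ := hall j
    have hk0 : k ≠ 0 := by rintro rfl; simp [hk] at h0
    have h1 := totalDegree_mul_of_isDomain hf.ne_zero hk0
    rw [← hk] at h1
    by_cases h2 : f.totalDegree = 0
    · rw [totalDegree_eq_zero_iff_eq_C.1 h2] at h0; simp at h0
    · have h3 : (pderiv j f).totalDegree < f.totalDegree := by
        rw [MvPolynomial.totalDegree, Finset.sup_lt_iff (by rw [bot_eq_zero]; omega)]
        intro m hm
        rw [mem_support_iff, coeff_pderiv] at hm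
        have h4 := le_totalDegree (mem_support_iff.2 (left_ne_zero_of_mul hm))
        rw [Finsupp.sum_add_index (by simp) (by simp)] at h4
        simp at h4
        omega
      omega
  have : f.totalDegree = 0 := by
    rw [totalDegree_eq_zero_iff]
    intro m hm j
    by_contra hj
    have h1 := coeff_pderiv (i := j) f (m - Finsupp.single j 1)
    rw [hz j, coeff_zero, tsub_add_cancel_of_le (by simpa [Nat.one_le_iff_ne_zero] using hj)] at h1
    rcases mul_eq_zero.1 h1.symm with h2 | h2
    · exact (mem_support_iff.1 hm) h2
    · exact Nat.cast_add_one_ne_zero _ h2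
  rw [totalDegree_eq_zero_iff_eq_C] at this
  apply hf.not_isUnit
  rw [this]
  refine IsUnit.map C (isUnit_iff_ne_zero.2 fun h => hf.ne_zero ?_)
  rw [this, h, C_0]

/-- Powers of `t` are reduced by `t ^ 2 = w`. It will be applied with `t` the normal derivative of
`f`, which is only a square root of a polynomial. The clause on `A` serves the singular points,
where `h` and `w` both vanish. -/
theorem exists_pow_eq_add_mul {R : Type*} [CommRing R] (h w : R) (m : ℕ) :
    ∃ A B : R, ∀ (K : Type) [CommRing K] (φ : R →+* K) (t : K), t ^ 2 = φ w →
      (φ h + φ w * t) ^ (m + 1) = φ A + t * φ B ∧ (φ w = 0 → φ h = 0 → φ A = 0) := by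
  induction m with
  | zero => exact ⟨h, w, fun K _ φ t _ => ⟨by ring, fun _ h => h⟩⟩
  | succ m ih =>
    obtain ⟨A, B, hAB⟩ := ih
    refine ⟨h * A + w ^ 2 * B, h * B + w * A, fun K _ φ t ht => ⟨?_, fun h1 h2 => ?_⟩⟩
    · rw [pow_succ, (hAB K φ t ht).1]
      simp only [map_add, map_mul, map_pow]
      linear_combination φ w * φ B * ht
    · simp [h1, h2]

end

/-! ### Wirtinger operators on smooth functions and their nilpotency. -/

section

/-- The smooth complex valued functions on the plane. -/
def smoothFun : Submodule ℂ (ℂ → ℂ) where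
  carrier := {f | ContDiff ℝ ∞ f}
  add_mem' {f g} (hf : ContDiff ℝ ∞ f) (hg : ContDiff ℝ ∞ g) := hf.add hg
  zero_mem' := (contDiff_const : ContDiff ℝ ∞ fun _ : ℂ => (0 : ℂ))
  smul_mem' c f (hf : ContDiff ℝ ∞ f) := hf.const_smul c

theorem contDiff_fderiv_apply {f : ℂ → ℂ} (hf : ContDiff ℝ ∞ f) (v : ℂ) :
    ContDiff ℝ ∞ fun x => fderiv ℝ f x v :=
  (hf.fderiv_right (m := ∞) (by simp)).clm_apply contDiff_const

theorem smoothFun_differentiable (f : smoothFun) : Differentiable ℝ (f : ℂ → ℂ) :=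
  have h : ContDiff ℝ ∞ (f : ℂ → ℂ) := f.2
  h.differentiable (by simp)

/-- The derivative in the direction `v` as an operator on smooth functions. -/
def dirDeriv (v : ℂ) : Module.End ℂ smoothFun where
  toFun f := ⟨fun x => fderiv ℝ (f : ℂ → ℂ) x v, contDiff_fderiv_apply f.2 v⟩
  map_add' f g := by
    ext x
    simp [fderiv_add (smoothFun_differentiable f x) (smoothFun_differentiable g x)]
  map_smul' c f := by
    ext x
    simp [fderiv_const_smul (smoothFun_differentiable f x)]

theorem dirDeriv_apply (v : ℂ) (f : smoothFun) (x : ℂ) :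
    (dirDeriv v f : ℂ → ℂ) x = fderiv ℝ (f : ℂ → ℂ) x v := rfl

theorem dirDeriv_commute (v w : ℂ) : Commute (dirDeriv v) (dirDeriv w) := by
  apply LinearMap.ext
  intro f
  ext x
  have hf : ContDiff ℝ ∞ (f : ℂ → ℂ) := f.2
  have hd : DifferentiableAt ℝ (fderiv ℝ (f : ℂ → ℂ)) x :=
    ((hf.fderiv_right (m := ∞) (by simp)).differentiable (by simp)) x
  have key : ∀ a b : ℂ, fderiv ℝ (fun y => fderiv ℝ (f : ℂ → ℂ) y a) x b
      = fderiv ℝ (fderiv ℝ (f : ℂ → ℂ)) x b a := fun a b => by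
    rw [fderiv_clm_apply hd (differentiableAt_const a)]
    simp
  have hf2 : ContDiff ℝ 2 (f : ℂ → ℂ) := contDiff_infty.1 hf 2
  have hsymm := (hf2.contDiffAt (x := x)).isSymmSndFDerivAt (by simp)
  change fderiv ℝ (fun y => fderiv ℝ (f : ℂ → ℂ) y w) x v
    = fderiv ℝ (fun y => fderiv ℝ (f : ℂ → ℂ) y v) x w
  rw [key, key, hsymm.eq]

/-- The Wirtinger operator `∂ / ∂z`. -/
def wirtinger : Module.End ℂ smoothFun := (1 / 2 : ℂ) • (dirDeriv 1 - Complex.I • dirDeriv Complex.I)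

/-- The Wirtinger operator `∂ / ∂z̄`. -/
def wirtingerBar : Module.End ℂ smoothFun :=
  (1 / 2 : ℂ) • (dirDeriv 1 + Complex.I • dirDeriv Complex.I)

theorem wirtinger_commute : Commute wirtinger wirtingerBar := by
  have h := dirDeriv_commute 1 Complex.I
  unfold wirtinger wirtingerBar
  refine ((Commute.sub_left (R := Module.End ℂ smoothFun) ?_ ?_).smul_left _).smul_right _
  · exact (Commute.refl _).add_right (h.smul_right _)
  · exact ((h.symm).add_right ((Commute.refl _).smul_right _)).smul_left _

theorem dirDeriv_one_eq : dirDeriv 1 = wirtinger + wirtingerBar := by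
  unfold wirtinger wirtingerBar
  module

theorem eq_I_smul_add_neg {M : Type*} [AddCommGroup M] [Module ℂ M] (A B : Module.End ℂ M) :
    B = Complex.I • ((1 / 2 : ℂ) • (A - Complex.I • B) + -((1 / 2 : ℂ) • (A + Complex.I • B))) := by
  have : Complex.I • ((1 / 2 : ℂ) • (A - Complex.I • B) + -((1 / 2 : ℂ) • (A + Complex.I • B)))
      = -(Complex.I * Complex.I) • B := by module
  rw [this, Complex.I_mul_I]; simp

theorem dirDeriv_I_eq : dirDeriv Complex.I = Complex.I • (wirtinger + -wirtingerBar) :=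
  eq_I_smul_add_neg _ _

theorem fderiv_eq_wirtinger (f : smoothFun) (x u : ℂ) :
    fderiv ℝ (f : ℂ → ℂ) x u
      = (wirtinger f : ℂ → ℂ) x * u + (wirtingerBar f : ℂ → ℂ) x * (starRingEnd ℂ) u := by
  have h : fderiv ℝ (f : ℂ → ℂ) x u
      = u.re * fderiv ℝ (f : ℂ → ℂ) x 1 + u.im * fderiv ℝ (f : ℂ → ℂ) x Complex.I := by
    conv_lhs => rw [show u = u.re • (1 : ℂ) + u.im • Complex.I by simp]
    rw [map_add, map_smul, map_smul]; simp
  rw [h]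
  simp only [wirtinger, wirtingerBar, LinearMap.smul_apply, LinearMap.sub_apply,
    LinearMap.add_apply, Submodule.coe_smul, Submodule.coe_add, Submodule.coe_sub, Pi.smul_apply,
    Pi.add_apply, Pi.sub_apply, dirDeriv_apply, smul_eq_mul]
  conv_rhs => rw [← Complex.re_add_im u]
  simp only [map_add, map_mul, Complex.conj_ofReal, Complex.conj_I]
  linear_combination ((u.im : ℂ) * fderiv ℝ (f : ℂ → ℂ) x Complex.I) * Complex.I_sq

/-- The smooth functions that vanish on the set `U`. -/
def vanishingOn (U : Set ℂ) : Submodule ℂ smoothFun where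
  carrier := {f | ∀ x ∈ U, (f : ℂ → ℂ) x = 0}
  add_mem' hf hg x hx := by simp [hf x hx, hg x hx]
  zero_mem' x _ := rfl
  smul_mem' c f hf x hx := by simp [hf x hx]

theorem dirDeriv_mem_vanishingOn {U : Set ℂ} (hU : IsOpen U) (v : ℂ) {f : smoothFun}
    (hf : f ∈ vanishingOn U) : dirDeriv v f ∈ vanishingOn U := by
  intro x hx
  have : (f : ℂ → ℂ) =ᶠ[nhds x] fun _ => 0 :=
    Filter.mem_of_superset (hU.mem_nhds hx) fun y hy => hf y hy
  rw [dirDeriv_apply, this.fderiv_eq]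
  simp

theorem wirtinger_mem_vanishingOn {U : Set ℂ} (hU : IsOpen U) {f : smoothFun}
    (hf : f ∈ vanishingOn U) : wirtinger f ∈ vanishingOn U ∧ wirtingerBar f ∈ vanishingOn U := by
  have h1 := dirDeriv_mem_vanishingOn hU 1 hf
  have h2 := dirDeriv_mem_vanishingOn hU Complex.I hf
  exact ⟨Submodule.smul_mem _ _ (Submodule.sub_mem _ h1 (Submodule.smul_mem _ _ h2)),
    Submodule.smul_mem _ _ (Submodule.add_mem _ h1 (Submodule.smul_mem _ _ h2))⟩

theorem pow_apply_mem {R M : Type*} [CommRing R] [AddCommGroup M] [Module R M]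
    {T : Module.End R M} {V : Submodule R M} (hT : ∀ f ∈ V, T f ∈ V) (k : ℕ) {f : M} (hf : f ∈ V) :
    (T ^ k) f ∈ V := by
  induction k with
  | zero => simpa
  | succ k ih => rw [pow_succ', Module.End.mul_apply]; exact hT _ ih

theorem neg_pow_apply_mem {R M : Type*} [CommRing R] [AddCommGroup M] [Module R M]
    {T : Module.End R M} {V : Submodule R M} (k : ℕ) {f : M} (hf : (T ^ k) f ∈ V) :
    ((-T) ^ k) f ∈ V := by
  rcases neg_one_pow_eq_or (Module.End R M) k with h | h <;> rw [neg_pow, h] <;> simp [hf]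

theorem pow_apply_mem_of_le {R M : Type*} [CommRing R] [AddCommGroup M] [Module R M]
    {T : Module.End R M} {V : Submodule R M} (hT : ∀ f ∈ V, T f ∈ V) {k l : ℕ} (hkl : k ≤ l) {f : M}
    (hf : (T ^ k) f ∈ V) : (T ^ l) f ∈ V := by
  obtain ⟨d, rfl⟩ := Nat.exists_eq_add_of_le' hkl
  rw [pow_add, Module.End.mul_apply]
  exact pow_apply_mem hT d hf

/-- In each term of the binomial expansion of order `2k` one of the two exponents is at least `k`.
Working modulo `V` allows functions that are annihilated only on an open set. -/
theorem sum_pow_apply_mem {R M : Type*} [CommRing R] [AddCommGroup M] [Module R M]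
    {S T : Module.End R M} (hST : Commute S T) {V : Submodule R M} (hS : ∀ f ∈ V, S f ∈ V)
    (hT : ∀ f ∈ V, T f ∈ V) {k : ℕ} {f : M} (hSf : (S ^ k) f ∈ V) (hTf : (T ^ k) f ∈ V) :
    ((S + T) ^ (k + k)) f ∈ V := by
  rw [hST.add_pow, LinearMap.sum_apply]
  refine Submodule.sum_mem _ fun i hi => ?_
  rw [Module.End.mul_apply]
  have hc : ((k + k).choose i : Module.End R M) f = ((k + k).choose i : R) • f := by
    rw [← map_natCast (algebraMap R (Module.End R M)), Module.algebraMap_end_apply]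
  rw [hc, map_smul, Module.End.mul_apply]
  refine Submodule.smul_mem _ _ ?_
  rcases le_total k i with h | h
  · rw [← Module.End.mul_apply, (hST.pow_pow _ _).eq, Module.End.mul_apply]
    exact pow_apply_mem hT _ (pow_apply_mem_of_le hS h hSf)
  · exact pow_apply_mem hS _ (pow_apply_mem_of_le hT (by omega) hTf)

theorem add_neg_pow_apply_mem {R M : Type*} [CommRing R] [AddCommGroup M] [Module R M]
    {S T : Module.End R M} (hST : Commute S T) {V : Submodule R M} (hS : ∀ f ∈ V, S f ∈ V)
    (hT : ∀ f ∈ V, T f ∈ V) {k : ℕ} {f : M} (hSf : (S ^ k) f ∈ V) (hTf : (T ^ k) f ∈ V) :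
    ((S + -T) ^ (k + k)) f ∈ V :=
  sum_pow_apply_mem hST.neg_right hS (fun f hf => Submodule.neg_mem _ (hT f hf)) hSf
    (neg_pow_apply_mem _ hTf)

/-- The recursion for the Fourier coefficients of a smooth solution of the flow equation forces high
Wirtinger derivatives to vanish. -/
theorem wirtinger_pow_mem {U : Set ℂ} (hU : IsOpen U) (c : ℕ → smoothFun) (κ : ℕ → ℂ) (M : ℕ)
    (hc : ∀ m, M < m → c m = 0)
    (h : ∀ m, wirtinger (c m) + κ (m + 1) • c (m + 1) + wirtingerBar (c (m + 2)) ∈ vanishingOn U)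
    (h1 : κ 0 • c 0 + wirtingerBar (c 1) ∈ vanishingOn U)
    (h0 : wirtingerBar (c 0) ∈ vanishingOn U) (m : ℕ) :
    (wirtinger ^ (M + 1)) (c m) ∈ vanishingOn U ∧
      (wirtingerBar ^ (M + 1)) (c m) ∈ vanishingOn U := by
  have hW := fun f hf => (wirtinger_mem_vanishingOn hU (f := f) hf).1
  have hWb := fun f hf => (wirtinger_mem_vanishingOn hU (f := f) hf).2
  -- Downwards from `c m = 0` for `m > M`: the recursion expresses `∂ (c m)` through `c (m + 1)` and
  -- `∂̄ (c (m + 2))`.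
  have hdown : ∀ l m, M + 1 ≤ m + l → (wirtinger ^ l) (c m) ∈ vanishingOn U := by
    intro l
    induction l using Nat.strong_induction_on with
    | _ l ih =>
      intro m hm
      cases l with
      | zero => rw [hc m (by omega), map_zero]; exact Submodule.zero_mem _
      | succ l =>
        have e1 := pow_apply_mem hW l (h m)
        rw [map_add, map_add, map_smul] at e1
        have e2 := ih l (by omega) (m + 1) (by omega)
        have e3 : (wirtinger ^ l) (wirtingerBar (c (m + 2))) ∈ vanishingOn U := by
          rw [← Module.End.mul_apply, (wirtinger_commute.pow_left l).eq, Module.End.mul_apply]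
          cases l with
          | zero =>
            rw [hc (m + 2) (by omega), map_zero, map_zero]; exact Submodule.zero_mem _
          | succ l =>
            exact hWb _ (ih (l + 1) (by omega) (m + 2) (by omega))
        rw [pow_succ, Module.End.mul_apply]
        have := Submodule.sub_mem _ (Submodule.sub_mem _ e1 e3) (Submodule.smul_mem _ (κ (m + 1)) e2)
        convert! this using 1
        abel
  -- Upwards from `∂̄ (c 0) = 0`: the same recursion expresses `∂̄ (c (m + 2))` through `∂ (c m)`
  -- and `c (m + 1)`.
  have hup : ∀ m, (wirtingerBar ^ (m + 1)) (c m) ∈ vanishingOn U := by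
    intro m
    induction m using Nat.strong_induction_on with
    | _ m ih =>
      match m with
      | 0 => simpa using h0
      | 1 =>
        have e1 := hWb _ h1
        rw [map_add, map_smul] at e1
        have := Submodule.sub_mem _ e1 (Submodule.smul_mem _ (κ 0) h0)
        convert! this using 1
        rw [pow_succ, pow_one, Module.End.mul_apply]; abel
      | m + 2 =>
        have e1 := pow_apply_mem hWb (m + 2) (h m)
        rw [map_add, map_add, map_smul] at e1
        have e2 := ih (m + 1) (by omega)
        have e3 : (wirtingerBar ^ (m + 2)) (wirtinger (c m)) ∈ vanishingOn U := by
          rw [← Module.End.mul_apply, (wirtinger_commute.symm.pow_left _).eq, Module.End.mul_apply]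
          exact hW _ (pow_apply_mem_of_le hWb (by omega) (ih m (by omega)))
        rw [pow_succ, Module.End.mul_apply]
        have := Submodule.sub_mem _ (Submodule.sub_mem _ e1 e3) (Submodule.smul_mem _ (κ (m + 1)) e2)
        convert! this using 1
        abel
  by_cases hm : m ≤ M
  · exact ⟨hdown _ _ (by omega), pow_apply_mem_of_le hWb (by omega) (hup m)⟩
  · rw [hc m (by omega), map_zero, map_zero]
    exact ⟨Submodule.zero_mem _, Submodule.zero_mem _⟩

theorem dirDeriv_pow_mem {U : Set ℂ} (hU : IsOpen U) {f : smoothFun} {k : ℕ}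
    (h1 : (wirtinger ^ k) f ∈ vanishingOn U) (h2 : (wirtingerBar ^ k) f ∈ vanishingOn U) :
    (dirDeriv 1 ^ (k + k)) f ∈ vanishingOn U ∧ (dirDeriv Complex.I ^ (k + k)) f ∈ vanishingOn U := by
  have hW := fun f hf => (wirtinger_mem_vanishingOn hU (f := f) hf).1
  have hWb := fun f hf => (wirtinger_mem_vanishingOn hU (f := f) hf).2
  constructor
  · rw [dirDeriv_one_eq]
    exact sum_pow_apply_mem wirtinger_commute hW hWb h1 h2
  · rw [dirDeriv_I_eq, smul_pow, LinearMap.smul_apply]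
    refine Submodule.smul_mem _ _ (add_neg_pow_apply_mem wirtinger_commute hW hWb h1 h2)

end

/-! ### Fourier coefficients in the velocity, short-time invariance, mollification. -/

section

theorem star_eq_inv_of_norm_one {u : ℂ} (hu : ‖u‖ = 1) : (starRingEnd ℂ) u = u⁻¹ := by
  rw [Complex.inv_def, Complex.normSq_eq_norm_sq, hu]; simp

theorem ne_zero_of_norm_one {u : ℂ} (hu : ‖u‖ = 1) : u ≠ 0 := by
  rintro rfl; simp at hu

theorem infinite_unit_circle : {u : ℂ | ‖u‖ = 1}.Infinite := by
  have h : Set.InjOn (fun t : ℝ => Complex.exp (t * Complex.I)) (Set.Ioo 0 1) := by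
    intro x hx y hy hxy
    obtain ⟨n, hn⟩ := Complex.exp_eq_exp_iff_exists_int.1 hxy
    have h1 : x = y + n * (2 * Real.pi) := by
      have := congrArg Complex.im hn
      simpa using this
    have h2 : |(n : ℝ) * (2 * Real.pi)| < 1 := by
      rw [show (n : ℝ) * (2 * Real.pi) = x - y by linarith, abs_lt]
      constructor <;> linarith [hx.1, hx.2, hy.1, hy.2]
    have h3 : n = 0 := by
      by_contra hn0
      have h4 : (1 : ℝ) ≤ |(n : ℝ)| := by exact_mod_cast Int.one_le_abs hn0
      rw [abs_mul, abs_of_pos Real.two_pi_pos] at h2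
      nlinarith [Real.pi_gt_three]
    simpa [h3] using h1
  refine ((Set.Ioo_infinite zero_lt_one).image h).mono ?_
  rintro _ ⟨t, -, rfl⟩
  exact Complex.norm_exp_ofReal_mul_I t

theorem poly_eq_zero_of_unit_circle {Q : Polynomial ℂ} (h : ∀ u : ℂ, ‖u‖ = 1 → Q.eval u = 0) :
    Q = 0 :=
  Polynomial.eq_zero_of_infinite_isRoot _ (infinite_unit_circle.mono fun u hu => h u hu)

open Polynomial in
/-- A function that is polynomial in the velocity has finitely many Fourier coefficients, which
extend to continuous functions on the plane. -/
theorem exists_fourier_coefficients {S : Set ℂ} (hS : IsClosed S) {Φ : ℂ → ℂ → ℝ} {N : ℕ}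
    {a : ℕ → ℕ → ℂ → ℝ} (ha : ∀ k l, ContinuousOn (a k l) S)
    (hΦ : ∀ x ∈ S, ∀ v : ℂ, ‖v‖ = 1 → Φ x v = ∑ k ∈ Finset.range (N + 1),
      ∑ l ∈ Finset.range (N + 1 - k), a k l x * v.re ^ k * v.im ^ l) :
    ∃ b : ℕ → ℂ → ℂ, (∀ j, Continuous (b j)) ∧ (∀ j, 2 * N < j → b j = 0) ∧
      ∀ x ∈ S, ∀ u : ℂ, ‖u‖ = 1 →
        (Φ x u : ℂ) * u ^ N = ∑ j ∈ Finset.range (2 * N + 1), b j x * u ^ j := by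
  -- Tietze's theorem; globally defined coefficients can be convolved with a bump function.
  have hext : ∀ k l, ∃ g : C(ℂ, ℝ), ∀ x ∈ S, g x = a k l x := fun k l => by
    obtain ⟨g, hg⟩ := ContinuousMap.exists_restrict_eq hS ⟨S.domRestrict (a k l), (ha k l).domRestrict⟩
    exact ⟨g, fun x hx => DFunLike.congr_fun hg ⟨x, hx⟩⟩
  choose g hg using hext
  -- For `|u| = 1` one has `u * re u = (u ^ 2 + 1) / 2` and `u * im u = (u ^ 2 - 1) / (2 * I)`; the
  -- polynomial `p k l` is `u ^ N * (re u) ^ k * (im u) ^ l`.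
  let p : ℕ → ℕ → ℂ[X] := fun k l => X ^ (N - k - l) * (C (1 / 2) * (X ^ 2 + 1)) ^ k *
    (C (1 / (2 * Complex.I)) * (X ^ 2 - 1)) ^ l
  have hdeg : ∀ k l, k + l ≤ N → (p k l).natDegree ≤ 2 * N := fun k l hkl => by
    have h1 : (C (1 / 2) * (X ^ 2 + 1) : ℂ[X]).natDegree ≤ 2 := by compute_degree
    have h2 : (C (1 / (2 * Complex.I)) * (X ^ 2 - 1) : ℂ[X]).natDegree ≤ 2 := by compute_degree
    have h3 := natDegree_pow_le_of_le k h1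
    have h4 := natDegree_pow_le_of_le l h2
    have h5 : (X ^ (N - k - l) : ℂ[X]).natDegree ≤ N - k - l := natDegree_X_pow_le _
    have := natDegree_mul_le_of_le (natDegree_mul_le_of_le h5 h3) h4
    refine this.trans ?_
    omega
  have heval : ∀ k l, k + l ≤ N → ∀ u : ℂ, ‖u‖ = 1 →
      (p k l).eval u = u ^ N * ((u.re : ℂ) ^ k * (u.im : ℂ) ^ l) := fun k l hkl u hu => by
    have hu0 := ne_zero_of_norm_one hu
    have hre : u * (u.re : ℂ) = 1 / 2 * (u ^ 2 + 1) := by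
      rw [Complex.re_eq_add_conj, star_eq_inv_of_norm_one hu]; field_simp
    have him : u * (u.im : ℂ) = 1 / (2 * Complex.I) * (u ^ 2 - 1) := by
      rw [Complex.im_eq_sub_conj, star_eq_inv_of_norm_one hu]; field_simp
    have hN : u ^ N = u ^ (N - k - l) * u ^ k * u ^ l := by
      rw [← pow_add, ← pow_add]; congr 1; omega
    simp only [p, eval_mul, eval_pow, eval_C, eval_X, eval_add, eval_sub, eval_one]
    rw [← hre, ← him, hN, mul_pow, mul_pow]
    ring
  refine ⟨fun j x => if 2 * N < j then 0 else ∑ k ∈ Finset.range (N + 1),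
    ∑ l ∈ Finset.range (N + 1 - k), (g k l x : ℂ) * (p k l).coeff j, fun j => ?_, fun j hj => ?_,
    fun x hx u hu => ?_⟩
  · beta_reduce
    split_ifs
    · exact continuous_const
    · fun_prop
  · ext x; simp [hj]
  · rw [hΦ x hx u hu]
    have hL : ((∑ k ∈ Finset.range (N + 1), ∑ l ∈ Finset.range (N + 1 - k),
        a k l x * u.re ^ k * u.im ^ l : ℝ) : ℂ) * u ^ N = ∑ k ∈ Finset.range (N + 1),
        ∑ l ∈ Finset.range (N + 1 - k), (g k l x : ℂ) * (p k l).eval u := by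
      push_cast
      simp only [Finset.sum_mul]
      refine Finset.sum_congr rfl fun k hk => Finset.sum_congr rfl fun l hl => ?_
      rw [Finset.mem_range] at hk hl
      rw [heval k l (by omega) u hu, hg k l x hx]; ring
    rw [hL]
    have hR : ∀ j ∈ Finset.range (2 * N + 1), (if 2 * N < j then 0 else
        ∑ k ∈ Finset.range (N + 1), ∑ l ∈ Finset.range (N + 1 - k),
          (g k l x : ℂ) * (p k l).coeff j) * u ^ j = ∑ k ∈ Finset.range (N + 1),
        ∑ l ∈ Finset.range (N + 1 - k), (g k l x : ℂ) * ((p k l).coeff j * u ^ j) := by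
      intro j hj
      rw [Finset.mem_range] at hj
      rw [if_neg (by omega)]
      simp only [Finset.sum_mul, mul_assoc]
    rw [Finset.sum_congr rfl hR, Finset.sum_comm]
    refine Finset.sum_congr rfl fun k hk => ?_
    rw [Finset.sum_comm]
    refine Finset.sum_congr rfl fun l hl => ?_
    rw [Finset.mem_range] at hk hl
    rw [eval_eq_sum_range' (n := 2 * N + 1) (by have := hdeg k l (by omega); omega),
      Finset.mul_sum]

/-- The displacement after time `t` of a particle with initial velocity `1`. -/
def displacement (β t : ℝ) : ℂ :=
  ((1 / β : ℝ) : ℂ) * Complex.I * (1 - Complex.exp (((β * t : ℝ) : ℂ) * Complex.I))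

theorem flowPosition_eq (β t : ℝ) (x v : ℂ) :
    flowPosition β t x v = x + displacement β t * v := by
  simp only [flowPosition, larmorCenter, flowVelocity, displacement]; ring

theorem hasDerivAt_rotation (β t : ℝ) :
    HasDerivAt (fun t : ℝ => Complex.exp (((β * t : ℝ) : ℂ) * Complex.I))
      (Complex.exp (((β * t : ℝ) : ℂ) * Complex.I) * (β * Complex.I)) t := by
  have h1 : HasDerivAt (fun t : ℝ => ((β * t : ℝ) : ℂ) * Complex.I) (β * Complex.I) t := by
    have := (((hasDerivAt_id t).const_mul β).ofReal_comp).mul_const Complex.I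
    simpa using this
  exact h1.cexp

theorem hasDerivAt_displacement {β : ℝ} (hβ : β ≠ 0) (t : ℝ) :
    HasDerivAt (displacement β) (Complex.exp (((β * t : ℝ) : ℂ) * Complex.I)) t := by
  have h := ((hasDerivAt_rotation β t).const_sub 1).const_mul (((1 / β : ℝ) : ℂ) * Complex.I)
  convert! h using 1
  have : (β : ℂ) ≠ 0 := by exact_mod_cast hβ
  push_cast
  field_simp
  rw [Complex.I_sq]; ring

theorem displacement_zero (β : ℝ) : displacement β 0 = 0 := by simp [displacement]

theorem norm_rotation (β t : ℝ) : ‖Complex.exp (((β * t : ℝ) : ℂ) * Complex.I)‖ = 1 :=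
  Complex.norm_exp_ofReal_mul_I _

theorem norm_displacement_le {β : ℝ} (hβ : β ≠ 0) {t : ℝ} (ht : 0 ≤ t) :
    ‖displacement β t‖ ≤ t := by
  have h := (convex_univ (𝕜 := ℝ) (E := ℝ)).norm_image_sub_le_of_norm_hasDerivWithin_le
    (f := displacement β) (C := 1) (fun x _ => (hasDerivAt_displacement hβ x).hasDerivWithinAt)
    (fun x _ => (norm_rotation β x).le) (Set.mem_univ 0) (Set.mem_univ t)
  simpa [displacement_zero, abs_of_nonneg ht] using h

/-- The Fourier coefficients `b` are those of a function that is invariant under the flow for a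
short time, as long as the initial position is in `U`. -/
def FlowInvariantOn (β ε : ℝ) (N : ℕ) (b : ℕ → ℂ → ℂ) (U : Set ℂ) : Prop :=
  ∀ x ∈ U, ∀ u : ℂ, ‖u‖ = 1 → ∀ t ∈ Set.Ico 0 ε,
    ∑ j ∈ Finset.range (2 * N + 1), b j (x + displacement β t * u) *
        (Complex.exp (((β * t : ℝ) : ℂ) * Complex.I) * u) ^ j
      = Complex.exp (((β * t : ℝ) : ℂ) * Complex.I) ^ N *
        ∑ j ∈ Finset.range (2 * N + 1), b j x * u ^ j

open MeasureTheory Convolution in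
/-- Regularization of a function by convolution with a bump function. -/
def mollify (φ : ContDiffBump (0 : ℂ)) (g : ℂ → ℂ) : ℂ → ℂ :=
  (φ.normed volume ⋆[ContinuousLinearMap.lsmul ℝ ℝ, volume] g)

open MeasureTheory

theorem mollify_apply (φ : ContDiffBump (0 : ℂ)) (g : ℂ → ℂ) (x : ℂ) :
    mollify φ g x = ∫ y, φ.normed volume y • g (x - y) := by
  rw [mollify, convolution_lsmul]

theorem contDiff_mollify (φ : ContDiffBump (0 : ℂ)) {g : ℂ → ℂ} (hg : Continuous g) :
    ContDiff ℝ ∞ (mollify φ g) :=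
  φ.hasCompactSupport_normed.contDiff_convolution_left _ φ.contDiff_normed hg.locallyIntegrable

theorem integrable_mollify (φ : ContDiffBump (0 : ℂ)) {g : ℂ → ℂ} (hg : Continuous g) (x : ℂ) :
    Integrable fun y => φ.normed volume y • g (x - y) := by
  apply Continuous.integrable_of_hasCompactSupport
  · exact φ.continuous_normed.smul (hg.comp (continuous_const.sub continuous_id))
  · exact φ.hasCompactSupport_normed.smul_right

/-- The invariance is linear in `b` and its displacements do not depend on `x`, so averaging over
translations by less than `δ` preserves it. This costs a margin `δ` in the domain. -/
theorem FlowInvariantOn.mollify {β ε δ : ℝ} {N : ℕ} {b : ℕ → ℂ → ℂ} {x₀ : ℂ}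
    (hb : ∀ j, Continuous (b j)) (h : FlowInvariantOn β ε N b (Metric.ball x₀ (δ + δ)))
    (φ : ContDiffBump (0 : ℂ)) (hφ : φ.rOut ≤ δ) :
    FlowInvariantOn β ε N (fun j => mollify φ (b j)) (Metric.ball x₀ δ) := by
  intro x hx u hu t ht
  have hsum : ∀ (z : ℂ) (c : ℕ → ℂ), ∑ j ∈ Finset.range (2 * N + 1), MagneticBilliard.mollify φ (b j) z * c j
      = ∫ y, φ.normed volume y • ∑ j ∈ Finset.range (2 * N + 1), b j (z - y) * c j := fun z c => by
    simp only [mollify_apply, Finset.smul_sum]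
    rw [integral_finsetSum]
    · refine Finset.sum_congr rfl fun j _ => ?_
      rw [← integral_mul_const]
      simp only [smul_mul_assoc]
    · intro j _
      simpa only [smul_mul_assoc] using (integrable_mollify φ (hb j) z).mul_const (c j)
  simp only [hsum]
  rw [← integral_const_mul]
  refine integral_congr_ae (Filter.Eventually.of_forall fun y => ?_)
  by_cases hy : y ∈ Metric.ball (0 : ℂ) φ.rOut
  · have hxy : x - y ∈ Metric.ball x₀ (δ + δ) := by
      rw [Metric.mem_ball, dist_eq_norm] at hx ⊢
      rw [mem_ball_zero_iff] at hy
      calc ‖x - y - x₀‖ = ‖(x - x₀) - y‖ := by ring_nf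
        _ ≤ ‖x - x₀‖ + ‖y‖ := norm_sub_le _ _
        _ < δ + δ := by linarith
    have := h (x - y) hxy u hu t ht
    simp only [mul_smul_comm]
    rw [← this]
    simp only [add_sub_right_comm]
  · rw [← φ.support_normed_eq (μ := volume), Function.notMem_support] at hy
    simp [hy]

end

/-! ### Polynomials of bounded degree on a square, via interpolation. -/

section

theorem exists_antiderivative (Q : Polynomial ℂ) : ∃ P : Polynomial ℂ, P.derivative = Q ∧
    P.natDegree ≤ Q.natDegree + 1 := by
  refine ⟨∑ n ∈ Finset.range (Q.natDegree + 1), Polynomial.monomial (n + 1) (Q.coeff n / (n + 1)),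
    ?_, ?_⟩
  · rw [Polynomial.derivative_sum]
    conv_rhs => rw [Q.as_sum_range]
    refine Finset.sum_congr rfl fun n _ => ?_
    rw [Polynomial.derivative_monomial, Nat.add_sub_cancel]
    congr 1
    have : (n + 1 : ℂ) ≠ 0 := Nat.cast_add_one_ne_zero n
    push_cast
    field_simp
  · refine Polynomial.natDegree_sum_le_of_forall_le _ _ fun n hn => ?_
    rw [Finset.mem_range] at hn
    exact (Polynomial.natDegree_monomial_le _).trans (by omega)

/-- A function on an interval whose derivative of order `K` vanishes is a polynomial of degree less
than `K`. -/
theorem exists_polynomial_of_iterate_deriv_zero {s₀ s₁ : ℝ} (K : ℕ) (g : ℕ → ℝ → ℂ)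
    (hg : ∀ k, ∀ t ∈ Set.Ioo s₀ s₁, HasDerivAt (g k) (g (k + 1) t) t)
    (h0 : ∀ t ∈ Set.Ioo s₀ s₁, g (K + 1) t = 0) :
    ∃ P : Polynomial ℂ, P.natDegree ≤ K ∧ ∀ t ∈ Set.Ioo s₀ s₁, g 0 t = P.eval (t : ℂ) := by
  have hconst : ∀ h : ℝ → ℂ, (∀ t ∈ Set.Ioo s₀ s₁, HasDerivAt h 0 t) →
      ∃ c, ∀ t ∈ Set.Ioo s₀ s₁, h t = c := fun h hh => by
    rcases (Set.Ioo s₀ s₁).eq_empty_or_nonempty with he | ⟨t₀, ht₀⟩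
    · exact ⟨0, by simp [he]⟩
    · refine ⟨h t₀, fun t ht => ?_⟩
      exact isOpen_Ioo.is_const_of_deriv_eq_zero (convex_Ioo s₀ s₁).isPreconnected
        (fun x hx => (hh x hx).differentiableAt.differentiableWithinAt)
        (fun x hx => (hh x hx).deriv) ht ht₀
  induction K generalizing g with
  | zero =>
    obtain ⟨c, hc⟩ := hconst (g 0) fun t ht => by simpa [h0 t ht] using hg 0 t ht
    exact ⟨Polynomial.C c, by simp, fun t ht => by simp [hc t ht]⟩
  | succ K ih =>
    obtain ⟨Q, hQd, hQ⟩ := ih (fun k => g (k + 1)) (fun k => hg (k + 1)) h0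
    obtain ⟨P, hP, hPd⟩ := exists_antiderivative Q
    obtain ⟨c, hc⟩ := hconst (fun t => g 0 t - P.eval (t : ℂ)) fun t ht => by
      have h1 := (hg 0 t ht).sub ((P.hasDerivAt (t : ℂ)).comp_ofReal)
      rw [hP, ← hQ t ht, sub_self] at h1
      exact h1
    refine ⟨P + Polynomial.C c, ?_, fun t ht => ?_⟩
    · exact (Polynomial.natDegree_add_C).le.trans (hPd.trans (by omega))
    · rw [Polynomial.eval_add, Polynomial.eval_C, ← hc t ht]; ring

/-- The partial derivatives of a smooth function along a line. -/
theorem hasDerivAt_dirDeriv_pow (f : smoothFun) (v x : ℂ) (k : ℕ) (t : ℝ) :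
    HasDerivAt (fun t : ℝ => ((dirDeriv v ^ k) f : ℂ → ℂ) (x + t * v))
      (((dirDeriv v ^ (k + 1)) f : ℂ → ℂ) (x + t * v)) t := by
  have h1 : HasDerivAt (fun t : ℝ => x + t * v) v t := by
    simpa using ((Complex.ofRealCLM.hasDerivAt (x := t)).mul_const v).const_add x
  have h2 := (smoothFun_differentiable ((dirDeriv v ^ k) f) (x + t * v)).hasFDerivAt
  have h3 := h2.comp_hasDerivAt t h1
  rw [pow_succ', Module.End.mul_apply, dirDeriv_apply]
  exact h3

/-- The open square with centre `x₀` and side length `2 η`. -/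
def square (x₀ : ℂ) (η : ℝ) : Set ℂ := {x | |x.re - x₀.re| < η ∧ |x.im - x₀.im| < η}

theorem square_subset_ball (x₀ : ℂ) (η : ℝ) : square x₀ η ⊆ Metric.ball x₀ (η + η) := by
  rintro x ⟨h1, h2⟩
  rw [Metric.mem_ball, dist_eq_norm]
  refine (Complex.norm_le_abs_re_add_abs_im _).trans_lt ?_
  simp only [Complex.sub_re, Complex.sub_im]
  linarith

theorem isOpen_square (x₀ : ℂ) (η : ℝ) : IsOpen (square x₀ η) := by
  have h1 : IsOpen {x : ℂ | |x.re - x₀.re| < η} := isOpen_lt (by fun_prop) continuous_const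
  have h2 : IsOpen {x : ℂ | |x.im - x₀.im| < η} := isOpen_lt (by fun_prop) continuous_const
  exact h1.inter h2

/-- Interpolation nodes near `c`. -/
def interpolationNode (c η : ℝ) (K i : ℕ) : ℝ := c + η * (i / (K + 1))

theorem interpolationNode_mem {c η : ℝ} (hη : 0 < η) {K i : ℕ} (hi : i ∈ Finset.range (K + 1)) :
    |interpolationNode c η K i - c| < η := by
  rw [Finset.mem_range] at hi
  have hK : (0 : ℝ) < K + 1 := by positivity
  have h1 : (i : ℝ) / (K + 1) < 1 := by
    rw [div_lt_one hK]; exact_mod_cast hi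
  have h2 : (0 : ℝ) ≤ (i : ℝ) / (K + 1) := by positivity
  rw [interpolationNode, add_sub_cancel_left, abs_of_nonneg (by positivity)]
  nlinarith

theorem interpolationNode_injective {c η : ℝ} (hη : 0 < η) (K : ℕ) :
    Function.Injective fun i : ℕ => (interpolationNode c η K i : ℂ) := by
  intro i j hij
  have h1 : interpolationNode c η K i = interpolationNode c η K j := Complex.ofReal_injective hij
  have hK : (K + 1 : ℝ) ≠ 0 := by positivity
  simp only [interpolationNode, add_right_inj, mul_eq_mul_left_iff, hη.ne', or_false] at h1
  rw [div_left_inj' hK] at h1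
  exact_mod_cast h1

/-- The Lagrange basis polynomials for the interpolation nodes. -/
def interpolationBasis (c η : ℝ) (K i : ℕ) : Polynomial ℂ :=
  Lagrange.basis (Finset.range (K + 1)) (fun i => (interpolationNode c η K i : ℂ)) i

theorem eval_eq_sum_interpolationBasis {c η : ℝ} (hη : 0 < η) {K : ℕ} {P : Polynomial ℂ}
    (hP : P.natDegree ≤ K) (z : ℂ) : P.eval z = ∑ i ∈ Finset.range (K + 1),
      P.eval (interpolationNode c η K i : ℂ) * (interpolationBasis c η K i).eval z := by
  have h := Lagrange.eq_interpolate (f := P) (s := Finset.range (K + 1))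
    (v := fun i => (interpolationNode c η K i : ℂ)) (interpolationNode_injective hη K).injOn
    (by rw [Finset.card_range]
        exact lt_of_le_of_lt Polynomial.degree_le_natDegree (by exact_mod_cast Nat.lt_succ_of_le hP))
  conv_lhs => rw [h, Lagrange.interpolate_apply]
  simp [Polynomial.eval_finsetSum, interpolationBasis]

/-- The interpolation identity for functions on a square that are polynomials of degree at most `K`
in each of the two coordinates. -/
def IsInterpolated (x₀ : ℂ) (η : ℝ) (K : ℕ) (f : ℂ → ℂ) : Prop :=
  ∀ x ∈ square x₀ η, f x = ∑ i ∈ Finset.range (K + 1), ∑ j ∈ Finset.range (K + 1),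
    f ⟨interpolationNode x₀.re η K i, interpolationNode x₀.im η K j⟩ *
      (interpolationBasis x₀.re η K i).eval (x.re : ℂ) *
      (interpolationBasis x₀.im η K j).eval (x.im : ℂ)

/-- On each horizontal and each vertical segment of the square `f` is a polynomial of degree at most
`K`, hence equal to its Lagrange interpolant; the two interpolations are composed. -/
theorem isInterpolated_of_dirDeriv_pow {x₀ : ℂ} {η : ℝ} (hη : 0 < η) {K : ℕ} (f : smoothFun)
    (h1 : (dirDeriv 1 ^ (K + 1)) f ∈ vanishingOn (square x₀ η))
    (h2 : (dirDeriv Complex.I ^ (K + 1)) f ∈ vanishingOn (square x₀ η)) :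
    IsInterpolated x₀ η K f := by
  have hmem : ∀ c t : ℝ, t ∈ Set.Ioo (c - η) (c + η) ↔ |t - c| < η := fun c t => by
    rw [abs_lt, Set.mem_Ioo]; constructor <;> rintro ⟨_, _⟩ <;> constructor <;> linarith
  have hx : ∀ y : ℝ, |y - x₀.im| < η → ∀ t : ℝ, |t - x₀.re| < η → (f : ℂ → ℂ) ⟨t, y⟩ =
      ∑ i ∈ Finset.range (K + 1), (f : ℂ → ℂ) ⟨interpolationNode x₀.re η K i, y⟩ *
        (interpolationBasis x₀.re η K i).eval (t : ℂ) := by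
    intro y hy
    have heq : ∀ t : ℝ, (y : ℂ) * Complex.I + t * 1 = ⟨t, y⟩ := fun t => by
      apply Complex.ext <;> simp
    obtain ⟨P, hPd, hP⟩ := exists_polynomial_of_iterate_deriv_zero (s₀ := x₀.re - η)
      (s₁ := x₀.re + η) K
      (fun k t => ((dirDeriv 1 ^ k) f : ℂ → ℂ) (y * Complex.I + t * 1))
      (fun k t _ => hasDerivAt_dirDeriv_pow f 1 _ k t)
      (fun t ht => h1 _ (by rw [heq]; exact ⟨(hmem _ _).1 ht, hy⟩))
    simp only [pow_zero, Module.End.one_apply, heq] at hP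
    intro t ht
    rw [hP t ((hmem _ _).2 ht), eval_eq_sum_interpolationBasis hη hPd (c := x₀.re)]
    refine Finset.sum_congr rfl fun i hi => ?_
    rw [hP _ ((hmem _ _).2 (interpolationNode_mem hη hi))]
  have hy : ∀ x : ℝ, |x - x₀.re| < η → ∀ t : ℝ, |t - x₀.im| < η → (f : ℂ → ℂ) ⟨x, t⟩ =
      ∑ i ∈ Finset.range (K + 1), (f : ℂ → ℂ) ⟨x, interpolationNode x₀.im η K i⟩ *
        (interpolationBasis x₀.im η K i).eval (t : ℂ) := by
    intro x hx
    have heq : ∀ t : ℝ, (x : ℂ) + t * Complex.I = ⟨x, t⟩ := fun t => by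
      apply Complex.ext <;> simp
    obtain ⟨P, hPd, hP⟩ := exists_polynomial_of_iterate_deriv_zero (s₀ := x₀.im - η)
      (s₁ := x₀.im + η) K
      (fun k t => ((dirDeriv Complex.I ^ k) f : ℂ → ℂ) (x + t * Complex.I))
      (fun k t _ => hasDerivAt_dirDeriv_pow f Complex.I _ k t)
      (fun t ht => h2 _ (by rw [heq]; exact ⟨hx, (hmem _ _).1 ht⟩))
    simp only [pow_zero, Module.End.one_apply, heq] at hP
    intro t ht
    rw [hP t ((hmem _ _).2 ht), eval_eq_sum_interpolationBasis hη hPd (c := x₀.im)]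
    refine Finset.sum_congr rfl fun i hi => ?_
    rw [hP _ ((hmem _ _).2 (interpolationNode_mem hη hi))]
  rintro ⟨a, b⟩ ⟨ha, hb⟩
  rw [hx b hb a ha]
  refine Finset.sum_congr rfl fun i hi => ?_
  rw [hy _ (interpolationNode_mem hη hi) b hb, Finset.sum_mul]
  exact Finset.sum_congr rfl fun j _ => by ring

theorem IsInterpolated.exists_mvPolynomial {x₀ : ℂ} {η : ℝ} {K : ℕ} {f : ℂ → ℂ}
    (h : IsInterpolated x₀ η K f) : ∃ P : MvPolynomial (Fin 2) ℂ,
      ∀ x ∈ square x₀ η, f x = MvPolynomial.eval (toC2 x) P := by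
  refine ⟨∑ i ∈ Finset.range (K + 1), ∑ j ∈ Finset.range (K + 1),
    MvPolynomial.C (f ⟨interpolationNode x₀.re η K i, interpolationNode x₀.im η K j⟩) *
      Polynomial.aeval (MvPolynomial.X 0) (interpolationBasis x₀.re η K i) *
      Polynomial.aeval (MvPolynomial.X 1) (interpolationBasis x₀.im η K j), fun x hx => ?_⟩
  have hev : ∀ (k : Fin 2) (Q : Polynomial ℂ),
      MvPolynomial.eval (toC2 x) (Polynomial.aeval (MvPolynomial.X k) Q) = Q.eval (toC2 x k) :=
    fun k Q => by
      rw [← MvPolynomial.coe_aeval_eq_eval, RingHom.coe_coe, ← Polynomial.aeval_algHom_apply,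
        MvPolynomial.aeval_X, Polynomial.coe_aeval_eq_eval]
  rw [h x hx]
  simp only [map_sum, map_mul, hev, MvPolynomial.eval_C]
  simp [toC2]

/-- The identity involves only finitely many point values, so, unlike a condition on derivatives, it
survives pointwise limits. This is what removes the mollification. -/
theorem IsInterpolated.of_tendsto {x₀ : ℂ} {η : ℝ} {K : ℕ} {f : ℂ → ℂ} {g : ℕ → ℂ → ℂ}
    (hg : ∀ n, IsInterpolated x₀ η K (g n))
    (hlim : ∀ x, Filter.Tendsto (fun n => g n x) Filter.atTop (nhds (f x))) :
    IsInterpolated x₀ η K f := by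
  intro x hx
  refine tendsto_nhds_unique (hlim x) ?_
  have := fun n => hg n x hx
  simp only [this]
  exact tendsto_finsetSum _ fun i _ => tendsto_finsetSum _ fun j _ =>
    ((hlim _).mul_const _).mul_const _

end

/-! ### The integral as a polynomial in the Larmor centre. -/

section

open Finset in
/-- The flow equation in terms of the Fourier coefficients. -/
theorem FlowInvariantOn.wirtinger_recursion {β ε : ℝ} (hβ : β ≠ 0) (hε : 0 < ε) {N : ℕ}
    {c : ℕ → smoothFun} (hc : ∀ m, 2 * N < m → c m = 0) {U : Set ℂ}
    (h : FlowInvariantOn β ε N (fun j => c j) U) {x : ℂ} (hx : x ∈ U) :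
    (∀ m : ℕ, (wirtinger (c m) : ℂ → ℂ) x +
        (Complex.I * β * (((m + 1 : ℕ) : ℂ) - N)) * (c (m + 1) : ℂ → ℂ) x +
        (wirtingerBar (c (m + 2)) : ℂ → ℂ) x = 0) ∧
      (Complex.I * β * (((0 : ℕ) : ℂ) - N)) * (c 0 : ℂ → ℂ) x +
        (wirtingerBar (c 1) : ℂ → ℂ) x = 0 ∧
      (wirtingerBar (c 0) : ℂ → ℂ) x = 0 := by
  have hpde : ∀ u : ℂ, ‖u‖ = 1 → ∑ j ∈ range (2 * N + 1),
      (fderiv ℝ (c j : ℂ → ℂ) x u * u ^ j + (c j : ℂ → ℂ) x * (j * (β * Complex.I) * u ^ j))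
        = N * (β * Complex.I) * ∑ j ∈ range (2 * N + 1), (c j : ℂ → ℂ) x * u ^ j := by
    intro u hu
    have hrot : ∀ (n : ℕ) (w : ℂ), HasDerivAt
        (fun t : ℝ => (Complex.exp (((β * t : ℝ) : ℂ) * Complex.I) * w) ^ n)
        (n * (β * Complex.I) * w ^ n) 0 := fun n w => by
      have := (((hasDerivAt_rotation β 0).mul_const w).pow n)
      convert! this using 1
      cases n with
      | zero => simp
      | succ n => simp; ring
    have hD : HasDerivAt (fun t : ℝ => x + displacement β t * u) u 0 := by
      have := ((hasDerivAt_displacement hβ 0).mul_const u).const_add x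
      simpa using this
    have hcj : ∀ j, HasDerivAt (fun t : ℝ => (c j : ℂ → ℂ) (x + displacement β t * u))
        (fderiv ℝ (c j : ℂ → ℂ) x u) 0 := fun j => by
      have h2 := (smoothFun_differentiable (c j) (x + displacement β 0 * u)).hasFDerivAt
      have h3 := h2.comp_hasDerivAt 0 hD
      rw [displacement_zero, zero_mul, add_zero] at h3
      exact h3
    have hL : HasDerivAt (fun t : ℝ => ∑ j ∈ range (2 * N + 1),
        (c j : ℂ → ℂ) (x + displacement β t * u) *
          (Complex.exp (((β * t : ℝ) : ℂ) * Complex.I) * u) ^ j)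
        (∑ j ∈ range (2 * N + 1), (fderiv ℝ (c j : ℂ → ℂ) x u * u ^ j +
          (c j : ℂ → ℂ) x * (j * (β * Complex.I) * u ^ j))) 0 := by
      refine HasDerivAt.fun_sum fun j _ => ?_
      have := (hcj j).mul (hrot j u)
      simp only [displacement_zero, mul_zero, Complex.ofReal_zero, zero_mul, Complex.exp_zero,
        add_zero, one_mul] at this
      exact this
    have hR : HasDerivAt (fun t : ℝ => Complex.exp (((β * t : ℝ) : ℂ) * Complex.I) ^ N *
        ∑ j ∈ range (2 * N + 1), (c j : ℂ → ℂ) x * u ^ j)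
        (N * (β * Complex.I) * ∑ j ∈ range (2 * N + 1), (c j : ℂ → ℂ) x * u ^ j) 0 := by
      have := (hrot N 1).mul_const (∑ j ∈ range (2 * N + 1), (c j : ℂ → ℂ) x * u ^ j)
      simpa using this
    -- Invariance is available only for `t ≥ 0`, so one-sided derivatives at 0 are compared.
    have hmem : Set.Ico 0 ε ∈ nhdsWithin (0 : ℝ) (Set.Ici 0) := Ico_mem_nhdsGE hε
    have hL' := (hL.hasDerivWithinAt (s := Set.Ici 0)).congr_of_eventuallyEq
      (f₁ := fun t : ℝ => Complex.exp (((β * t : ℝ) : ℂ) * Complex.I) ^ N *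
        ∑ j ∈ range (2 * N + 1), (c j : ℂ → ℂ) x * u ^ j)
      (Filter.mem_of_superset hmem fun t ht => (h x hx u hu t ht).symm)
      (h x hx u hu 0 ⟨le_rfl, hε⟩).symm
    exact (uniqueDiffWithinAt_Ici (0 : ℝ)).eq_deriv _ hL' hR.hasDerivWithinAt
  -- The derivative in the direction `u` is `∂ * u + ∂̄ * u⁻¹` for `|u| = 1`. Multiplied by `u`, the
  -- flow equation becomes a polynomial identity on the unit circle, whose coefficients are the
  -- recursion.
  let Q : Polynomial ℂ := ∑ j ∈ range (2 * N + 1),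
    (Polynomial.C ((wirtinger (c j) : ℂ → ℂ) x) * Polynomial.X ^ (j + 2) +
      Polynomial.C (Complex.I * β * ((j : ℂ) - N) * (c j : ℂ → ℂ) x) * Polynomial.X ^ (j + 1) +
      Polynomial.C ((wirtingerBar (c j) : ℂ → ℂ) x) * Polynomial.X ^ j)
  have hQ : Q = 0 := by
    refine poly_eq_zero_of_unit_circle fun u hu => ?_
    have hu0 := ne_zero_of_norm_one hu
    have h1 := hpde u hu
    have h2 : Q.eval u = u * (∑ j ∈ range (2 * N + 1), (fderiv ℝ (c j : ℂ → ℂ) x u * u ^ j +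
        (c j : ℂ → ℂ) x * (j * (β * Complex.I) * u ^ j))
        - N * (β * Complex.I) * ∑ j ∈ range (2 * N + 1), (c j : ℂ → ℂ) x * u ^ j) := by
      rw [mul_sum, ← sum_sub_distrib, mul_sum, Polynomial.eval_finsetSum]
      refine sum_congr rfl fun j _ => ?_
      rw [fderiv_eq_wirtinger, star_eq_inv_of_norm_one hu]
      simp only [Polynomial.eval_add, Polynomial.eval_mul, Polynomial.eval_C, Polynomial.eval_pow,
        Polynomial.eval_X]
      field_simp
      ring
    rw [h2, h1, sub_self, mul_zero]
  have hcoeff : ∀ (a : ℕ → ℂ), (∀ j, 2 * N < j → a j = 0) → ∀ k m : ℕ,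
      (∑ j ∈ range (2 * N + 1), Polynomial.C (a j) * Polynomial.X ^ (j + k)).coeff (m + k)
        = a m := by
    intro a ha k m
    rw [Polynomial.finsetSum_coeff]
    simp only [Polynomial.coeff_C_mul_X_pow, add_left_inj]
    rw [sum_ite_eq]
    split_ifs with hm
    · rfl
    · rw [mem_range] at hm
      exact (ha m (by omega)).symm
  have hcoeff0 : ∀ (a : ℕ → ℂ) (k m : ℕ), m < k →
      (∑ j ∈ range (2 * N + 1), Polynomial.C (a j) * Polynomial.X ^ (j + k)).coeff m = 0 := by
    intro a k m hm
    rw [Polynomial.finsetSum_coeff]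
    refine sum_eq_zero fun j _ => ?_
    rw [Polynomial.coeff_C_mul_X_pow, if_neg (by omega)]
  have ha0 : ∀ j, 2 * N < j → (wirtinger (c j) : ℂ → ℂ) x = 0 := fun j hj => by
    rw [hc j hj, map_zero]; rfl
  have ha1 : ∀ j : ℕ, 2 * N < j → Complex.I * β * ((j : ℂ) - N) * (c j : ℂ → ℂ) x = 0 :=
    fun j hj => by rw [hc j hj]; exact mul_zero _
  have ha2 : ∀ j, 2 * N < j → (wirtingerBar (c j) : ℂ → ℂ) x = 0 := fun j hj => by
    rw [hc j hj, map_zero]; rfl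
  have hsplit : Q = ∑ j ∈ range (2 * N + 1),
      Polynomial.C ((wirtinger (c j) : ℂ → ℂ) x) * Polynomial.X ^ (j + 2) +
      ∑ j ∈ range (2 * N + 1), Polynomial.C (Complex.I * β * ((j : ℂ) - N) * (c j : ℂ → ℂ) x) *
        Polynomial.X ^ (j + 1) +
      ∑ j ∈ range (2 * N + 1), Polynomial.C ((wirtingerBar (c j) : ℂ → ℂ) x) *
        Polynomial.X ^ (j + 0) := by
    rw [← sum_add_distrib, ← sum_add_distrib]; rfl
  rw [hQ] at hsplit
  refine ⟨fun m => ?_, ?_, ?_⟩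
  · have := congrArg (fun P => Polynomial.coeff P (m + 2)) hsplit
    simp only [Polynomial.coeff_add, Polynomial.coeff_zero] at this
    have e1 := hcoeff (fun j => (wirtinger (c j) : ℂ → ℂ) x) ha0 2 m
    have e2 := hcoeff _ ha1 1 (m + 1)
    have e3 := hcoeff (fun j => (wirtingerBar (c j) : ℂ → ℂ) x) ha2 0 (m + 2)
    rw [e1, e2, e3] at this
    exact this.symm
  · have := congrArg (fun P => Polynomial.coeff P 1) hsplit
    simp only [Polynomial.coeff_add, Polynomial.coeff_zero] at this
    have e1 := hcoeff0 (fun j => (wirtinger (c j) : ℂ → ℂ) x) 2 1 (by omega)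
    have e2 := hcoeff _ ha1 1 0
    have e3 := hcoeff (fun j => (wirtingerBar (c j) : ℂ → ℂ) x) ha2 0 1
    rw [e1, e2, e3, zero_add] at this
    exact this.symm
  · have := congrArg (fun P => Polynomial.coeff P 0) hsplit
    simp only [Polynomial.coeff_add, Polynomial.coeff_zero] at this
    have e1 := hcoeff0 (fun j => (wirtinger (c j) : ℂ → ℂ) x) 2 0 (by omega)
    have e2 := hcoeff0 (fun j => Complex.I * β * ((j : ℂ) - N) * (c j : ℂ → ℂ) x) 1 0 (by omega)
    have e3 := hcoeff (fun j => (wirtingerBar (c j) : ℂ → ℂ) x) ha2 0 0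
    rw [e1, e2, e3, zero_add, zero_add] at this
    exact this.symm

/-- The `∂` and `∂̄` powers of order `2N + 1` vanish, so the real directional derivatives of order
`4N + 2` do. The bound does not depend on the functions, which makes the passage to a limit
possible. -/
theorem FlowInvariantOn.isInterpolated {β ε : ℝ} (hβ : β ≠ 0) (hε : 0 < ε) {N : ℕ}
    {c : ℕ → smoothFun} (hc : ∀ m, 2 * N < m → c m = 0) {x₀ : ℂ} {η : ℝ} (hη : 0 < η)
    (h : FlowInvariantOn β ε N (fun j => c j) (square x₀ η)) (m : ℕ) :
    IsInterpolated x₀ η (4 * N + 1) (c m) := by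
  have hrec := fun x hx => h.wirtinger_recursion hβ hε hc (x := x) hx
  obtain ⟨h1, h2⟩ := wirtinger_pow_mem (isOpen_square x₀ η) c
    (fun m => Complex.I * β * ((m : ℂ) - N)) (2 * N) hc (fun m x hx => (hrec x hx).1 m)
    (fun x hx => (hrec x hx).2.1) (fun x hx => (hrec x hx).2.2) m
  obtain ⟨h3, h4⟩ := dirDeriv_pow_mem (isOpen_square x₀ η) h1 h2
  have e : 2 * N + 1 + (2 * N + 1) = 4 * N + 1 + 1 := by omega
  rw [e] at h3 h4
  exact isInterpolated_of_dirDeriv_pow hη _ h3 h4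

/-- The continuous Fourier coefficients of a function that is invariant under the flow are
polynomials near every point. -/
theorem FlowInvariantOn.exists_mvPolynomial {β ε δ : ℝ} (hβ : β ≠ 0) (hε : 0 < ε) (hδ : 0 < δ)
    {N : ℕ} {b : ℕ → ℂ → ℂ} {x₀ : ℂ} (hb : ∀ j, Continuous (b j)) (hb0 : ∀ j, 2 * N < j → b j = 0)
    (h : FlowInvariantOn β ε N b (Metric.ball x₀ (δ + δ))) (m : ℕ) :
    ∃ P : MvPolynomial (Fin 2) ℂ, ∀ x ∈ square x₀ (δ / 2), b m x = MvPolynomial.eval (toC2 x) P := by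
  have hpos : ∀ n : ℕ, 0 < δ / ((n : ℝ) + 1) := fun n => by positivity
  let φ : ℕ → ContDiffBump (0 : ℂ) := fun n =>
    ⟨δ / ((n : ℝ) + 1) / 2, δ / ((n : ℝ) + 1), half_pos (hpos n), half_lt_self (hpos n)⟩
  have hφ : Filter.Tendsto (fun n => (φ n).rOut) Filter.atTop (nhds 0) :=
    by simpa [φ, div_eq_mul_inv] using (tendsto_one_div_add_atTop_nhds_zero_nat (𝕜 := ℝ)).const_mul δ
  refine (IsInterpolated.of_tendsto (K := 4 * N + 1) 
    (g := fun n => MagneticBilliard.mollify (φ n) (b m)) (fun n => ?_)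
    fun x => ContDiffBump.convolution_tendsto_right_of_continuous hφ (hb m) x).exists_mvPolynomial
  let c : ℕ → smoothFun := fun j => ⟨MagneticBilliard.mollify (φ n) (b j), contDiff_mollify (φ n) (hb j)⟩
  have hle : (φ n).rOut ≤ δ :=
    div_le_self hδ.le (by have : (0 : ℝ) ≤ n := n.cast_nonneg
                          linarith)
  refine FlowInvariantOn.isInterpolated hβ hε (c := c) (fun j hj => ?_) (half_pos hδ) ?_ m
  · ext x
    simp [c, mollify_apply, hb0 j hj]
  · intro x hx
    refine h.mollify hb (φ n) hle x ?_
    simpa using square_subset_ball _ _ hx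

theorem analyticOnNhd_eval (P : MvPolynomial (Fin 2) ℂ) (S : Set ℂ) :
    AnalyticOnNhd ℝ (fun x => MvPolynomial.eval (toC2 x) P) S := by
  intro x _
  have : ∀ i, AnalyticAt ℝ (fun x => toC2 x i) x := by
    intro i
    fin_cases i
    · exact (Complex.ofRealCLM.comp Complex.reCLM).analyticAt x
    · exact (Complex.ofRealCLM.comp Complex.imCLM).analyticAt x
  simpa [MvPolynomial.aeval_eq_eval] using AnalyticAt.aeval_mvPolynomial this P

theorem continuous_eval (P : MvPolynomial (Fin 2) ℂ) :
    Continuous fun x => MvPolynomial.eval (toC2 x) P :=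
  continuousOn_univ.1 (analyticOnNhd_eval P Set.univ).continuousOn

/-- Composition of a polynomial with a translation. -/
theorem exists_translate (P : MvPolynomial (Fin 2) ℂ) (w : ℂ) :
    ∃ P' : MvPolynomial (Fin 2) ℂ, ∀ z,
      MvPolynomial.eval (toC2 z) P' = MvPolynomial.eval (toC2 (z + w)) P := by
  refine ⟨MvPolynomial.bind₁ (fun i => MvPolynomial.X i + MvPolynomial.C (toC2 w i)) P, fun z => ?_⟩
  have h : (fun i => toC2 z i + toC2 w i) = toC2 (z + w) := by
    ext i; fin_cases i <;> simp [toC2]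
  induction P using MvPolynomial.induction_on with
  | C a => simp
  | add p q hp hq => simp only [map_add, hp, hq]
  | mul_X p i hp =>
    rw [map_mul, map_mul, hp, map_mul, MvPolynomial.bind₁_X_right, ← h]
    simp

/-- Functions that are locally polynomial on a connected open set are polynomials. -/
theorem exists_mvPolynomial_of_local {Ω : Set ℂ} (hΩ : IsPreconnected Ω) (hne : Ω.Nonempty)
    {f : ℂ → ℂ} (h : ∀ x ∈ Ω, ∃ P : MvPolynomial (Fin 2) ℂ,
      ∀ᶠ y in nhds x, f y = MvPolynomial.eval (toC2 y) P) :
    ∃ P : MvPolynomial (Fin 2) ℂ, ∀ x ∈ Ω, f x = MvPolynomial.eval (toC2 x) P := by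
  obtain ⟨x₀, hx₀⟩ := hne
  obtain ⟨P, hP⟩ := h x₀ hx₀
  refine ⟨P, AnalyticOnNhd.eqOn_of_preconnected_of_eventuallyEq (𝕜 := ℝ) (fun x hx => ?_)
    (analyticOnNhd_eval P Ω) hΩ hx₀ hP⟩
  obtain ⟨Q, hQ⟩ := h x hx
  exact (analyticOnNhd_eval Q {x} x rfl).congr (hQ.mono fun y hy => hy.symm)

theorem displacement_add (β s t : ℝ) : displacement β (s + t) =
    displacement β s + displacement β t * Complex.exp (((β * s : ℝ) : ℂ) * Complex.I) := by
  simp only [displacement]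
  have : Complex.exp (((β * (s + t) : ℝ) : ℂ) * Complex.I) =
      Complex.exp (((β * s : ℝ) : ℂ) * Complex.I) * Complex.exp (((β * t : ℝ) : ℂ) * Complex.I) := by
    rw [← Complex.exp_add]; congr 1; push_cast; ring
  rw [this]; ring

/-- For polynomial coefficients, invariance under the flow for a short time near one point is
invariance for all times everywhere. -/
theorem FlowInvariantOn.global {β ε : ℝ} (hε : 0 < ε) {N : ℕ} {P : ℕ → MvPolynomial (Fin 2) ℂ}
    {U : Set ℂ} (hU : IsOpen U) (hne : U.Nonempty)
    (h : FlowInvariantOn β ε N (fun j x => MvPolynomial.eval (toC2 x) (P j)) U) (T : ℝ) :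
    FlowInvariantOn β T N (fun j x => MvPolynomial.eval (toC2 x) (P j)) Set.univ := by
  -- For fixed `u` and `t` both sides are polynomials in `x` that agree on an open set.
  have hstep : FlowInvariantOn β ε N (fun j x => MvPolynomial.eval (toC2 x) (P j)) Set.univ := by
    intro x _ u hu t ht
    obtain ⟨x₀, hx₀⟩ := hne
    let L : MvPolynomial (Fin 2) ℂ := ∑ j ∈ Finset.range (2 * N + 1),
      (exists_translate (P j) (displacement β t * u)).choose *
        MvPolynomial.C ((Complex.exp (((β * t : ℝ) : ℂ) * Complex.I) * u) ^ j)
    let R : MvPolynomial (Fin 2) ℂ := MvPolynomial.C (Complex.exp (((β * t : ℝ) : ℂ) * Complex.I) ^ N) *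
      ∑ j ∈ Finset.range (2 * N + 1), P j * MvPolynomial.C (u ^ j)
    have hL : ∀ x, MvPolynomial.eval (toC2 x) L = ∑ j ∈ Finset.range (2 * N + 1),
        MvPolynomial.eval (toC2 (x + displacement β t * u)) (P j) *
        (Complex.exp (((β * t : ℝ) : ℂ) * Complex.I) * u) ^ j := fun x => by
      simp only [L, map_sum, map_mul, MvPolynomial.eval_C,
        (exists_translate (P _) (displacement β t * u)).choose_spec]
    have hR : ∀ x, MvPolynomial.eval (toC2 x) R = Complex.exp (((β * t : ℝ) : ℂ) * Complex.I) ^ N *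
        ∑ j ∈ Finset.range (2 * N + 1), MvPolynomial.eval (toC2 x) (P j) * u ^ j := fun x => by
      simp only [R, map_sum, map_mul, MvPolynomial.eval_C]
    have heq := AnalyticOnNhd.eq_of_eventuallyEq (𝕜 := ℝ) (z₀ := x₀)
      (analyticOnNhd_eval L Set.univ) (analyticOnNhd_eval R Set.univ)
      (Filter.mem_of_superset (hU.mem_nhds hx₀) fun y hy => by
        change MvPolynomial.eval (toC2 y) L = MvPolynomial.eval (toC2 y) R
        rw [hL, hR]; exact h y hy u hu t ht)
    have := congrFun heq x
    rwa [hL, hR] at this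
  -- A long time is cut into `n` equal steps shorter than `ε`; with the domain now the whole plane,
  -- nothing prevents the iteration.
  have hmul : ∀ n : ℕ, ∀ t ∈ Set.Ico 0 ε, ∀ x u : ℂ, ‖u‖ = 1 →
      ∑ j ∈ Finset.range (2 * N + 1),
        MvPolynomial.eval (toC2 (x + displacement β (n * t) * u)) (P j) *
        (Complex.exp (((β * (n * t) : ℝ) : ℂ) * Complex.I) * u) ^ j
      = Complex.exp (((β * (n * t) : ℝ) : ℂ) * Complex.I) ^ N *
        ∑ j ∈ Finset.range (2 * N + 1), MvPolynomial.eval (toC2 x) (P j) * u ^ j := by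
    intro n t ht
    induction n with
    | zero => intro x u hu; simp [displacement_zero]
    | succ n ih =>
      intro x u hu
      set ζ := Complex.exp (((β * (n * t) : ℝ) : ℂ) * Complex.I) with hζ
      have h1 := hstep (x + displacement β (n * t) * u) trivial (ζ * u)
        (by rw [norm_mul, hu, norm_rotation, mul_one]) t ht
      have e1 : ((n + 1 : ℕ) : ℝ) * t = n * t + t := by push_cast; ring
      have e2 : Complex.exp (((β * (n * t + t) : ℝ) : ℂ) * Complex.I)
          = Complex.exp (((β * t : ℝ) : ℂ) * Complex.I) * ζ := by
        rw [hζ, ← Complex.exp_add]; congr 1; push_cast; ring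
      rw [ih x u hu] at h1
      rw [e1, e2, displacement_add, ← hζ]
      convert! h1 using 1
      · refine Finset.sum_congr rfl fun j _ => ?_
        rw [mul_assoc, show x + (displacement β (n * t) + displacement β t * ζ) * u
          = x + displacement β (n * t) * u + displacement β t * (ζ * u) by ring]
      · ring
  intro x _ u hu t ht
  obtain ⟨n, hn⟩ := exists_nat_gt (t / ε)
  have hn0 : (0 : ℝ) < n := lt_of_le_of_lt (div_nonneg ht.1 hε.le) hn
  have := hmul n (t / n) ⟨div_nonneg ht.1 hn0.le, by
    rw [div_lt_iff₀ hε] at hn; rw [div_lt_iff₀ hn0]; linarith⟩ x u hu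
  rwa [mul_div_cancel₀ _ hn0.ne'] at this

/-- At unit speed, a particle starting in the ball of radius `2δ` stays in the ball of radius `3δ`
for a time less than `δ`. -/
theorem IsPolynomialIntegral.flowInvariantOn {β : ℝ} (hβ : β ≠ 0) {Ω : Set ℂ}
    {B : PiecewiseSmoothBoundary Ω} {Φ : ℂ → ℂ → ℝ} (hΦ : IsPolynomialIntegral β B Φ) {N : ℕ}
    {b : ℕ → ℂ → ℂ} (hb : ∀ x ∈ closure Ω, ∀ u : ℂ, ‖u‖ = 1 →
        (Φ x u : ℂ) * u ^ N = ∑ j ∈ Finset.range (2 * N + 1), b j x * u ^ j)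
    {x₀ : ℂ} {δ : ℝ} (hball : Metric.ball x₀ (δ + δ + δ) ⊆ Ω) (hδ : 0 < δ) :
    FlowInvariantOn β δ N b (Metric.ball x₀ (δ + δ)) := by
  intro x hx u hu t ht
  have hmem : ∀ s ∈ Set.Icc 0 t, flowPosition β s x u ∈ Ω := fun s hs => by
    apply hball
    rw [Metric.mem_ball, dist_eq_norm] at hx ⊢
    rw [flowPosition_eq]
    calc ‖x + displacement β s * u - x₀‖ = ‖(x - x₀) + displacement β s * u‖ := by ring_nf
      _ ≤ ‖x - x₀‖ + ‖displacement β s * u‖ := norm_add_le _ _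
      _ ≤ ‖x - x₀‖ + s := by
        rw [norm_mul, hu, mul_one]; gcongr; exact norm_displacement_le hβ hs.1
      _ < δ + δ + δ := by linarith [hs.2, ht.2]
  have hxΩ : x ∈ Ω := hball (Metric.ball_subset_ball (by linarith) hx)
  have h1 := hΦ.flow_invariant x hxΩ u hu t ht.1 hmem
  have h2 := hb _ (subset_closure (hmem t ⟨ht.1, le_rfl⟩)) (flowVelocity β t u)
    (by rw [flowVelocity, norm_mul, hu, norm_rotation, mul_one])
  rw [h1, flowPosition_eq, flowVelocity, mul_pow, mul_left_comm, hb x (subset_closure hxΩ) u hu] at h2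
  exact h2.symm

/-- A polynomial integral is a polynomial in the Larmor centre. -/
theorem IsPolynomialIntegral.exists_mvPolynomial {β : ℝ} (hβ : 0 < β) {Ω : Set ℂ}
    (hΩo : IsOpen Ω) (hΩne : Ω.Nonempty) (hΩc : Convex ℝ Ω)
    {B : PiecewiseSmoothBoundary Ω} {Φ : ℂ → ℂ → ℝ} (hΦ : IsPolynomialIntegral β B Φ) :
    ∃ F : MvPolynomial (Fin 2) ℂ, ∀ x ∈ closure Ω, ∀ v : ℂ, ‖v‖ = 1 →
      (Φ x v : ℂ) = MvPolynomial.eval (toC2 (larmorCenter β x v)) F := by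
  obtain ⟨N, a, ha, hΦa⟩ := hΦ.polynomial
  obtain ⟨b, hb, hb0, hbΦ⟩ := exists_fourier_coefficients isClosed_closure ha hΦa
  have hball : ∀ x ∈ Ω, ∃ δ > 0, Metric.ball x (δ + δ + δ) ⊆ Ω := fun x hx => by
    obtain ⟨ε, hε, h⟩ := Metric.isOpen_iff.1 hΩo x hx
    exact ⟨ε / 3, by positivity, by convert! h using 2; ring⟩
  have hP : ∀ j, ∃ P : MvPolynomial (Fin 2) ℂ, ∀ x ∈ Ω, b j x = MvPolynomial.eval (toC2 x) P := by
    intro j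
    refine exists_mvPolynomial_of_local hΩc.isPreconnected hΩne fun x hx => ?_
    obtain ⟨δ, hδ, hsub⟩ := hball x hx
    obtain ⟨P, hP⟩ := (hΦ.flowInvariantOn hβ.ne' hbΦ hsub hδ).exists_mvPolynomial hβ.ne' hδ hδ hb hb0 j
    refine ⟨P, Filter.mem_of_superset ((isOpen_square x (δ / 2)).mem_nhds ?_) hP⟩
    simp [square, hδ]
  choose P hP using hP
  have hPcl : ∀ j, ∀ x ∈ closure Ω, b j x = MvPolynomial.eval (toC2 x) (P j) := fun j =>
    Set.EqOn.closure (hP j) (hb j) (continuous_eval (P j))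
  obtain ⟨x₀, hx₀⟩ := hΩne
  obtain ⟨δ, hδ, hsub⟩ := hball x₀ hx₀
  have hinv : FlowInvariantOn β δ N (fun j x => MvPolynomial.eval (toC2 x) (P j))
      (Metric.ball x₀ (δ + δ)) := by
    refine hΦ.flowInvariantOn hβ.ne' (fun x hx u hu => ?_) hsub hδ
    rw [hbΦ x hx u hu]
    exact Finset.sum_congr rfl fun j _ => by rw [hPcl j x hx]
  -- The orbit with Larmor centre `L` passes through `L - r J 1` with velocity 1; there the Fourier
  -- sum is just the sum of the coefficients.
  choose P' hP' using fun j => exists_translate (P j) (-(((1 / β : ℝ) : ℂ) * Complex.I))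
  refine ⟨∑ j ∈ Finset.range (2 * N + 1), P' j, fun x hx v hv => ?_⟩
  have hv0 := ne_zero_of_norm_one hv
  -- The time that rotates `v` into 1, taken in a nonnegative form.
  set t : ℝ := (2 * Real.pi - v.arg) / β with ht
  have ht0 : 0 ≤ t := by
    have := Complex.arg_le_pi v
    have := Real.pi_pos
    exact div_nonneg (by linarith) hβ.le
  have hζ : Complex.exp (((β * t : ℝ) : ℂ) * Complex.I) * v = 1 := by
    have h1 : v = Complex.exp (v.arg * Complex.I) := by
      conv_lhs => rw [← Complex.norm_mul_exp_arg_mul_I v, hv]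
      simp
    conv_lhs => rw [h1]
    rw [← Complex.exp_add, ht, mul_div_cancel₀ _ hβ.ne']
    have : (((2 * Real.pi - v.arg : ℝ) : ℂ) * Complex.I + v.arg * Complex.I)
        = 2 * Real.pi * Complex.I := by push_cast; ring
    rw [this, Complex.exp_two_pi_mul_I]
  have key := hinv.global hδ Metric.isOpen_ball ⟨x₀, Metric.mem_ball_self (by linarith)⟩ (t + 1) x
    trivial v hv t ⟨ht0, by linarith⟩
  have hsum : ∑ j ∈ Finset.range (2 * N + 1), MvPolynomial.eval (toC2 x) (P j) * v ^ j
      = (Φ x v : ℂ) * v ^ N := by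
    rw [hbΦ x hx v hv]
    exact Finset.sum_congr rfl fun j _ => by rw [hPcl j x hx]
  have hζ' : Complex.exp (((β * t : ℝ) : ℂ) * Complex.I) ^ N * ((Φ x v : ℂ) * v ^ N) = Φ x v := by
    rw [mul_left_comm, ← mul_pow, hζ, one_pow, mul_one]
  have hpos : x + displacement β t * v
      = larmorCenter β x v + -(((1 / β : ℝ) : ℂ) * Complex.I) := by
    rw [displacement, larmorCenter]
    linear_combination (-((1 / β : ℝ) : ℂ) * Complex.I) * hζ
  rw [hsum, hζ', hζ, hpos] at key
  rw [← key, map_sum]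
  exact Finset.sum_congr rfl fun j _ => by rw [hP', one_pow, mul_one]

end

/-! ### Parallel curves and the symmetry coming from the reflection law. -/

section

open MvPolynomial

/-- The derivative of the polynomial `f` at the real point `z` in the direction `w`. -/
def dirEval (f : MvPolynomial (Fin 2) ℂ) (z w : ℂ) : ℂ :=
  eval (toC2 z) (pderiv 0 f) * w.re + eval (toC2 z) (pderiv 1 f) * w.im

theorem dirEval_smul (f : MvPolynomial (Fin 2) ℂ) (z w : ℂ) (c : ℝ) :
    dirEval f z (c * w) = c * dirEval f z w := by
  simp only [dirEval, Complex.re_ofReal_mul, Complex.im_ofReal_mul]; push_cast; ring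

theorem hasDerivAt_eval (f : MvPolynomial (Fin 2) ℂ) {q : ℝ → ℂ} {q' : ℂ} {t : ℝ}
    (hq : HasDerivAt q q' t) :
    HasDerivAt (fun t => eval (toC2 (q t)) f) (dirEval f (q t) q') t := by
  have hre : HasDerivAt (fun t => ((q t).re : ℂ)) (q'.re : ℂ) t :=
    ((Complex.reCLM.hasFDerivAt.comp_hasDerivAt t hq)).ofReal_comp
  have him : HasDerivAt (fun t => ((q t).im : ℂ)) (q'.im : ℂ) t :=
    ((Complex.imCLM.hasFDerivAt.comp_hasDerivAt t hq)).ofReal_comp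
  induction f using MvPolynomial.induction_on with
  | C a => simpa [dirEval] using hasDerivAt_const t a
  | add f g hf hg =>
    have := hf.add hg
    simp only [map_add, dirEval] at this ⊢
    convert! this using 1; ring
  | mul_X f i hf =>
    fin_cases i
    · have := hf.mul hre
      simp only [map_mul, dirEval, pderiv_mul, map_add, eval_X] at this ⊢
      convert! this using 1
      simp [toC2]; ring
    · have := hf.mul him
      simp only [map_mul, dirEval, pderiv_mul, map_add, eval_X] at this ⊢
      convert! this using 1
      simp [toC2]; ring

/-- `γ` is a unit speed curve on `U` with tangent `τ` and curvature `k`. -/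
structure IsFrenet (γ τ : ℝ → ℂ) (k : ℝ → ℝ) (U : Set ℝ) : Prop where
  norm_tangent : ∀ s ∈ U, ‖τ s‖ = 1
  hasDerivAt : ∀ s ∈ U, HasDerivAt γ (τ s) s
  hasDerivAt_tangent : ∀ s ∈ U, HasDerivAt τ (k s * (Complex.I * τ s)) s

/-- The curve `γ + r J τ` parallel to `γ`. -/
def parallel (γ τ : ℝ → ℂ) (r : ℝ) (s : ℝ) : ℂ := γ s + r * (Complex.I * τ s)

theorem IsFrenet.mono {γ τ : ℝ → ℂ} {k : ℝ → ℝ} {U V : Set ℝ} (h : IsFrenet γ τ k U) (hVU : V ⊆ U) :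
    IsFrenet γ τ k V :=
  ⟨fun s hs => h.1 s (hVU hs), fun s hs => h.2 s (hVU hs), fun s hs => h.3 s (hVU hs)⟩

/-- Since `J τ' = -k τ`, a parallel curve keeps the tangent direction of `γ`, and it is singular
exactly where `r k = 1`. -/
theorem IsFrenet.hasDerivAt_parallel {γ τ : ℝ → ℂ} {k : ℝ → ℝ} {U : Set ℝ} (h : IsFrenet γ τ k U)
    (r : ℝ) {s : ℝ} (hs : s ∈ U) :
    HasDerivAt (parallel γ τ r) (((1 - r * k s : ℝ) : ℂ) * τ s) s := by
  have := (h.hasDerivAt s hs).add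
    (((h.hasDerivAt_tangent s hs).const_mul Complex.I).const_mul (r : ℂ))
  convert! this using 1
  push_cast
  linear_combination (-(r : ℂ) * k s * τ s) * Complex.I_sq

/-- The values of `F` on the circle of radius `|r|` about `x` are symmetric with respect to the
line through `x` with direction `n`. -/
def IsSymmetricOnCircle (F : MvPolynomial (Fin 2) ℂ) (r : ℝ) (x n : ℂ) : Prop :=
  ∀ θ : ℝ, eval (toC2 (x + r * (Complex.exp (θ * Complex.I) * n))) F
    = eval (toC2 (x + r * (Complex.exp (-(θ * Complex.I)) * n))) F

/-- A half turn `θ ↦ θ + π` changes the sign of the radius. Thus both parallel curves are covered by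
one argument with signed `r`. -/
theorem IsSymmetricOnCircle.neg {F : MvPolynomial (Fin 2) ℂ} {r : ℝ} {x n : ℂ}
    (h : IsSymmetricOnCircle F r x n) : IsSymmetricOnCircle F (-r) x n := by
  intro θ
  have h1 := h (θ + Real.pi)
  have e1 : Complex.exp (((θ + Real.pi : ℝ) : ℂ) * Complex.I) = -Complex.exp (θ * Complex.I) := by
    push_cast
    rw [add_mul, Complex.exp_add, Complex.exp_pi_mul_I]; ring
  have e2 : Complex.exp (-(((θ + Real.pi : ℝ) : ℂ) * Complex.I))
      = -Complex.exp (-(θ * Complex.I)) := by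
    push_cast
    rw [add_mul, neg_add, Complex.exp_add, Complex.exp_neg (Real.pi * Complex.I),
      Complex.exp_pi_mul_I]; ring
  rw [e1, e2] at h1
  convert! h1 using 3
  · congr 1; push_cast; ring
  · congr 1; push_cast; ring

theorem hasDerivAt_circle (x n : ℂ) (r θ : ℝ) :
    HasDerivAt (fun θ : ℝ => x + r * (Complex.exp (θ * Complex.I) * n))
      (r * (Complex.exp (θ * Complex.I) * (Complex.I * n))) θ := by
  have h1 : HasDerivAt (fun θ : ℝ => (θ : ℂ) * Complex.I) Complex.I θ := by
    simpa using (Complex.ofRealCLM.hasDerivAt (x := θ)).mul_const Complex.I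
  have h2 := (((h1.cexp).mul_const n).const_mul (r : ℂ)).const_add x
  convert! h2 using 1; ring

/-- An even function of `θ` has derivative zero at `θ = 0`, and the circle is tangent to `τ` there.
-/
theorem IsSymmetricOnCircle.dirEval_eq_zero {F : MvPolynomial (Fin 2) ℂ} {r : ℝ} (hr : r ≠ 0)
    {x τ : ℂ} (h : IsSymmetricOnCircle F r x (Complex.I * τ)) :
    dirEval F (x + r * (Complex.I * τ)) τ = 0 := by
  have h1 := hasDerivAt_eval F (hasDerivAt_circle x (Complex.I * τ) r 0)
  have h2 := hasDerivAt_eval F ((hasDerivAt_circle x (Complex.I * τ) r (-0)).scomp (0 : ℝ)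
    (hasDerivAt_neg (0 : ℝ)))
  have heq : (fun t : ℝ => eval (toC2 (x + r * (Complex.exp (t * Complex.I) * (Complex.I * τ)))) F)
      = fun t => eval (toC2 (((fun θ : ℝ => x + r * (Complex.exp (θ * Complex.I) * (Complex.I * τ)))
        ∘ Neg.neg) t)) F := by
    ext t
    simpa using h t
  rw [← heq] at h2
  have h3 := h1.unique h2
  simp only [Complex.ofReal_zero, zero_mul, Complex.exp_zero, one_mul, Function.comp_apply,
    neg_zero] at h3
  have e1 : (r : ℂ) * (Complex.I * (Complex.I * τ)) = ((-r : ℝ) : ℂ) * τ := by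
    push_cast; linear_combination (r : ℂ) * τ * Complex.I_sq
  have e2 : (-1 : ℝ) • ((r : ℂ) * (Complex.I * (Complex.I * τ))) = (r : ℂ) * τ := by
    rw [Complex.real_smul]; push_cast; linear_combination (-(r : ℂ)) * τ * Complex.I_sq
  rw [e2, e1, dirEval_smul, dirEval_smul] at h3
  have hr' : (r : ℂ) ≠ 0 := by exact_mod_cast hr
  push_cast at h3
  have : (2 * r : ℂ) * dirEval F (x + r * (Complex.I * τ)) τ = 0 := by linear_combination -h3
  simpa [hr'] using this

/-- The integral is constant along the parallel curves. -/
theorem IsFrenet.eval_parallel_eq {γ τ : ℝ → ℂ} {k : ℝ → ℝ} {s₀ s₁ r : ℝ} (hr : r ≠ 0)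
    (h : IsFrenet γ τ k (Set.Ioo s₀ s₁)) {F : MvPolynomial (Fin 2) ℂ}
    (hF : ∀ s ∈ Set.Ioo s₀ s₁, IsSymmetricOnCircle F r (γ s) (Complex.I * τ s)) {s t : ℝ}
    (hs : s ∈ Set.Ioo s₀ s₁) (ht : t ∈ Set.Ioo s₀ s₁) :
    eval (toC2 (parallel γ τ r s)) F = eval (toC2 (parallel γ τ r t)) F := by
  have hd : ∀ s ∈ Set.Ioo s₀ s₁, HasDerivAt (fun s => eval (toC2 (parallel γ τ r s)) F) 0 s := by
    intro s hs
    have h1 := hasDerivAt_eval F (h.hasDerivAt_parallel r hs)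
    rw [dirEval_smul, parallel, (hF s hs).dirEval_eq_zero hr, mul_zero] at h1
    exact h1
  exact isOpen_Ioo.is_const_of_deriv_eq_zero (convex_Ioo s₀ s₁).isPreconnected
    (fun x hx => (hd x hx).differentiableAt.differentiableWithinAt)
    (fun x hx => (hd x hx).deriv) hs ht

namespace PiecewiseSmoothBoundary

variable {Ω : Set ℂ} (B : PiecewiseSmoothBoundary Ω)

theorem node_lt (i : Fin B.n) : B.node i.castSucc < B.node i.succ :=
  B.node_strictMono Fin.castSucc_lt_succ

theorem contDiffOn_tangent (i : Fin B.n) : ContDiffOn ℝ ∞ (B.tangent i) (B.interval i) :=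
  (B.smooth i).derivWithin (uniqueDiffOn_Icc (B.node_lt i)) (by simp)

theorem openInterval_subset (i : Fin B.n) : B.openInterval i ⊆ B.interval i := Set.Ioo_subset_Icc_self

theorem interval_mem_nhds (i : Fin B.n) {s : ℝ} (hs : s ∈ B.openInterval i) :
    B.interval i ∈ nhds s := Icc_mem_nhds hs.1 hs.2

theorem isFrenet (i : Fin B.n) :
    IsFrenet B.curve (B.tangent i) (B.curvature i) (B.openInterval i) where
  norm_tangent s hs := B.unit_speed i s (B.openInterval_subset i hs)
  hasDerivAt s hs := by
    have h := ((B.smooth i).differentiableOn (by simp) s (B.openInterval_subset i hs)).hasDerivWithinAt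
    exact h.hasDerivAt (B.interval_mem_nhds i hs)
  hasDerivAt_tangent s hs := by
    have h := (((B.contDiffOn_tangent i).differentiableOn (by simp) s
      (B.openInterval_subset i hs)).hasDerivWithinAt).hasDerivAt (B.interval_mem_nhds i hs)
    -- From `|τ| ^ 2 = 1` the derivative of `τ` is orthogonal to `τ`, hence a multiple of `J τ`.
    have h1 := h.norm_sq
    have h2 : (fun t => ‖B.tangent i t‖ ^ 2) =ᶠ[nhds s] fun _ => 1 :=
      Filter.mem_of_superset (B.interval_mem_nhds i hs) fun t ht => by
        change ‖B.tangent i t‖ ^ 2 = 1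
        rw [show ‖B.tangent i t‖ = 1 from B.unit_speed i t ht, one_pow]
    have h3 := (h1.congr_of_eventuallyEq h2.symm).unique (hasDerivAt_const s (1 : ℝ))
    have h4 : ‖B.tangent i s‖ ^ 2 = 1 := h2.self_of_nhds
    convert! h using 1
    rw [curvature, normal]
    set w := derivWithin (B.tangent i) (B.interval i) s
    set τ := B.tangent i s
    rw [← Complex.normSq_eq_norm_sq, Complex.normSq_apply] at h4
    simp only [Complex.inner, Complex.mul_re, Complex.conj_re, Complex.conj_im] at h3 ⊢
    have h5 : w.re * τ.re + w.im * τ.im = 0 := by linarith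
    apply Complex.ext
    · simp
      linear_combination (w.re) * h4 - τ.re * h5
    · simp
      linear_combination (w.im) * h4 - τ.im * h5

theorem continuousOn_curvature (i : Fin B.n) : ContinuousOn (B.curvature i) (B.interval i) := by
  have h1 := (B.contDiffOn_tangent i).continuousOn
  have h2 : ContinuousOn (derivWithin (B.tangent i) (B.interval i)) (B.interval i) :=
    (B.contDiffOn_tangent i).continuousOn_derivWithin (uniqueDiffOn_Icc (B.node_lt i)) (by simp)
  exact ContinuousOn.inner (𝕜 := ℝ) (continuousOn_const.mul h1) h2

theorem curve_mem_frontier (i : Fin B.n) {s : ℝ} (hs : s ∈ B.interval i) :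
    B.curve s ∈ frontier Ω := by
  rw [← B.image_eq]
  refine ⟨s, ⟨(B.node_strictMono.monotone (Fin.zero_le _)).trans hs.1,
    hs.2.trans (B.node_strictMono.monotone (Fin.le_last _))⟩, rfl⟩

end PiecewiseSmoothBoundary

/-- The reflection maps `e^{iθ} τ` to `e^{-iθ} τ`, and the corresponding Larmor centres are the
points at angles `θ` and `-θ`, measured from `J τ`, of the circle of radius `r` about the boundary
point. -/
theorem IsPolynomialIntegral.isSymmetricOnCircle {β : ℝ} {Ω : Set ℂ}
    {B : PiecewiseSmoothBoundary Ω} {Φ : ℂ → ℂ → ℝ} (hΦ : IsPolynomialIntegral β B Φ)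
    {F : MvPolynomial (Fin 2) ℂ} (hF : ∀ x ∈ closure Ω, ∀ v : ℂ, ‖v‖ = 1 →
      (Φ x v : ℂ) = eval (toC2 (larmorCenter β x v)) F) (i : Fin B.n) {s : ℝ}
    (hs : s ∈ B.openInterval i) :
    IsSymmetricOnCircle F (1 / β) (B.curve s) (Complex.I * B.tangent i s) := by
  intro θ
  have hs' := B.openInterval_subset i hs
  have hcl : B.curve s ∈ closure Ω := frontier_subset_closure (B.curve_mem_frontier i hs')
  have hτ : ‖B.tangent i s‖ = 1 := B.unit_speed i s hs'
  set τ := B.tangent i s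
  have hv : ‖Complex.exp (θ * Complex.I) * τ‖ = 1 := by
    rw [norm_mul, hτ, Complex.norm_exp_ofReal_mul_I, one_mul]
  have hv' : ‖Complex.exp (-(θ * Complex.I)) * τ‖ = 1 := by
    rw [norm_mul, hτ, mul_one]
    simpa using Complex.norm_exp_ofReal_mul_I (-θ)
  have hrefl : reflect (B.normal i s) (Complex.exp (θ * Complex.I) * τ)
      = Complex.exp (-(θ * Complex.I)) * τ := by
    have h4 : τ.re * τ.re + τ.im * τ.im = 1 := by
      rw [← Complex.normSq_apply, Complex.normSq_eq_norm_sq, hτ, one_pow]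
    have e1 : Complex.exp (-(θ * Complex.I)) = Real.cos θ - Real.sin θ * Complex.I := by
      rw [show -((θ : ℂ) * Complex.I) = ((-θ : ℝ) : ℂ) * Complex.I by push_cast; ring,
        Complex.exp_mul_I, ← Complex.ofReal_cos, ← Complex.ofReal_sin, Real.cos_neg, Real.sin_neg]
      push_cast; ring
    have e2 : Complex.exp (θ * Complex.I) = Real.cos θ + Real.sin θ * Complex.I := by
      rw [Complex.exp_mul_I, ← Complex.ofReal_cos, ← Complex.ofReal_sin]
    rw [e1, e2, reflect, PiecewiseSmoothBoundary.normal]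
    generalize Real.cos θ = c
    generalize Real.sin θ = d
    change _ - (2 * inner ℝ (Complex.I * τ) _) • (Complex.I * τ) = _
    apply Complex.ext
    · simp [Complex.inner]
      linear_combination (2 * d * τ.im) * h4
    · simp [Complex.inner]
      linear_combination (-2 * d * τ.re) * h4
  have key := hΦ.reflection_invariant i s hs _ hv
  rw [hrefl] at key
  have h1 := hF _ hcl _ hv
  have h2 := hF _ hcl _ hv'
  rw [key, h2] at h1
  convert! h1.symm using 3
  · rw [larmorCenter]; congr 1; ring
  · rw [larmorCenter]; congr 1; ring

theorem parallelCurve_eq (β : ℝ) {Ω : Set ℂ} (B : PiecewiseSmoothBoundary Ω) (i : Fin B.n) (σ : ℝ) :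
    parallelCurve β B i σ = parallel B.curve (B.tangent i) (σ * (1 / β)) '' B.interval i := by
  rw [parallelCurve]
  congr 1
  ext s
  rw [larmorCenter, parallel]; push_cast; ring

end

/-! ### Polynomials on circles; symmetry at infinitely many points of a circle gives radiality. -/

section

open MvPolynomial

/-- The restriction of a polynomial to circles is a trigonometric polynomial of bounded degree. -/
theorem exists_circle_polynomial (f : MvPolynomial (Fin 2) ℂ) : ∃ N : ℕ, ∀ o w : ℂ,
    ∃ P : Polynomial ℂ, P.natDegree ≤ 2 * N ∧
      ∀ η : ℂ, ‖η‖ = 1 → P.eval η = η ^ N * eval (toC2 (o + w * η)) f := by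
  induction f using MvPolynomial.induction_on with
  | C a => exact ⟨0, fun o w => ⟨Polynomial.C a, by simp, fun η _ => by simp⟩⟩
  | add p q hp hq =>
    obtain ⟨N, hN⟩ := hp
    obtain ⟨M, hM⟩ := hq
    refine ⟨N + M, fun o w => ?_⟩
    obtain ⟨P, hPd, hP⟩ := hN o w
    obtain ⟨Q, hQd, hQ⟩ := hM o w
    refine ⟨Polynomial.X ^ M * P + Polynomial.X ^ N * Q, ?_, fun η hη => ?_⟩
    · have h1 := Polynomial.natDegree_mul_le_of_le (Polynomial.natDegree_X_pow_le (R := ℂ) M) hPd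
      have h2 := Polynomial.natDegree_mul_le_of_le (Polynomial.natDegree_X_pow_le (R := ℂ) N) hQd
      exact Polynomial.natDegree_add_le_of_degree_le (h1.trans (by omega)) (h2.trans (by omega))
    · simp only [Polynomial.eval_add, Polynomial.eval_mul, Polynomial.eval_pow, Polynomial.eval_X,
        hP η hη, hQ η hη, map_add]
      ring
  | mul_X p i hp =>
    obtain ⟨N, hN⟩ := hp
    refine ⟨N + 1, fun o w => ?_⟩
    obtain ⟨P, hPd, hP⟩ := hN o w
    obtain ⟨a, b, c, habc⟩ : ∃ a b c : ℂ, ∀ η : ℂ, ‖η‖ = 1 →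
        η * toC2 (o + w * η) i = a * η ^ 2 + b * η + c := by
      fin_cases i
      · refine ⟨w / 2, o.re, (starRingEnd ℂ) w / 2, fun η hη => ?_⟩
        have hη0 := ne_zero_of_norm_one hη
        change η * ((o + w * η).re : ℂ) = _
        rw [Complex.add_re, Complex.ofReal_add, Complex.re_eq_add_conj (w * η), map_mul, star_eq_inv_of_norm_one hη]
        field_simp
        ring
      · refine ⟨w / (2 * Complex.I), o.im, -(starRingEnd ℂ) w / (2 * Complex.I), fun η hη => ?_⟩
        have hη0 := ne_zero_of_norm_one hη
        change η * ((o + w * η).im : ℂ) = _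
        rw [Complex.add_im, Complex.ofReal_add, Complex.im_eq_sub_conj (w * η), map_mul, star_eq_inv_of_norm_one hη]
        field_simp
        ring
    refine ⟨P * (Polynomial.C a * Polynomial.X ^ 2 + Polynomial.C b * Polynomial.X + Polynomial.C c),
      ?_, fun η hη => ?_⟩
    · exact (Polynomial.natDegree_mul_le_of_le hPd Polynomial.natDegree_quadratic_le).trans (by omega)
    · simp only [Polynomial.eval_add, Polynomial.eval_mul, Polynomial.eval_pow, Polynomial.eval_X,
        Polynomial.eval_C, hP η hη, map_mul, eval_X]
      rw [← habc η hη]; ring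

/-- After multiplication by a power of `η` both sides are polynomials in `η`, so infinitely many
agreements suffice. -/
theorem eval_circle_eq_of_infinite (f : MvPolynomial (Fin 2) ℂ) {o w w' : ℂ} {S : Set ℂ}
    (hS : S.Infinite) (hS1 : ∀ η ∈ S, ‖η‖ = 1)
    (h : ∀ η ∈ S, eval (toC2 (o + w * η)) f = eval (toC2 (o + w' * η)) f) {η : ℂ} (hη : ‖η‖ = 1) :
    eval (toC2 (o + w * η)) f = eval (toC2 (o + w' * η)) f := by
  obtain ⟨N, hN⟩ := exists_circle_polynomial f
  obtain ⟨P, -, hP⟩ := hN o w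
  obtain ⟨Q, -, hQ⟩ := hN o w'
  have hPQ : P = Q := Polynomial.eq_of_infinite_eval_eq _ _ (hS.mono fun η hη => by
    change P.eval η = Q.eval η
    rw [hP η (hS1 η hη), hQ η (hS1 η hη), h η hη])
  have h1 := hP η hη
  rw [hPQ, hQ η hη] at h1
  exact (mul_left_cancel₀ (pow_ne_zero _ (ne_zero_of_norm_one hη)) h1).symm

/-- A polynomial that is invariant under a rotation of a circle, which is not of small finite order,
is constant on the circle. -/
theorem eval_circle_const {f : MvPolynomial (Fin 2) ℂ} {N : ℕ} {o R : ℂ}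
    (hP : ∃ P : Polynomial ℂ, P.natDegree ≤ 2 * N ∧
      ∀ η : ℂ, ‖η‖ = 1 → P.eval η = η ^ N * eval (toC2 (o + R * η)) f) {ζ : ℂ} (hζ : ‖ζ‖ = 1)
    (hord : ∀ n : ℕ, 0 < n → n ≤ 2 * N → ζ ^ n ≠ 1)
    (hinv : ∀ η : ℂ, ‖η‖ = 1 → eval (toC2 (o + R * (ζ * η))) f = eval (toC2 (o + R * η)) f)
    {η : ℂ} (hη : ‖η‖ = 1) : eval (toC2 (o + R * η)) f = eval (toC2 (o + R)) f := by
  obtain ⟨P, hPd, hP⟩ := hP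
  have hpow : ∀ n : ℕ, eval (toC2 (o + R * ζ ^ n)) f = eval (toC2 (o + R)) f := by
    intro n
    induction n with
    | zero => simp
    | succ n ih => rw [pow_succ', hinv _ (by rw [norm_pow, hζ, one_pow]), ih]
  obtain ⟨c, hc⟩ : ∃ c, eval (toC2 (o + R)) f = c := ⟨_, rfl⟩
  rw [hc] at hpow ⊢
  obtain ⟨Q, hQ⟩ : ∃ Q : Polynomial ℂ, Q = P - Polynomial.C c * Polynomial.X ^ N := ⟨_, rfl⟩
  have hQd : Q.natDegree ≤ 2 * N := by
    rw [hQ]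
    have h1 : (Polynomial.C c * Polynomial.X ^ N).natDegree ≤ 2 * N :=
      (Polynomial.natDegree_C_mul_X_pow_le c N).trans (by omega)
    exact (Polynomial.natDegree_sub_le_of_le hPd h1).trans (max_self _).le
  have hinj : Set.InjOn (fun n : ℕ => ζ ^ n) (Finset.range (2 * N + 1) : Set ℕ) := by
    have hlt : ∀ m n : ℕ, m < n → n ≤ 2 * N → ζ ^ m ≠ ζ ^ n := fun m n hmn hn heq => by
      refine hord (n - m) (by omega) (by omega) ?_
      have h0 : ζ ^ m ≠ 0 := pow_ne_zero _ (ne_zero_of_norm_one hζ)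
      apply mul_left_cancel₀ h0
      rw [← pow_add, mul_one, Nat.add_sub_cancel' hmn.le, heq]
    intro m hm n hn hmn
    simp only [Finset.coe_range, Set.mem_Iio] at hm hn
    rcases lt_trichotomy m n with h | h | h
    · exact absurd hmn (hlt m n h (by omega))
    · exact h
    · exact absurd hmn.symm (hlt n m h (by omega))
  -- The `2N + 1` distinct powers of `ζ` are zeros of `Q`, whose degree is at most `2N`.
  have hQ0 : Q = 0 := by
    refine Polynomial.eq_zero_of_natDegree_lt_card_of_eval_eq_zero' Q
      ((Finset.range (2 * N + 1)).image fun n => ζ ^ n) ?_ ?_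
    · intro z hz
      obtain ⟨n, -, rfl⟩ := Finset.mem_image.1 hz
      rw [hQ, Polynomial.eval_sub, hP _ (by rw [norm_pow, hζ, one_pow]), hpow]
      simp only [Polynomial.eval_mul, Polynomial.eval_C, Polynomial.eval_pow, Polynomial.eval_X]
      ring
    · rw [Finset.card_image_of_injOn hinj, Finset.card_range]; omega
  have h1 := hP η hη
  rw [hQ0, eq_comm, sub_eq_zero] at hQ
  rw [hQ] at h1
  simp only [Polynomial.eval_mul, Polynomial.eval_C, Polynomial.eval_pow, Polynomial.eval_X] at h1
  rw [mul_comm] at h1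
  exact (mul_left_cancel₀ (pow_ne_zero _ (ne_zero_of_norm_one hη)) h1).symm

theorem exists_line_polynomial (f : MvPolynomial (Fin 2) ℂ) (o η : ℂ) :
    ∃ P : Polynomial ℂ, ∀ ρ : ℝ, P.eval (ρ : ℂ) = eval (toC2 (o + ρ * η)) f := by
  refine ⟨aeval (fun i => Polynomial.C (toC2 o i) + Polynomial.C (toC2 η i) * Polynomial.X) f,
    fun ρ => ?_⟩
  induction f using MvPolynomial.induction_on with
  | C a => simp
  | add p q hp hq => simp only [map_add, Polynomial.eval_add, hp, hq]
  | mul_X p i hp =>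
    rw [map_mul, map_mul, Polynomial.eval_mul, hp]
    congr 1
    fin_cases i <;> simp [toC2] <;> ring

/-- There are only finitely many roots of unity of order at most `M`, so those different from 1 keep
away from 1. -/
theorem eventually_pow_ne_one (M : ℕ) : ∀ᶠ z : ℂ in nhds 1, z ≠ 1 →
    ∀ n : ℕ, 0 < n → n ≤ M → z ^ n ≠ 1 := by
  have hfin : {z : ℂ | z ≠ 1 ∧ ∃ n : ℕ, 0 < n ∧ n ≤ M ∧ z ^ n = 1}.Finite := by
    refine Set.Finite.subset (s := ⋃ n ∈ Set.Icc 1 M, {z : ℂ | z ^ n = 1}) ?_ ?_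
    · refine (Set.finite_Icc 1 M).biUnion fun n hn => ?_
      refine ((Polynomial.X ^ n - 1 : Polynomial ℂ).roots.toFinset.finite_toSet).subset fun z hz => ?_
      have h0 : (Polynomial.X ^ n - 1 : Polynomial ℂ) ≠ 0 :=
        Polynomial.X_pow_sub_C_ne_zero (by have := hn.1; omega) 1
      have hz' : z ^ n = 1 := hz
      simp [h0, hz']
    · rintro z ⟨-, n, h1, h2, h3⟩
      simp only [Set.mem_iUnion]
      exact ⟨n, ⟨h1, h2⟩, h3⟩
  have := hfin.isClosed.isOpen_compl.mem_nhds (x := 1) (by simp)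
  filter_upwards [this] with z hz hz1 n hn hnM hzn
  exact hz ⟨hz1, n, hn, hnM, hzn⟩

/-- A polynomial whose restrictions to the circles of radius `r` centred at the points of an
infinite subset of a circle about `o` are symmetric, is radial about `o`. -/
theorem radial_of_symmetric {f : MvPolynomial (Fin 2) ℂ} {o : ℂ} {d r : ℝ} (hd : 0 < d) (hr : 0 < r)
    {S : Set ℂ} (hS : S.Infinite) (hS1 : ∀ η ∈ S, ‖η‖ = 1)
    (h : ∀ η ∈ S, IsSymmetricOnCircle f r (o + d * η) η) (ρ : ℝ) {η : ℂ} (hη : ‖η‖ = 1) :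
    eval (toC2 (o + ρ * η)) f = eval (toC2 (o + ρ)) f := by
  -- The circle about `o + dη` consists of the points `o + w(θ) η`, and reflection in the line
  -- through `o` with direction `η` replaces `w(θ)` by its conjugate.
  let w : ℝ → ℂ := fun θ => d + r * Complex.exp (θ * Complex.I)
  have hconj : ∀ θ : ℝ, (starRingEnd ℂ) (w θ) = d + r * Complex.exp (-(θ * Complex.I)) := fun θ => by
    simp only [w, map_add, map_mul, Complex.conj_ofReal, ← Complex.exp_conj, Complex.conj_I, mul_neg]
  have hsym : ∀ (θ : ℝ) (η : ℂ), ‖η‖ = 1 →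
      eval (toC2 (o + w θ * η)) f = eval (toC2 (o + (starRingEnd ℂ) (w θ) * η)) f := by
    intro θ η hη
    refine eval_circle_eq_of_infinite f hS hS1 (fun η hη => ?_) hη
    have := h η hη θ
    rw [hconj]
    convert! this using 3
    · congr 1; simp only [w]; ring
    · congr 1; ring
  obtain ⟨N, hN⟩ := exists_circle_polynomial f
  have hcont : Continuous w := by fun_prop
  have hw0 : w 0 ≠ 0 := by
    have : w 0 = ((d + r : ℝ) : ℂ) := by simp [w]
    rw [this]; exact_mod_cast (by positivity : d + r ≠ 0)
  have hlim : Filter.Tendsto (fun θ => (starRingEnd ℂ) (w θ) / w θ) (nhds 0) (nhds 1) := by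
    have h1 : ContinuousAt (fun θ => (starRingEnd ℂ) (w θ) / w θ) 0 :=
      (Complex.continuous_conj.comp hcont).continuousAt.div hcont.continuousAt hw0
    have h2 : (starRingEnd ℂ) (w 0) / w 0 = 1 := by
      rw [hconj, div_eq_one_iff_eq hw0]; simp [w]
    have h3 := h1.tendsto
    rwa [h2] at h3
  have hw_ev := hcont.continuousAt.eventually_ne hw0
  obtain ⟨ε, hε, hball⟩ := Metric.eventually_nhds_iff.1
    ((hlim.eventually (eventually_pow_ne_one (2 * N))).and hw_ev)
  set U := Set.Ioo 0 (min ε Real.pi)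
  have hU : U.Infinite := Set.Ioo_infinite (lt_min hε Real.pi_pos)
  -- For small `θ > 0` the number `conj w / w` is not 1 but close to 1, so the corresponding
  -- rotation has no small finite order and `f` is constant on the circle of radius `|w|`.
  have hconst : ∀ θ ∈ U, ∀ η : ℂ, ‖η‖ = 1 →
      eval (toC2 (o + (‖w θ‖ : ℂ) * η)) f = eval (toC2 (o + (‖w θ‖ : ℂ))) f := by
    intro θ hθ η hη
    obtain ⟨h1, h2⟩ := hball (y := θ) (by
      rw [Real.dist_eq, sub_zero, abs_of_pos hθ.1]; exact hθ.2.trans_le (min_le_left _ _))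
    have hnorm : (‖w θ‖ : ℂ) ≠ 0 := by exact_mod_cast (norm_pos_iff.2 h2).ne'
    refine eval_circle_const (hN o _) (ζ := (starRingEnd ℂ) (w θ) / w θ) ?_ (h1 ?_) ?_ hη
    · rw [norm_div, Complex.norm_conj, div_self (norm_ne_zero_iff.2 h2)]
    · rw [Ne, div_eq_one_iff_eq h2]
      intro hc
      have him := Complex.conj_eq_iff_im.1 hc
      have : r * Real.sin θ = 0 := by
        simp only [w, Complex.add_im, Complex.ofReal_im, zero_add, Complex.im_ofReal_mul,
          Complex.exp_ofReal_mul_I_im] at him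
        exact him
      have hsin := Real.sin_pos_of_pos_of_lt_pi hθ.1 (hθ.2.trans_le (min_le_right _ _))
      exact (mul_pos hr hsin).ne' this
    · intro η hη
      have hη' : ‖(‖w θ‖ : ℂ) / w θ * η‖ = 1 := by
        rw [norm_mul, hη, mul_one, norm_div, Complex.norm_real, norm_norm,
          div_self (norm_ne_zero_iff.2 h2)]
      have := hsym θ _ hη'
      convert! this.symm using 3
      · congr 1; field_simp
      · congr 1; field_simp
  -- `|w| ^ 2 = d ^ 2 + r ^ 2 + 2 d r cos θ` is injective on `(0, π)`, so infinitely many radii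
  -- occur and polynomials along rays can be compared.
  have hinj : Set.InjOn (fun θ => (‖w θ‖ : ℂ)) U := by
    have hsq : ∀ θ : ℝ, ‖w θ‖ ^ 2 = d ^ 2 + r ^ 2 + 2 * d * r * Real.cos θ := fun θ => by
      rw [← Complex.normSq_eq_norm_sq, Complex.normSq_apply]
      simp only [w, Complex.add_re, Complex.ofReal_re, Complex.re_ofReal_mul,
        Complex.exp_ofReal_mul_I_re, Complex.add_im, Complex.ofReal_im, Complex.im_ofReal_mul,
        Complex.exp_ofReal_mul_I_im]
      linear_combination r ^ 2 * Real.sin_sq_add_cos_sq θ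
    intro θ hθ θ' hθ' heq
    have h1 : ‖w θ‖ = ‖w θ'‖ := Complex.ofReal_injective heq
    have h2 : Real.cos θ = Real.cos θ' := by
      have := hsq θ
      rw [h1, hsq θ'] at this
      have hdr : 2 * d * r ≠ 0 := by positivity
      apply mul_left_cancel₀ hdr
      linarith
    exact Real.injOn_cos ⟨hθ.1.le, (hθ.2.trans_le (min_le_right _ _)).le⟩
      ⟨hθ'.1.le, (hθ'.2.trans_le (min_le_right _ _)).le⟩ h2
  obtain ⟨P, hP⟩ := exists_line_polynomial f o η
  obtain ⟨Q, hQ⟩ := exists_line_polynomial f o 1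
  have hPQ : P = Q := by
    refine Polynomial.eq_of_infinite_eval_eq _ _ ((hU.image hinj).mono ?_)
    rintro _ ⟨θ, hθ, rfl⟩
    change P.eval (‖w θ‖ : ℂ) = Q.eval (‖w θ‖ : ℂ)
    rw [hP, hQ, mul_one]
    exact hconst θ hθ η hη
  rw [← hP, hPQ, hQ, mul_one]

/-- A continuous function with values in a finite set is constant on connected sets. -/
theorem eq_of_finite_values {X : Type*} [MetricSpace X] {s : Set ℝ} (hs : IsPreconnected s)
    {f : ℝ → X} (hf : ContinuousOn f s) {V : Set X} (hV : V.Finite) (hfV : ∀ t ∈ s, f t ∈ V) {a b : ℝ}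
    (ha : a ∈ s) (hb : b ∈ s) : f a = f b := by
  have := hV.countable.isTotallyDisconnected (f '' s) (by rintro _ ⟨t, ht, rfl⟩; exact hfV t ht)
    (hs.image f hf)
  exact this ⟨a, ha, rfl⟩ ⟨b, hb, rfl⟩

end

/-! ### A circular boundary arc forces the boundary to be a circle. -/

section

open MvPolynomial

/-- A connected set that avoids the sphere and meets `Ω` contains no frontier point and so lies in
`Ω`. A point of `Ω` outside the closed disc would thus bring an unbounded ray into `Ω`; openness
excludes points on the sphere; and the open disc, being connected, fills `Ω`. -/
theorem frontier_eq_sphere {Ω : Set ℂ} (hΩo : IsOpen Ω) (hΩne : Ω.Nonempty)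
    (hΩb : Bornology.IsBounded Ω) {o : ℂ} {d : ℝ} (hd : 0 < d)
    (h : frontier Ω ⊆ Metric.sphere o d) : frontier Ω = Metric.sphere o d := by
  have hsub : ∀ U : Set ℂ, IsPreconnected U → (U ∩ Ω).Nonempty →
      (∀ x ∈ U, x ∉ Metric.sphere o d) → U ⊆ Ω := fun U hU hne hdis => by
    by_contra hnot
    obtain ⟨y, hy, hyΩ⟩ := Set.not_subset.1 hnot
    have hcov : U ⊆ Ω ∪ (closure Ω)ᶜ := fun x hx => by
      by_contra hc
      rw [Set.mem_union, not_or, Set.notMem_compl_iff] at hc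
      exact hdis x hx (h (by rw [hΩo.frontier_eq]; exact ⟨hc.2, hc.1⟩))
    obtain ⟨x, -, hx, hx'⟩ := hU Ω (closure Ω)ᶜ hΩo isClosed_closure.isOpen_compl hcov hne
      ⟨y, hy, (hcov hy).resolve_left hyΩ⟩
    exact hx' (subset_closure hx)
  have hle : ∀ x ∈ Ω, ‖x - o‖ ≤ d := by
    intro x hx
    by_contra! hlt
    have hray : (fun t : ℝ => o + t * (x - o)) '' Set.Ici 1 ⊆ Ω := by
      refine hsub _ ((convex_Ici (1 : ℝ)).isPreconnected.image _ (by fun_prop))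
        ⟨x, ⟨1, Set.self_mem_Ici, by simp⟩, hx⟩ ?_
      rintro _ ⟨t, ht, rfl⟩ hmem
      rw [mem_sphere_iff_norm, add_sub_cancel_left, norm_mul, Complex.norm_real,
        Real.norm_of_nonneg (zero_le_one.trans ht)] at hmem
      have : 1 * ‖x - o‖ ≤ t * ‖x - o‖ := mul_le_mul_of_nonneg_right ht (norm_nonneg _)
      linarith
    obtain ⟨C, hC⟩ := (Metric.isBounded_iff_subset_closedBall o).1 hΩb
    have hx0 : 0 < ‖x - o‖ := hd.trans hlt
    have h1 : (1 : ℝ) ≤ |C| / ‖x - o‖ + 1 := by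
      have : 0 ≤ |C| / ‖x - o‖ := by positivity
      linarith
    have h2 := hC (hray ⟨|C| / ‖x - o‖ + 1, h1, rfl⟩)
    rw [mem_closedBall_iff_norm, add_sub_cancel_left, norm_mul, Complex.norm_real,
      Real.norm_of_nonneg (zero_le_one.trans h1), add_mul, div_mul_cancel₀ _ hx0.ne'] at h2
    linarith [le_abs_self C]
  have hlt : ∀ x ∈ Ω, ‖x - o‖ < d := by
    intro x hx
    refine lt_of_le_of_ne (hle x hx) fun heq => ?_
    have hcont : Filter.Tendsto (fun t : ℝ => o + t * (x - o)) (nhds 1) (nhds x) := by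
      have : Continuous fun t : ℝ => o + t * (x - o) := by fun_prop
      simpa using this.tendsto 1
    obtain ⟨ε, hε, hb⟩ := Metric.eventually_nhds_iff.1 (hcont.eventually (hΩo.mem_nhds hx))
    have h1 := hle _ (hb (y := 1 + ε / 2) (by
      rw [Real.dist_eq, add_sub_cancel_left, abs_of_pos (by positivity)]; linarith))
    rw [add_sub_cancel_left, norm_mul, Complex.norm_real,
      Real.norm_of_nonneg (by positivity), heq] at h1
    nlinarith
  have hball : Ω = Metric.ball o d := by
    refine Set.Subset.antisymm (fun x hx => mem_ball_iff_norm.2 (hlt x hx)) ?_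
    obtain ⟨x, hx⟩ := hΩne
    refine hsub _ (convex_ball o d).isPreconnected ⟨x, mem_ball_iff_norm.2 (hlt x hx), hx⟩ ?_
    intro y hy hy'
    rw [mem_ball_iff_norm] at hy
    rw [mem_sphere_iff_norm] at hy'
    linarith
  rw [hball, frontier_ball o hd.ne']

theorem normSq_sub_const_of_orthogonal {γ τ : ℝ → ℂ} {s₀ s₁ : ℝ} {o : ℂ}
    (hγ : ∀ s ∈ Set.Ioo s₀ s₁, HasDerivAt γ (τ s) s)
    (h : ∀ s ∈ Set.Ioo s₀ s₁, inner ℝ (γ s - o) (τ s) = 0) {s t : ℝ} (hs : s ∈ Set.Ioo s₀ s₁)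
    (ht : t ∈ Set.Ioo s₀ s₁) : ‖γ s - o‖ = ‖γ t - o‖ := by
  have hd : ∀ s ∈ Set.Ioo s₀ s₁, HasDerivAt (fun s => ‖γ s - o‖ ^ 2) 0 s := fun s hs => by
    have := ((hγ s hs).sub_const o).norm_sq
    rwa [h s hs, mul_zero] at this
  have := isOpen_Ioo.is_const_of_deriv_eq_zero (convex_Ioo s₀ s₁).isPreconnected
    (fun x hx => (hd x hx).differentiableAt.differentiableWithinAt)
    (fun x hx => (hd x hx).deriv) hs ht
  exact (sq_eq_sq₀ (norm_nonneg _) (norm_nonneg _)).1 this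

theorem orthogonal_of_normSq_sub_const {γ : ℝ → ℂ} {v : ℂ} {s s₀ s₁ c : ℝ} {o : ℂ}
    (hs : s ∈ Set.Ioo s₀ s₁) (hγ : HasDerivAt γ v s)
    (h : ∀ s ∈ Set.Ioo s₀ s₁, ‖γ s - o‖ = c) : inner ℝ (γ s - o) v = 0 := by
  have h1 := (hγ.sub_const o).norm_sq
  have h2 : (fun t => ‖γ t - o‖ ^ 2) =ᶠ[nhds s] fun _ => c ^ 2 :=
    Filter.mem_of_superset (Ioo_mem_nhds hs.1 hs.2) fun t ht => by
      change ‖γ t - o‖ ^ 2 = c ^ 2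
      rw [h t ht]
  have h3 := (h1.congr_of_eventuallyEq h2.symm).unique (hasDerivAt_const s (c ^ 2))
  linarith

theorem eq_mul_normal_of_orthogonal {w τ : ℂ} (hτ : ‖τ‖ = 1) (h : inner ℝ w τ = 0) :
    w = (‖w‖ : ℂ) * (Complex.I * τ) ∨ w = -((‖w‖ : ℂ) * (Complex.I * τ)) := by
  have h4 : τ.re * τ.re + τ.im * τ.im = 1 := by
    rw [← Complex.normSq_apply, Complex.normSq_eq_norm_sq, hτ, one_pow]
  simp only [Complex.inner, Complex.mul_re, Complex.conj_re, Complex.conj_im] at h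
  obtain ⟨a, ha⟩ : ∃ a : ℝ, w = a * (Complex.I * τ) := by
    refine ⟨w.im * τ.re - w.re * τ.im, Complex.ext ?_ ?_⟩
    · simp
      linear_combination (-w.re) * h4 + τ.re * h
    · simp
      linear_combination (-w.im) * h4 + τ.im * h
  have hw : ‖w‖ = |a| := by
    rw [ha, norm_mul, norm_mul, hτ, Complex.norm_I, mul_one, mul_one, Complex.norm_real,
      Real.norm_eq_abs]
  rw [hw]
  rcases abs_choice a with h | h <;> rw [h]
  · exact Or.inl ha
  · right; rw [ha]; push_cast; ring

namespace PiecewiseSmoothBoundary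

variable {Ω : Set ℂ} (B : PiecewiseSmoothBoundary Ω)

theorem injOn_curve (i : Fin B.n) : Set.InjOn B.curve (B.openInterval i) :=
  B.simple.mono (Set.Ioo_subset_Ico_self.trans (Set.Ico_subset_Ico
    (B.node_strictMono.monotone (Fin.zero_le _)) (B.node_strictMono.monotone (Fin.le_last _))))

theorem exists_mem_interval {s : ℝ} (hs : s ∈ Set.Icc (B.node 0) (B.node (Fin.last B.n))) :
    ∃ i : Fin B.n, s ∈ B.interval i := by
  have key : ∀ j : Fin (B.n + 1), s ≤ B.node j → ∃ i : Fin B.n, s ∈ B.interval i := by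
    intro j
    induction j using Fin.induction with
    | zero =>
      intro h
      have h0 : s = B.node 0 := le_antisymm h hs.1
      refine ⟨⟨0, B.n_pos⟩, ?_⟩
      have : (⟨0, B.n_pos⟩ : Fin B.n).castSucc = 0 := rfl
      exact ⟨by rw [this, h0], by rw [h0, ← this]; exact (B.node_lt _).le⟩
    | succ i ih =>
      intro h
      rcases le_total s (B.node i.castSucc) with h1 | h1
      · exact ih h1
      · exact ⟨i, h1, h⟩
  exact key _ hs.2

/-- If every smooth piece lies on a circle about `o`, so does the boundary. -/
theorem frontier_subset_sphere {o : ℂ}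
    (h : ∀ i, ∀ s ∈ B.interval i, ∀ t ∈ B.interval i, ‖B.curve s - o‖ = ‖B.curve t - o‖) :
    frontier Ω ⊆ Metric.sphere o ‖B.curve (B.node 0) - o‖ := by
  have hl : ∀ i : Fin B.n, B.node i.castSucc ∈ B.interval i := fun i => ⟨le_rfl, (B.node_lt i).le⟩
  have hr : ∀ i : Fin B.n, B.node i.succ ∈ B.interval i := fun i => ⟨(B.node_lt i).le, le_rfl⟩
  have hnode : ∀ j : Fin (B.n + 1), ‖B.curve (B.node j) - o‖ = ‖B.curve (B.node 0) - o‖ := by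
    intro j
    induction j using Fin.induction with
    | zero => rfl
    | succ i ih => rw [h i _ (hr i) _ (hl i), ih]
  rw [← B.image_eq]
  rintro _ ⟨s, hs, rfl⟩
  obtain ⟨i, hi⟩ := B.exists_mem_interval hs
  rw [mem_sphere_iff_norm, h i s hi _ (hl i), hnode]

end PiecewiseSmoothBoundary

/-- If a part of the boundary lies on a circle, then the boundary is a circle. -/
theorem frontier_eq_sphere_of_arc {β : ℝ} (hβ : 0 < β) {Ω : Set ℂ} (hΩo : IsOpen Ω)
    (hΩne : Ω.Nonempty) (hΩb : Bornology.IsBounded Ω) {B : PiecewiseSmoothBoundary Ω}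
    (hcurv : ∀ i, ∀ s ∈ B.interval i, β ≤ B.curvature i s) {F : MvPolynomial (Fin 2) ℂ}
    (hsymm : ∀ i, ∀ s ∈ B.openInterval i,
      IsSymmetricOnCircle F (1 / β) (B.curve s) (Complex.I * B.tangent i s))
    (hF : ∃ z z' : ℂ, eval (toC2 z) F ≠ eval (toC2 z') F) {i : Fin B.n} {s₀ s₁ : ℝ} (h01 : s₀ < s₁)
    (hsub : Set.Ioo s₀ s₁ ⊆ B.openInterval i) {o : ℂ} {d : ℝ} (hd : 0 < d)
    (harc : ∀ s ∈ Set.Ioo s₀ s₁, ‖B.curve s - o‖ = d) :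
    ∃ (o : ℂ) (d : ℝ), 0 < d ∧ frontier Ω = Metric.sphere o d := by
  have hr : 0 < 1 / β := by positivity
  have hd' : (d : ℂ) ≠ 0 := by exact_mod_cast hd.ne'
  have hrad : ∀ (ρ : ℝ) (η : ℂ), ‖η‖ = 1 → eval (toC2 (o + ρ * η)) F = eval (toC2 (o + ρ)) F := by
    intro ρ η hη
    refine radial_of_symmetric hd hr (S := (fun s => (B.curve s - o) / d) '' Set.Ioo s₀ s₁)
      ?_ ?_ ?_ ρ hη
    · refine (Set.Ioo_infinite h01).image fun s hs t ht hst => ?_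
      refine B.injOn_curve i (hsub hs) (hsub ht) ?_
      have := (div_left_inj' hd').1 hst
      linear_combination this
    · rintro _ ⟨s, hs, rfl⟩
      rw [norm_div, harc s hs, Complex.norm_real, Real.norm_of_nonneg hd.le, div_self hd.ne']
    · rintro _ ⟨s, hs, rfl⟩
      have h1 := hsymm i s (hsub hs)
      have h2 : o + d * ((B.curve s - o) / d) = B.curve s := by field_simp; ring
      have h3 := orthogonal_of_normSq_sub_const hs ((B.isFrenet i).hasDerivAt s (hsub hs)) harc
      beta_reduce
      rw [h2]
      -- The radial direction is `J τ` or `-J τ`, according to the side of the curve on which `o`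
      -- lies; the second case replaces `r` by `-r`.
      rcases eq_mul_normal_of_orthogonal ((B.isFrenet i).norm_tangent s (hsub hs)) h3 with h4 | h4
      · rw [h4, harc s hs, mul_div_cancel_left₀ _ hd']
        exact h1
      · rw [h4, harc s hs, neg_div, mul_div_cancel_left₀ _ hd']
        intro θ
        convert! h1.neg θ using 3
        · congr 1; push_cast; ring
        · congr 1; push_cast; ring
  obtain ⟨Q, hQ⟩ := exists_line_polynomial F o 1
  have hFQ : ∀ z : ℂ, eval (toC2 z) F = Q.eval (‖z - o‖ : ℂ) := by
    intro z
    rw [hQ, mul_one]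
    rcases eq_or_ne (z - o) 0 with h0 | h0
    · rw [h0, norm_zero]; rw [sub_eq_zero] at h0; rw [h0]; simp
    · have hn : (‖z - o‖ : ℂ) ≠ 0 := by exact_mod_cast norm_ne_zero_iff.2 h0
      rw [← hrad ‖z - o‖ ((z - o) / ‖z - o‖) (by
        rw [norm_div, Complex.norm_real, norm_norm, div_self (norm_ne_zero_iff.2 h0)])]
      rw [mul_div_cancel₀ _ hn, add_sub_cancel]
  have hfin : ∀ c : ℂ, {ρ : ℝ | Q.eval (ρ : ℂ) = c}.Finite := by
    intro c
    have hne : Q - Polynomial.C c ≠ 0 := by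
      intro h0
      obtain ⟨z, z', hz⟩ := hF
      rw [hFQ, hFQ, sub_eq_zero.1 h0] at hz
      simp at hz
    refine Set.Finite.subset ((Q - Polynomial.C c).roots.toFinset.finite_toSet.preimage
      (Complex.ofReal_injective.injOn)) fun ρ hρ => ?_
    have hρ' : Q.eval (ρ : ℂ) = c := hρ
    simp [hne, hρ']
  -- The curve `γ_{-r}` is used because its speed `1 + r k` never vanishes. `F` is constant on it
  -- and a nonconstant polynomial in the distance to `o`, so this distance takes finitely many
  -- values and is constant. Hence `γ_{-r} - o` is orthogonal to `τ`, and so is `γ - o`.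
  have hpiece : ∀ j, ∀ s ∈ B.openInterval j, ∀ t ∈ B.openInterval j,
      ‖B.curve s - o‖ = ‖B.curve t - o‖ := by
    intro j s hs t ht
    have hfr := B.isFrenet j
    have hr' : -(1 / β) ≠ 0 := by simp [hβ.ne']
    have hpar : ∀ u ∈ B.openInterval j, ‖parallel B.curve (B.tangent j) (-(1 / β)) u - o‖
        = ‖parallel B.curve (B.tangent j) (-(1 / β)) s - o‖ := by
      intro u hu
      refine eq_of_finite_values (s := B.openInterval j)
        (f := fun u => ‖parallel B.curve (B.tangent j) (-(1 / β)) u - o‖) (convex_Ioo _ _).isPreconnected (fun x hx => ?_)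
        (hfin (eval (toC2 (parallel B.curve (B.tangent j) (-(1 / β)) s)) F)) (fun x hx => ?_) hu hs
      · exact ((hfr.hasDerivAt_parallel _ hx).continuousAt.sub
          continuousAt_const).norm.continuousWithinAt
      · change Q.eval _ = _
        rw [← hFQ]
        exact hfr.eval_parallel_eq hr' (fun s hs => (hsymm j s hs).neg) hx hs
    refine normSq_sub_const_of_orthogonal hfr.hasDerivAt (fun u hu => ?_) hs ht
    have h1 := orthogonal_of_normSq_sub_const hu (hfr.hasDerivAt_parallel (-(1 / β)) hu) hpar
    have hk := hcurv j u (B.openInterval_subset j hu)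
    have hk1 : 1 - -(1 / β) * B.curvature j u ≠ 0 := by
      have : 0 < 1 / β * B.curvature j u := mul_pos hr (hβ.trans_le hk)
      linarith
    rw [← Complex.real_smul, inner_smul_right] at h1
    have h2 := (mul_eq_zero.1 h1).resolve_left hk1
    simp only [parallel, Complex.inner, Complex.mul_re, Complex.conj_re, Complex.conj_im] at h2 ⊢
    simp at h2 ⊢
    linear_combination h2
  have hclosed : ∀ j, ∀ s ∈ B.interval j, ∀ t ∈ B.interval j,
      ‖B.curve s - o‖ = ‖B.curve t - o‖ := by
    intro j
    obtain ⟨u, hu⟩ : (B.openInterval j).Nonempty := Set.nonempty_Ioo.2 (B.node_lt j)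
    have hcont : ContinuousOn (fun s => ‖B.curve s - o‖) (B.interval j) :=
      ((B.smooth j).continuousOn.sub continuousOn_const).norm
    have hE : Set.EqOn (fun s => ‖B.curve s - o‖) (fun _ => ‖B.curve u - o‖) (B.interval j) := by
      refine Set.EqOn.of_subset_closure (s := B.openInterval j) (fun s hs => hpiece j s hs u hu) hcont
        continuousOn_const (B.openInterval_subset j) ?_
      rw [PiecewiseSmoothBoundary.openInterval, closure_Ioo (B.node_lt j).ne]
      exact subset_rfl
    intro s hs t ht
    exact (hE hs).trans (hE ht).symm
  have hsph := B.frontier_subset_sphere hclosed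
  -- Radius zero would contradict the injectivity of the parametrization.
  have hpos : 0 < ‖B.curve (B.node 0) - o‖ := by
    refine lt_of_le_of_ne (norm_nonneg _) fun h0 => ?_
    rw [← h0, Metric.sphere_zero] at hsph
    have h3 : B.node i.castSucc < B.node i.succ := B.node_lt i
    obtain ⟨a, ha⟩ := exists_between h3
    obtain ⟨b, hb⟩ := exists_between ha.2
    have ha' : a ∈ B.openInterval i := ha
    have hb' : b ∈ B.openInterval i := ⟨ha.1.trans hb.1, hb.2⟩
    have e1 := hsph (B.curve_mem_frontier i (B.openInterval_subset i ha'))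
    have e2 := hsph (B.curve_mem_frontier i (B.openInterval_subset i hb'))
    exact hb.1.ne (B.injOn_curve i ha' hb' (e1.trans e2.symm))
  exact ⟨o, _, hpos, frontier_eq_sphere hΩo hΩne hΩb hpos hsph⟩

end

/-! ### The symmetry condition to third order. -/

section

open MvPolynomial

theorem pderiv_one_zero (f : MvPolynomial (Fin 2) ℂ) :
    pderiv 1 (pderiv 0 f) = pderiv 0 (pderiv 1 f) := by
  ext m
  simp only [coeff_pderiv]
  rw [add_right_comm]
  simp
  ring

/-- The second derivative of `f` at `z` in the directions `v` and `w`. -/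
def dirEval₂ (f : MvPolynomial (Fin 2) ℂ) (z v w : ℂ) : ℂ :=
  dirEval (pderiv 0 f) z w * v.re + dirEval (pderiv 1 f) z w * v.im

/-- The third derivative of `f` at `z` in the directions `u`, `v` and `w`. -/
def dirEval₃ (f : MvPolynomial (Fin 2) ℂ) (z u v w : ℂ) : ℂ :=
  dirEval₂ (pderiv 0 f) z v w * u.re + dirEval₂ (pderiv 1 f) z v w * u.im

theorem hasDerivAt_dirEval (f : MvPolynomial (Fin 2) ℂ) {q v : ℝ → ℂ} {q' v' : ℂ} {t : ℝ}
    (hq : HasDerivAt q q' t) (hv : HasDerivAt v v' t) :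
    HasDerivAt (fun t => dirEval f (q t) (v t)) (dirEval₂ f (q t) (v t) q' + dirEval f (q t) v') t := by
  have hre : HasDerivAt (fun t => ((v t).re : ℂ)) (v'.re : ℂ) t :=
    ((Complex.reCLM.hasFDerivAt.comp_hasDerivAt t hv)).ofReal_comp
  have him : HasDerivAt (fun t => ((v t).im : ℂ)) (v'.im : ℂ) t :=
    ((Complex.imCLM.hasFDerivAt.comp_hasDerivAt t hv)).ofReal_comp
  have h := ((hasDerivAt_eval (pderiv 0 f) hq).mul hre).add ((hasDerivAt_eval (pderiv 1 f) hq).mul him)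
  convert! h using 1
  simp only [dirEval₂, dirEval]; ring

theorem hasDerivAt_dirEval₂ (f : MvPolynomial (Fin 2) ℂ) {q v w : ℝ → ℂ} {q' v' w' : ℂ} {t : ℝ}
    (hq : HasDerivAt q q' t) (hv : HasDerivAt v v' t) (hw : HasDerivAt w w' t) :
    HasDerivAt (fun t => dirEval₂ f (q t) (v t) (w t))
      (dirEval₃ f (q t) (v t) (w t) q' + dirEval₂ f (q t) v' (w t) + dirEval₂ f (q t) (v t) w') t := by
  have hre : HasDerivAt (fun t => ((v t).re : ℂ)) (v'.re : ℂ) t :=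
    ((Complex.reCLM.hasFDerivAt.comp_hasDerivAt t hv)).ofReal_comp
  have him : HasDerivAt (fun t => ((v t).im : ℂ)) (v'.im : ℂ) t :=
    ((Complex.imCLM.hasFDerivAt.comp_hasDerivAt t hv)).ofReal_comp
  have h := ((hasDerivAt_dirEval (pderiv 0 f) hq hw).mul hre).add
    ((hasDerivAt_dirEval (pderiv 1 f) hq hw).mul him)
  convert! h using 1
  simp only [dirEval₃, dirEval₂]; ring

theorem dirEval₂_comm (f : MvPolynomial (Fin 2) ℂ) (z v w : ℂ) :
    dirEval₂ f z v w = dirEval₂ f z w v := by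
  simp only [dirEval₂, dirEval, pderiv_one_zero]; ring

theorem dirEval₂_smul (f : MvPolynomial (Fin 2) ℂ) (z v w : ℂ) (c d : ℝ) :
    dirEval₂ f z (c * v) (d * w) = c * d * dirEval₂ f z v w := by
  simp only [dirEval₂, dirEval_smul, Complex.re_ofReal_mul, Complex.im_ofReal_mul]; push_cast; ring

theorem dirEval₃_smul (f : MvPolynomial (Fin 2) ℂ) (z u v w : ℂ) (b c d : ℝ) :
    dirEval₃ f z (b * u) (c * v) (d * w) = b * c * d * dirEval₃ f z u v w := by
  simp only [dirEval₃, dirEval₂_smul, Complex.re_ofReal_mul, Complex.im_ofReal_mul]; push_cast; ring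

open Asymptotics in
-- The first order expansion of `φ₂` is integrated twice, so no third derivative away from 0 is
-- needed.
theorem isLittleO_taylor_three {φ φ₁ φ₂ : ℝ → ℂ} {a b : ℂ} (h0 : ∀ t, HasDerivAt φ (φ₁ t) t)
    (h1 : ∀ t, HasDerivAt φ₁ (φ₂ t) t) (h2 : HasDerivAt φ₂ b 0) (e0 : φ 0 = 0) (e1 : φ₁ 0 = 0)
    (e2 : φ₂ 0 = a) :
    (fun t : ℝ => φ t - (a / 2 * t ^ 2 + b / 6 * t ^ 3)) =o[nhds 0] fun t : ℝ => t ^ 3 := by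
  have k2 : (fun t : ℝ => φ₂ t - a - b * t) =o[nhds 0] fun t : ℝ => (t - 0) ^ 1 := by
    have := h2.isLittleO
    simp only [sub_zero, e2, Complex.real_smul] at this
    simpa only [sub_zero, pow_one, mul_comm b] using this
  have hpow : ∀ (n : ℕ) (t : ℝ), HasDerivAt (fun t : ℝ => (t : ℂ) ^ n) (n * (t : ℂ) ^ (n - 1)) t :=
    fun n t => by simpa using (hasDerivAt_pow n (t : ℂ)).comp_ofReal
  have k1 : (fun t : ℝ => φ₁ t - (a * t + b / 2 * t ^ 2)) =o[nhds 0] fun t : ℝ => (t - 0) ^ 2 := by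
    have := convex_univ.isLittleO_pow_succ_real (s := Set.univ) (x₀ := (0 : ℝ)) (Set.mem_univ 0)
      (f := fun t : ℝ => φ₁ t - (a * t + b / 2 * t ^ 2)) (f' := fun t : ℝ => φ₂ t - a - b * t) (n := 1)
      (fun t _ => by
        have h := (h1 t).sub (((hpow 1 t).const_mul a).add ((hpow 2 t).const_mul (b / 2)))
        refine HasDerivAt.hasDerivWithinAt ?_
        convert! h using 1
        · ext t; simp
        · simp; ring) (by simpa using k2)
    simpa [e1] using this
  have := convex_univ.isLittleO_pow_succ_real (s := Set.univ) (x₀ := (0 : ℝ)) (Set.mem_univ 0)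
    (f := fun t : ℝ => φ t - (a / 2 * t ^ 2 + b / 6 * t ^ 3))
    (f' := fun t : ℝ => φ₁ t - (a * t + b / 2 * t ^ 2)) (n := 2)
    (fun t _ => by
      have h := (h0 t).sub (((hpow 2 t).const_mul (a / 2)).add ((hpow 3 t).const_mul (b / 6)))
      refine HasDerivAt.hasDerivWithinAt ?_
      convert! h using 1
      simp; ring) (by simpa using k1)
  simpa [e0] using this

/-- Comparison of the lowest coefficients of odd order of an even function. -/
theorem third_order_of_even {φ φ₁ φ₂ ψ : ℝ → ℂ} {a b c : ℂ} (h0 : ∀ t, HasDerivAt φ (φ₁ t) t)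
    (h1 : ∀ t, HasDerivAt φ₁ (φ₂ t) t) (h2 : HasDerivAt φ₂ b 0) (e0 : φ 0 = 0) (e1 : φ₁ 0 = 0)
    (e2 : φ₂ 0 = a) (ha : a ≠ 0) (hψ : HasDerivAt ψ c 0) {m : ℕ}
    (heven : ∀ t, φ t ^ (m + 1) * ψ t = φ (-t) ^ (m + 1) * ψ (-t)) :
    (m + 1) * b * ψ 0 + 3 * a * c = 0 := by
  have ho := isLittleO_taylor_three h0 h1 h2 e0 e1 e2
  -- `χ = φ / t ^ 2` extends differentiably over 0, with value `a / 2` and derivative `b / 6`. The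
  -- function `χ ^ (m + 1) * ψ` is even, so its derivative at 0 vanishes; after division by `(a / 2)
  -- ^ m` this is the claim.
  let χ : ℝ → ℂ := fun t => if t = 0 then a / 2 else φ t / t ^ 2
  have hχ0 : χ 0 = a / 2 := if_pos rfl
  have hχ : HasDerivAt χ (b / 6) 0 := by
    rw [hasDerivAt_iff_isLittleO]
    rw [Asymptotics.isLittleO_iff] at ho ⊢
    intro C hC
    filter_upwards [ho hC] with t ht
    rcases eq_or_ne t 0 with rfl | h
    · simp
    · have htc : (t : ℂ) ≠ 0 := by exact_mod_cast h
      have : χ t = φ t / t ^ 2 := if_neg h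
      rw [this, hχ0]
      have e : φ t / t ^ 2 - a / 2 - (t - 0) • (b / 6)
          = (φ t - (a / 2 * t ^ 2 + b / 6 * t ^ 3)) / t ^ 2 := by
        rw [sub_zero, Complex.real_smul]; field_simp; ring
      rw [e, norm_div, div_le_iff₀ (norm_pos_iff.2 (pow_ne_zero 2 htc)), sub_zero]
      refine ht.trans (le_of_eq ?_)
      simp only [norm_pow, Real.norm_eq_abs, Complex.norm_real]; ring
  have hev : ∀ t, χ t ^ (m + 1) * ψ t = χ (-t) ^ (m + 1) * ψ (-t) := by
    intro t
    rcases eq_or_ne t 0 with rfl | h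
    · simp
    · have e1 : χ t = φ t / t ^ 2 := if_neg h
      have e2 : χ (-t) = φ (-t) / t ^ 2 := by
        have : χ (-t) = φ (-t) / ((-t : ℝ) : ℂ) ^ 2 := if_neg (neg_ne_zero.2 h)
        rw [this]; push_cast; rw [neg_sq]
      rw [e1, e2, div_pow, div_pow, div_mul_eq_mul_div, div_mul_eq_mul_div, heven]
  have hd := (hχ.pow (m + 1)).mul hψ
  have hd' := HasDerivAt.scomp (0 : ℝ) (by rw [neg_zero]; exact hd) (hasDerivAt_neg (0 : ℝ))
  have hfun : (χ ^ (m + 1) * ψ) ∘ Neg.neg = χ ^ (m + 1) * ψ := by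
    ext t; exact (hev t).symm
  rw [hfun] at hd'
  have h3 := hd.unique hd'
  simp only [Pi.pow_apply, hχ0, Nat.add_sub_cancel, neg_smul, one_smul, pow_succ] at h3
  have hpow : (a / 2) ^ m ≠ 0 := pow_ne_zero _ (div_ne_zero ha two_ne_zero)
  apply mul_left_cancel₀ hpow
  push_cast at h3
  linear_combination 3 * h3

/-- The derivatives of a polynomial along a circle. -/
theorem hasDerivAt_eval_circle (f : MvPolynomial (Fin 2) ℂ) (x n : ℂ) (r : ℝ) :
    let q : ℝ → ℂ := fun θ => x + r * (Complex.exp (θ * Complex.I) * n)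
    let v : ℝ → ℂ := fun θ => r * (Complex.exp (θ * Complex.I) * (Complex.I * n))
    (∀ θ, HasDerivAt (fun θ => eval (toC2 (q θ)) f) (dirEval f (q θ) (v θ)) θ) ∧
    (∀ θ, HasDerivAt (fun θ => dirEval f (q θ) (v θ))
      (dirEval₂ f (q θ) (v θ) (v θ) + dirEval f (q θ) (Complex.I * v θ)) θ) ∧
    ∀ θ, HasDerivAt (fun θ => dirEval₂ f (q θ) (v θ) (v θ) + dirEval f (q θ) (Complex.I * v θ))
      (dirEval₃ f (q θ) (v θ) (v θ) (v θ) + 3 * dirEval₂ f (q θ) (v θ) (Complex.I * v θ)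
        - dirEval f (q θ) (v θ)) θ := by
  intro q v
  have hq : ∀ θ, HasDerivAt q (v θ) θ := hasDerivAt_circle x n r
  have hv : ∀ θ, HasDerivAt v (Complex.I * v θ) θ := fun θ => by
    have := (hasDerivAt_circle 0 (Complex.I * n) r θ)
    simp only [zero_add] at this
    convert! this using 1
    simp only [v]; ring
  refine ⟨fun θ => hasDerivAt_eval f (hq θ), fun θ => hasDerivAt_dirEval f (hq θ) (hv θ), fun θ => ?_⟩
  have h := (hasDerivAt_dirEval₂ f (hq θ) (hv θ) (hv θ)).add
    (hasDerivAt_dirEval f (hq θ) ((hv θ).const_mul Complex.I))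
  convert! h using 1
  have e : Complex.I * (Complex.I * v θ) = ((-1 : ℝ) : ℂ) * v θ := by
    push_cast; linear_combination v θ * Complex.I_sq
  have e3 : dirEval f (q θ) (Complex.I * (Complex.I * v θ)) = -dirEval f (q θ) (v θ) := by
    rw [e, dirEval_smul, Complex.ofReal_neg, Complex.ofReal_one, neg_one_mul]
  rw [e3]
  linear_combination -2 * dirEval₂_comm f (q θ) (Complex.I * v θ) (v θ)

/-- The third order condition at a point `p = x + r J τ` where the curve `f = 0` is tangent to the
circle of radius `|r|` about `x`. -/
theorem IsSymmetricOnCircle.third_order {f g : MvPolynomial (Fin 2) ℂ} {m : ℕ} {r : ℝ} {x τ : ℂ}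
    (h : IsSymmetricOnCircle (f ^ (m + 1) * g) r x (Complex.I * τ))
    (h0 : eval (toC2 (x + r * (Complex.I * τ))) f = 0)
    (h1 : dirEval f (x + r * (Complex.I * τ)) τ = 0)
    (h2 : r ^ 2 * dirEval₂ f (x + r * (Complex.I * τ)) τ τ
      - r * dirEval f (x + r * (Complex.I * τ)) (Complex.I * τ) ≠ 0) :
    (m + 1) * (-r ^ 3 * dirEval₃ f (x + r * (Complex.I * τ)) τ τ τ +
        3 * r ^ 2 * dirEval₂ f (x + r * (Complex.I * τ)) τ (Complex.I * τ)) *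
        eval (toC2 (x + r * (Complex.I * τ))) g
      + 3 * (r ^ 2 * dirEval₂ f (x + r * (Complex.I * τ)) τ τ
        - r * dirEval f (x + r * (Complex.I * τ)) (Complex.I * τ)) *
        (-r * dirEval g (x + r * (Complex.I * τ)) τ) = 0 := by
  obtain ⟨d0, d1, d2⟩ := hasDerivAt_eval_circle f x (Complex.I * τ) r
  have hq0 : x + r * (Complex.exp (((0 : ℝ) : ℂ) * Complex.I) * (Complex.I * τ))
      = x + r * (Complex.I * τ) := by simp
  have hv0 : (r : ℂ) * (Complex.exp (((0 : ℝ) : ℂ) * Complex.I) * (Complex.I * (Complex.I * τ)))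
      = ((-r : ℝ) : ℂ) * τ := by
    simp only [Complex.ofReal_zero, zero_mul, Complex.exp_zero, one_mul]
    push_cast; linear_combination (r : ℂ) * τ * Complex.I_sq
  have hw0 : Complex.I * (((-r : ℝ) : ℂ) * τ) = ((-r : ℝ) : ℂ) * (Complex.I * τ) := by ring
  have d2' := d2 0
  have g1 := hasDerivAt_eval g (hasDerivAt_circle x (Complex.I * τ) r 0)
  simp only [hq0, hv0, hw0] at d2' g1
  have key := third_order_of_even (m := m) (a := r ^ 2 * dirEval₂ f (x + r * (Complex.I * τ)) τ τ
      - r * dirEval f (x + r * (Complex.I * τ)) (Complex.I * τ)) d0 d1 d2' ?_ ?_ ?_ h2 g1 ?_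
  · simp only [hq0] at key
    rw [dirEval₃_smul, dirEval₂_smul, dirEval_smul, dirEval_smul, h1] at key
    push_cast at key
    linear_combination key
  · simp only [hq0, h0]
  · simp only [hq0, hv0, dirEval_smul, h1, mul_zero]
  · simp only [hq0, hv0, hw0, dirEval_smul, dirEval₂_smul]
    push_cast; ring
  · intro θ
    have := h θ
    simp only [map_mul, map_pow] at this
    rw [this]
    push_cast
    simp only [neg_mul]

end

/-! ### The conserved quantity along a parallel curve. -/

section

open MvPolynomial

theorem exists_Ioo_ne_zero {u : ℝ → ℂ} {s₀ s₁ s : ℝ} (hs : s ∈ Set.Ioo s₀ s₁)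
    (hu : ContinuousAt u s) (h0 : u s ≠ 0) :
    ∃ t₀ t₁, t₀ < t₁ ∧ Set.Ioo t₀ t₁ ⊆ Set.Ioo s₀ s₁ ∧ ∀ t ∈ Set.Ioo t₀ t₁, u t ≠ 0 := by
  have h := (hu.eventually_ne h0).and (Ioo_mem_nhds hs.1 hs.2)
  obtain ⟨t₀, t₁, hst, hsub⟩ := mem_nhds_iff_exists_Ioo_subset.1 h
  exact ⟨t₀, t₁, hst.1.trans hst.2, fun t ht => (hsub ht).2, fun t ht => (hsub ht).1⟩

/-- Either a given irreducible factor vanishes along the whole arc, or it has no zero on some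
smaller arc, on which the cofactor must vanish. -/
theorem exists_irreducible_factor {Γ : ℝ → ℂ} {s₀ s₁ : ℝ} (h01 : s₀ < s₁)
    (hΓ : ContinuousOn Γ (Set.Ioo s₀ s₁)) {G : MvPolynomial (Fin 2) ℂ} (hG : G ≠ 0)
    (hGΓ : ∀ s ∈ Set.Ioo s₀ s₁, eval (toC2 (Γ s)) G = 0) :
    ∃ f, Irreducible f ∧ f ∣ G ∧ ∃ t₀ t₁, t₀ < t₁ ∧ Set.Ioo t₀ t₁ ⊆ Set.Ioo s₀ s₁ ∧
      ∀ s ∈ Set.Ioo t₀ t₁, eval (toC2 (Γ s)) f = 0 := by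
  induction G using WfDvdMonoid.induction_on_irreducible generalizing s₀ s₁ with
  | zero => exact absurd rfl hG
  | unit u hu =>
    obtain ⟨s, hs⟩ := Set.nonempty_Ioo.2 h01
    exact absurd (hGΓ s hs) (hu.map (eval (toC2 (Γ s)))).ne_zero
  | mul a i ha hi ih =>
    by_cases h : ∀ s ∈ Set.Ioo s₀ s₁, eval (toC2 (Γ s)) i = 0
    · exact ⟨i, hi, dvd_mul_right _ _, s₀, s₁, h01, subset_rfl, h⟩
    · push Not at h
      obtain ⟨s, hs, hs0⟩ := h
      obtain ⟨t₀, t₁, ht, hsub, hne⟩ := exists_Ioo_ne_zero (u := fun s => eval (toC2 (Γ s)) i) hs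
        ((continuous_eval i).continuousAt.comp (hΓ.continuousAt (Ioo_mem_nhds hs.1 hs.2))) hs0
      obtain ⟨f, hf, hfa, t₀', t₁', ht', hsub', hf0⟩ := ih ht (hΓ.mono hsub) ha fun s hs => by
        have := hGΓ s (hsub hs)
        rw [map_mul] at this
        exact (mul_eq_zero.1 this).resolve_left (hne s hs)
      exact ⟨f, hf, hfa.mul_left i, t₀', t₁', ht', hsub'.trans hsub, hf0⟩

section Local

variable {γ τ : ℝ → ℂ} {k : ℝ → ℝ} {s₀ s₁ r : ℝ}

theorem IsFrenet.continuousOn_parallel (h : IsFrenet γ τ k (Set.Ioo s₀ s₁)) :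
    ContinuousOn (parallel γ τ r) (Set.Ioo s₀ s₁) :=
  fun _ hs => (h.hasDerivAt_parallel r hs).continuousAt.continuousWithinAt

/-- A continuous curve with finitely many values is constant on an interval, but the velocity `(1 -
r k) τ` is not zero. -/
theorem IsFrenet.infinite_parallel (h : IsFrenet γ τ k (Set.Ioo s₀ s₁)) (h01 : s₀ < s₁)
    (hρ : ∀ s ∈ Set.Ioo s₀ s₁, 1 - r * k s ≠ 0) :
    (toC2 '' (parallel γ τ r '' Set.Ioo s₀ s₁)).Infinite := by
  refine Set.Infinite.image toC2_injective.injOn fun hfin => ?_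
  obtain ⟨s, hs⟩ := Set.nonempty_Ioo.2 h01
  have hc : ∀ t ∈ Set.Ioo s₀ s₁, parallel γ τ r t = parallel γ τ r s := fun t ht =>
    eq_of_finite_values (f := parallel γ τ r) isPreconnected_Ioo h.continuousOn_parallel hfin
      (fun t ht => Set.mem_image_of_mem _ ht) ht hs
  have hd : HasDerivAt (parallel γ τ r) 0 s := by
    refine (hasDerivAt_const s (parallel γ τ r s)).congr_of_eventuallyEq ?_
    filter_upwards [Ioo_mem_nhds hs.1 hs.2] with t ht using hc t ht
  have h2 := (h.hasDerivAt_parallel r hs).unique hd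
  rcases mul_eq_zero.1 h2 with h3 | h3
  · exact hρ s hs (by exact_mod_cast h3)
  · have := h.norm_tangent s hs
    rw [h3, norm_zero] at this
    exact zero_ne_one this

/-- The means of transporting identities from a real arc to all complex points of `f = 0`. -/
theorem IsFrenet.dvd_of_eval_parallel (h : IsFrenet γ τ k (Set.Ioo s₀ s₁)) (h01 : s₀ < s₁)
    (hρ : ∀ s ∈ Set.Ioo s₀ s₁, 1 - r * k s ≠ 0) {f P : MvPolynomial (Fin 2) ℂ} (hf : Irreducible f)
    (hf0 : ∀ s ∈ Set.Ioo s₀ s₁, eval (toC2 (parallel γ τ r s)) f = 0)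
    (hP : ∀ s ∈ Set.Ioo s₀ s₁, eval (toC2 (parallel γ τ r s)) P = 0) : f ∣ P := by
  refine dvd_of_infinite hf (h.infinite_parallel h01 hρ) ?_ ?_
  · rintro _ ⟨_, ⟨s, hs, rfl⟩, rfl⟩; exact hf0 s hs
  · rintro _ ⟨_, ⟨s, hs, rfl⟩, rfl⟩; exact hP s hs

/-- The derivative of `f` along the parallel curve vanishes. -/
theorem IsFrenet.dirEval_tangent (h : IsFrenet γ τ k (Set.Ioo s₀ s₁))
    (hρ : ∀ s ∈ Set.Ioo s₀ s₁, 1 - r * k s ≠ 0) {f : MvPolynomial (Fin 2) ℂ}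
    (hf0 : ∀ s ∈ Set.Ioo s₀ s₁, eval (toC2 (parallel γ τ r s)) f = 0) {s : ℝ}
    (hs : s ∈ Set.Ioo s₀ s₁) : dirEval f (parallel γ τ r s) (τ s) = 0 := by
  have h1 := hasDerivAt_eval f (h.hasDerivAt_parallel r hs)
  have h2 : HasDerivAt (fun s => eval (toC2 (parallel γ τ r s)) f) 0 s := by
    refine (hasDerivAt_const s (0 : ℂ)).congr_of_eventuallyEq ?_
    filter_upwards [Ioo_mem_nhds hs.1 hs.2] with t ht using hf0 t ht
  have h3 := h1.unique h2
  rw [dirEval_smul] at h3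
  exact (mul_eq_zero.1 h3).resolve_left (by exact_mod_cast hρ s hs)

/-- The relation `f_τ = 0` is differentiated once more along the parallel curve; it ties the second
tangential derivative of `f` to the normal derivative `λ`. -/
theorem IsFrenet.dirEval₂_tangent (h : IsFrenet γ τ k (Set.Ioo s₀ s₁))
    (hρ : ∀ s ∈ Set.Ioo s₀ s₁, 1 - r * k s ≠ 0) {f : MvPolynomial (Fin 2) ℂ}
    (hf0 : ∀ s ∈ Set.Ioo s₀ s₁, eval (toC2 (parallel γ τ r s)) f = 0) {s : ℝ}
    (hs : s ∈ Set.Ioo s₀ s₁) : ((1 - r * k s : ℝ) : ℂ) * dirEval₂ f (parallel γ τ r s) (τ s) (τ s)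
      + k s * dirEval f (parallel γ τ r s) (Complex.I * τ s) = 0 := by
  have h1 := hasDerivAt_dirEval f (h.hasDerivAt_parallel r hs) (h.hasDerivAt_tangent s hs)
  have h2 : HasDerivAt (fun s => dirEval f (parallel γ τ r s) (τ s)) 0 s := by
    refine (hasDerivAt_const s (0 : ℂ)).congr_of_eventuallyEq ?_
    filter_upwards [Ioo_mem_nhds hs.1 hs.2] with t ht using h.dirEval_tangent hρ hf0 ht
  have h3 := h1.unique h2
  have h4 := dirEval₂_smul f (parallel γ τ r s) (τ s) (τ s) 1 (1 - r * k s)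
  rw [Complex.ofReal_one, one_mul, one_mul] at h4
  rwa [h4, dirEval_smul] at h3

/-- The quantity `λ² φ''(0)`, where `φ` is the restriction of `f` to the Larmor circle. -/
def curvatureDet (f : MvPolynomial (Fin 2) ℂ) (γ τ : ℝ → ℂ) (r s : ℝ) : ℂ :=
  dirEval f (parallel γ τ r s) (Complex.I * τ s) ^ 2 *
    (r ^ 2 * dirEval₂ f (parallel γ τ r s) (τ s) (τ s)
      - r * dirEval f (parallel γ τ r s) (Complex.I * τ s))

/-- The factor `λ ^ 2` is an integrating factor: with it the terms containing `k` cancel by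
`dirEval₂_tangent`, and the derivative is a multiple of the third derivative of `f` along the
tangent circle, which is what the third order condition contains. -/
theorem IsFrenet.hasDerivAt_curvatureDet (h : IsFrenet γ τ k (Set.Ioo s₀ s₁))
    (hρ : ∀ s ∈ Set.Ioo s₀ s₁, 1 - r * k s ≠ 0) {f : MvPolynomial (Fin 2) ℂ}
    (hf0 : ∀ s ∈ Set.Ioo s₀ s₁, eval (toC2 (parallel γ τ r s)) f = 0) {s : ℝ}
    (hs : s ∈ Set.Ioo s₀ s₁) : HasDerivAt (curvatureDet f γ τ r)
      (((1 - r * k s : ℝ) : ℂ) * dirEval f (parallel γ τ r s) (Complex.I * τ s) ^ 2 *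
        (r ^ 2 * dirEval₃ f (parallel γ τ r s) (τ s) (τ s) (τ s)
          - 3 * r * dirEval₂ f (parallel γ τ r s) (τ s) (Complex.I * τ s))) s := by
  have hΓ := h.hasDerivAt_parallel r hs
  have hτ := h.hasDerivAt_tangent s hs
  have d1 := hasDerivAt_dirEval f hΓ (hτ.const_mul Complex.I)
  have d2 := hasDerivAt_dirEval₂ f hΓ hτ hτ
  have hd := (d1.pow 2).mul ((d2.const_mul ((r : ℂ) ^ 2)).sub (d1.const_mul (r : ℂ)))
  refine HasDerivAt.congr_deriv hd ?_
  have e1 : Complex.I * ((k s : ℂ) * (Complex.I * τ s)) = ((-k s : ℝ) : ℂ) * τ s := by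
    push_cast; linear_combination (k s : ℂ) * τ s * Complex.I_sq
  have e2 := dirEval₂_smul f (parallel γ τ r s) (Complex.I * τ s) (τ s) 1 (1 - r * k s)
  have e3 := dirEval₃_smul f (parallel γ τ r s) (τ s) (τ s) (τ s) 1 1 (1 - r * k s)
  have e4 := dirEval₂_smul f (parallel γ τ r s) (τ s) (Complex.I * τ s) 1 (k s)
  have e5 := dirEval₂_smul f (parallel γ τ r s) (Complex.I * τ s) (τ s) (k s) 1
  have e6 := dirEval₂_comm f (parallel γ τ r s) (Complex.I * τ s) (τ s)
  simp only [Complex.ofReal_one, one_mul, mul_one] at e2 e3 e4 e5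
  rw [e1, e2, e3, e4, e5, e6, dirEval_smul, h.dirEval_tangent hρ hf0 hs]
  have hc := h.dirEval₂_tangent hρ hf0 hs
  simp only [Pi.pow_apply, Pi.sub_apply]
  push_cast at hc ⊢
  linear_combination 2 * r ^ 2 * dirEval f (parallel γ τ r s) (Complex.I * τ s) *
    dirEval₂ f (parallel γ τ r s) (τ s) (Complex.I * τ s) * hc

/-- The conserved quantity along the parallel curve. -/
theorem IsFrenet.exists_const (h : IsFrenet γ τ k (Set.Ioo s₀ s₁)) (h01 : s₀ < s₁) (hr : r ≠ 0)
    (hρ : ∀ s ∈ Set.Ioo s₀ s₁, 1 - r * k s ≠ 0) {f g : MvPolynomial (Fin 2) ℂ} {m : ℕ}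
    (hf0 : ∀ s ∈ Set.Ioo s₀ s₁, eval (toC2 (parallel γ τ r s)) f = 0)
    (hg0 : ∀ s ∈ Set.Ioo s₀ s₁, eval (toC2 (parallel γ τ r s)) g ≠ 0)
    (hl0 : ∀ s ∈ Set.Ioo s₀ s₁, dirEval f (parallel γ τ r s) (Complex.I * τ s) ≠ 0)
    (hsym : ∀ s ∈ Set.Ioo s₀ s₁, IsSymmetricOnCircle (f ^ (m + 1) * g) r (γ s) (Complex.I * τ s)) :
    ∃ C : ℂ, C ≠ 0 ∧ ∀ s ∈ Set.Ioo s₀ s₁,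
      eval (toC2 (parallel γ τ r s)) g ^ 3 * curvatureDet f γ τ r s ^ (m + 1) = C := by
  have hrc : (r : ℂ) ≠ 0 := by exact_mod_cast hr
  -- By `dirEval₂_tangent`, `(1 - r k) φ'' = -r λ`, which is not zero.
  have hφ : ∀ s ∈ Set.Ioo s₀ s₁, (r ^ 2 * dirEval₂ f (parallel γ τ r s) (τ s) (τ s)
      - r * dirEval f (parallel γ τ r s) (Complex.I * τ s)) ≠ 0 := by
    intro s hs h0
    have hc := h.dirEval₂_tangent hρ hf0 hs
    have hρc : ((1 - r * k s : ℝ) : ℂ) ≠ 0 := by exact_mod_cast hρ s hs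
    apply mul_ne_zero hrc (hl0 s hs)
    push_cast at hc
    linear_combination (r : ℂ) ^ 2 * hc - (1 - r * k s : ℂ) * h0
  -- The logarithmic derivative is the third order condition up to nonzero factors; that condition
  -- carries one more factor `r`, hence the cancellation of `r`.
  have hd : ∀ s ∈ Set.Ioo s₀ s₁, HasDerivAt (fun s =>
      eval (toC2 (parallel γ τ r s)) g ^ 3 * curvatureDet f γ τ r s ^ (m + 1)) 0 s := by
    intro s hs
    have d1 := hasDerivAt_eval g (h.hasDerivAt_parallel r hs)
    have d2 := h.hasDerivAt_curvatureDet hρ hf0 hs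
    refine HasDerivAt.congr_deriv ((d1.pow 3).mul (d2.pow (m + 1))) ?_
    have ht := (hsym s hs).third_order (hf0 s hs) (h.dirEval_tangent hρ hf0 hs) (hφ s hs)
    apply mul_left_cancel₀ hrc
    rw [dirEval_smul]
    simp only [parallel, curvatureDet, Pi.pow_apply, Nat.add_sub_cancel] at ht ⊢
    push_cast at ht ⊢
    rw [pow_succ _ m]
    linear_combination (-(1 - r * k s : ℂ)
      * eval (toC2 (γ s + r * (Complex.I * τ s))) g ^ 2
      * dirEval f (γ s + r * (Complex.I * τ s)) (Complex.I * τ s) ^ 2 *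
      (dirEval f (γ s + r * (Complex.I * τ s)) (Complex.I * τ s) ^ 2 *
        (r ^ 2 * dirEval₂ f (γ s + r * (Complex.I * τ s)) (τ s) (τ s)
          - r * dirEval f (γ s + r * (Complex.I * τ s)) (Complex.I * τ s))) ^ m) * ht
  obtain ⟨s, hs⟩ := Set.nonempty_Ioo.2 h01
  refine ⟨_, mul_ne_zero (pow_ne_zero 3 (hg0 s hs)) (pow_ne_zero (m + 1)
    (mul_ne_zero (pow_ne_zero 2 (hl0 s hs)) (hφ s hs))), fun t ht => ?_⟩
  exact isOpen_Ioo.is_const_of_deriv_eq_zero isPreconnected_Ioo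
    (fun s hs => (hd s hs).differentiableAt.differentiableWithinAt) (fun s hs => (hd s hs).deriv) ht hs

end Local

end

/-! ### From the arc to the complex curve: smoothness and the component of the parallel curve. -/

section

open MvPolynomial

section Local

variable {γ τ : ℝ → ℂ} {k : ℝ → ℝ} {s₀ s₁ r : ℝ}

theorem sq_re_add_sq_im {z : ℂ} (hz : ‖z‖ = 1) : (z.re : ℂ) ^ 2 + (z.im : ℂ) ^ 2 = 1 := by
  have := Complex.sq_norm z
  rw [hz, Complex.normSq_apply] at this
  exact_mod_cast (by linarith : z.re ^ 2 + z.im ^ 2 = 1)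

theorem eval_pderiv_of_dirEval {f : MvPolynomial (Fin 2) ℂ} {z v : ℂ} (hv : ‖v‖ = 1)
    (h : dirEval f z v = 0) :
    eval (toC2 z) (pderiv 0 f) = -dirEval f z (Complex.I * v) * v.im ∧
    eval (toC2 z) (pderiv 1 f) = dirEval f z (Complex.I * v) * v.re := by
  have h1 := sq_re_add_sq_im hv
  simp only [dirEval, Complex.mul_re, Complex.mul_im, Complex.I_re, Complex.I_im] at h ⊢
  push_cast
  constructor
  · linear_combination (v.re : ℂ) * h - eval (toC2 z) (pderiv 0 f) * h1
  · linear_combination (v.im : ℂ) * h - eval (toC2 z) (pderiv 1 f) * h1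

/-- The squared length of the gradient. -/
def gradSq (f : MvPolynomial (Fin 2) ℂ) : MvPolynomial (Fin 2) ℂ :=
  pderiv 0 f ^ 2 + pderiv 1 f ^ 2

/-- The second derivative of `f` in the direction of the rotated gradient. -/
def hessTangent (f : MvPolynomial (Fin 2) ℂ) : MvPolynomial (Fin 2) ℂ :=
  pderiv 0 (pderiv 0 f) * pderiv 1 f ^ 2 - 2 * pderiv 0 (pderiv 1 f) * pderiv 0 f * pderiv 1 f
    + pderiv 1 (pderiv 1 f) * pderiv 0 f ^ 2

theorem dirEval_sq {f : MvPolynomial (Fin 2) ℂ} {z v : ℂ} (hv : ‖v‖ = 1)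
    (h : dirEval f z v = 0) : dirEval f z (Complex.I * v) ^ 2 = eval (toC2 z) (gradSq f) := by
  obtain ⟨h1, h2⟩ := eval_pderiv_of_dirEval hv h
  rw [gradSq, map_add, map_pow, map_pow, h1, h2]
  linear_combination -dirEval f z (Complex.I * v) ^ 2 * sq_re_add_sq_im hv

/-- The gradient of `f` is `λ J v`, so `λ v` is the gradient rotated by a right angle. The unit
tangent is thereby eliminated and only polynomials in the point remain. -/
theorem dirEval_sq_mul_dirEval₂ {f : MvPolynomial (Fin 2) ℂ} {z v : ℂ} (hv : ‖v‖ = 1)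
    (h : dirEval f z v = 0) :
    dirEval f z (Complex.I * v) ^ 2 * dirEval₂ f z v v = eval (toC2 z) (hessTangent f) := by
  obtain ⟨h1, h2⟩ := eval_pderiv_of_dirEval hv h
  simp only [hessTangent, map_add, map_sub, map_mul, map_pow, h1, h2, map_ofNat]
  generalize dirEval f z (Complex.I * v) = l
  simp only [dirEval₂, dirEval, pderiv_one_zero]
  ring

/-- The conservation law as an identity on the whole complex curve. -/
theorem IsFrenet.exists_identity (h : IsFrenet γ τ k (Set.Ioo s₀ s₁)) (h01 : s₀ < s₁) (hr : r ≠ 0)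
    (hρ : ∀ s ∈ Set.Ioo s₀ s₁, 1 - r * k s ≠ 0) {f g : MvPolynomial (Fin 2) ℂ} {m : ℕ}
    (hf : Irreducible f)
    (hf0 : ∀ s ∈ Set.Ioo s₀ s₁, eval (toC2 (parallel γ τ r s)) f = 0)
    (hg0 : ∀ s ∈ Set.Ioo s₀ s₁, eval (toC2 (parallel γ τ r s)) g ≠ 0)
    (hl0 : ∀ s ∈ Set.Ioo s₀ s₁, dirEval f (parallel γ τ r s) (Complex.I * τ s) ≠ 0)
    (hsym : ∀ s ∈ Set.Ioo s₀ s₁, IsSymmetricOnCircle (f ^ (m + 1) * g) r (γ s) (Complex.I * τ s)) :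
    (∀ p, eval p f = 0 → eval p g ≠ 0) ∧ IsSmoothAffineCurve f := by
  obtain ⟨C', hC', hconst⟩ := h.exists_const h01 hr hρ hf0 hg0 hl0 hsym
  have hrc : (r : ℂ) ≠ 0 := by exact_mod_cast hr
  -- Here `curvatureDet = -r * (-r * hessTangent + gradSq * λ)` with `λ ^ 2 = gradSq`.
  obtain ⟨A, B, hAB⟩ := exists_pow_eq_add_mul (-(C (r : ℂ)) * hessTangent f) (gradSq f) m
  -- The conservation law is linear in `λ`; isolating `λ` and squaring turns it into a polynomial
  -- identity on the arc, hence a multiple of `f`.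
  have hdvd : f ∣ (C C' - C ((-r : ℂ) ^ (m + 1)) * g ^ 3 * A) ^ 2
      - gradSq f * (C ((-r : ℂ) ^ (m + 1)) * g ^ 3 * B) ^ 2 := by
    refine h.dvd_of_eval_parallel h01 hρ hf hf0 fun s hs => ?_
    have ht := h.dirEval_tangent hρ hf0 hs
    have hw := dirEval_sq (h.norm_tangent s hs) ht
    have hH := dirEval_sq_mul_dirEval₂ (h.norm_tangent s hs) ht
    have e := (hAB ℂ (eval (toC2 (parallel γ τ r s))) _ hw).1
    have hc := hconst s hs
    have hM : curvatureDet f γ τ r s = -r * (eval (toC2 (parallel γ τ r s))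
        (-(C (r : ℂ)) * hessTangent f) + eval (toC2 (parallel γ τ r s)) (gradSq f)
        * dirEval f (parallel γ τ r s) (Complex.I * τ s)) := by
      rw [curvatureDet, ← hw, map_mul, map_neg, eval_C, ← hH]; ring
    rw [hM, mul_pow, e] at hc
    simp only [map_sub, map_mul, map_pow, eval_C, ← hw]
    rw [← hc]; ring
  have hp : ∀ p, eval p f = 0 → (C' - (-r : ℂ) ^ (m + 1) * eval p g ^ 3 * eval p A) ^ 2
      - eval p (gradSq f) * ((-r : ℂ) ^ (m + 1) * eval p g ^ 3 * eval p B) ^ 2 = 0 := by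
    intro p hp
    obtain ⟨q, hq⟩ := hdvd
    have := congrArg (eval p) hq
    rw [map_mul, hp, zero_mul] at this
    simpa only [map_sub, map_mul, map_pow, eval_C] using this
  -- At a zero of `g`, and at a singular point, where `gradSq`, `hessTangent` and so `A` vanish, the
  -- identity reduces to `C' ^ 2 = 0`.
  refine ⟨fun p hpf hpg => ?_, fun p hpf => ?_⟩
  · have := hp p hpf
    rw [hpg] at this
    simp [hC'] at this
  · by_contra! hcon
    have hw0 : eval p (gradSq f) = 0 := by simp [gradSq, hcon]
    have hh0 : eval p (-(C (r : ℂ)) * hessTangent f) = 0 := by simp [hessTangent, hcon]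
    have hA0 := (hAB ℂ (eval p) 0 (by rw [hw0]; simp)).2 hw0 hh0
    have := hp p hpf
    rw [hw0, hA0] at this
    simp [hC'] at this

/-- The component of `{G = 0}` that contains a parallel curve. -/
theorem IsFrenet.exists_component (h : IsFrenet γ τ k (Set.Ioo s₀ s₁)) (h01 : s₀ < s₁) (hr : r ≠ 0)
    (hρ : ∀ s ∈ Set.Ioo s₀ s₁, 1 - r * k s ≠ 0) {G : MvPolynomial (Fin 2) ℂ} (hG : G ≠ 0)
    (hG0 : ∀ s ∈ Set.Ioo s₀ s₁, eval (toC2 (parallel γ τ r s)) G = 0)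
    (hsym : ∀ s ∈ Set.Ioo s₀ s₁, IsSymmetricOnCircle G r (γ s) (Complex.I * τ s)) :
    ∃ (f : MvPolynomial (Fin 2) ℝ) (m : ℕ) (g : MvPolynomial (Fin 2) ℂ),
      Irreducible (complexify f) ∧ G = complexify f ^ (m + 1) * g ∧
      (∀ p, eval p (complexify f) = 0 → eval p g ≠ 0) ∧ IsSmoothAffineCurve (complexify f) ∧
      ∃ t₀ t₁, t₀ < t₁ ∧ Set.Ioo t₀ t₁ ⊆ Set.Ioo s₀ s₁ ∧
        ∀ s ∈ Set.Ioo t₀ t₁, eval (toC2 (parallel γ τ r s)) (complexify f) = 0 := by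
  obtain ⟨f', hf', hf'G, t₀, t₁, ht, htsub, hf'0⟩ :=
    exists_irreducible_factor h01 h.continuousOn_parallel hG hG0
  have hft := h.mono htsub
  have hρt : ∀ s ∈ Set.Ioo t₀ t₁, 1 - r * k s ≠ 0 := fun s hs => hρ s (htsub hs)
  obtain ⟨f, hassoc⟩ := exists_real_multiple hf' (hft.infinite_parallel ht hρt).of_image
    (by rintro _ ⟨s, hs, rfl⟩; exact hf'0 s hs)
  have hf : Irreducible (complexify f) := hassoc.irreducible hf'
  have hf0 : ∀ s ∈ Set.Ioo t₀ t₁, eval (toC2 (parallel γ τ r s)) (complexify f) = 0 := by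
    intro s hs
    obtain ⟨q, hq⟩ := hassoc.dvd
    rw [hq, map_mul, hf'0 s hs, zero_mul]
  have hfG : complexify f ∣ G := hassoc.dvd_iff_dvd_left.1 hf'G
  obtain ⟨g, hGg, hfg⟩ := (FiniteMultiplicity.of_prime_left hf.prime hG).exists_eq_pow_mul_and_not_dvd
  obtain ⟨m, hm⟩ : ∃ m, multiplicity (complexify f) G = m + 1 := by
    refine Nat.exists_eq_succ_of_ne_zero fun h0 => hfg ?_
    rw [h0, pow_zero, one_mul] at hGg
    exact hGg ▸ hfG
  rw [hm] at hGg
  -- `f` divides neither `g` nor this partial derivative, so both are nonzero on a still smaller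
  -- arc; there `λ ≠ 0`, since the gradient is `λ J τ`.
  obtain ⟨j, hj⟩ := exists_pderiv_not_dvd hf
  have hnd : ¬ complexify f ∣ g * pderiv j (complexify f) := fun hd =>
    (hf.prime.dvd_or_dvd hd).elim hfg hj
  obtain ⟨s, hs, hs0⟩ : ∃ s ∈ Set.Ioo t₀ t₁,
      eval (toC2 (parallel γ τ r s)) (g * pderiv j (complexify f)) ≠ 0 := by
    by_contra! hcon
    exact hnd (hft.dvd_of_eval_parallel ht hρt hf hf0 hcon)
  obtain ⟨u₀, u₁, hu, husub, hu0⟩ := exists_Ioo_ne_zero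
    (u := fun s => eval (toC2 (parallel γ τ r s)) (g * pderiv j (complexify f))) hs
    ((continuous_eval _).continuousAt.comp (hft.hasDerivAt_parallel r hs).continuousAt) hs0
  have hfu := hft.mono husub
  have hρu : ∀ s ∈ Set.Ioo u₀ u₁, 1 - r * k s ≠ 0 := fun s hs => hρt s (husub hs)
  have hfu0 := fun s hs => hf0 s (husub hs)
  have hid := hfu.exists_identity hu hr hρu (m := m) (g := g) hf hfu0
    (fun s hs h0 => hu0 s hs (by simp only [map_mul, h0, zero_mul]))
    (fun s hs h0 => by
      obtain ⟨e0, e1⟩ := eval_pderiv_of_dirEval (hfu.norm_tangent s hs)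
        (hfu.dirEval_tangent hρu hfu0 hs)
      rw [h0] at e0 e1
      refine hu0 s hs ?_
      rw [map_mul]
      fin_cases j
      · simp [e0]
      · simp [e1])
    (fun s hs => by rw [← hGg]; exact hsym s (htsub (husub hs)))
  exact ⟨f, m, g, hf, hGg, hid.1, hid.2, t₀, t₁, ht, htsub, hf0⟩

/-- If `G = f ^ (m + 1) * g` vanishes along a curve, and `f`, `g` have no common zeros, then `f`
vanishes along the whole curve as soon as it vanishes at one point. -/
theorem eval_eq_zero_of_isPreconnected {f g : MvPolynomial (Fin 2) ℂ} {m : ℕ}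
    (hfg : ∀ p, eval p f = 0 → eval p g ≠ 0) {Γ : ℝ → ℂ} {I : Set ℝ} (hI : IsPreconnected I)
    (hΓ : ContinuousOn Γ I) (hG : ∀ s ∈ I, eval (toC2 (Γ s)) (f ^ (m + 1) * g) = 0) {s : ℝ}
    (hs : s ∈ I) (hs0 : eval (toC2 (Γ s)) f = 0) {t : ℝ} (ht : t ∈ I) :
    eval (toC2 (Γ t)) f = 0 := by
  by_contra h0
  have hcl : ∀ P : MvPolynomial (Fin 2) ℂ, IsClosed {z : ℂ | eval (toC2 z) P = 0} := fun P =>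
    isClosed_eq (continuous_eval P) continuous_const
  have hor : ∀ u ∈ I, eval (toC2 (Γ u)) f = 0 ∨ eval (toC2 (Γ u)) g = 0 := fun u hu => by
    have := hG u hu
    rw [map_mul, map_pow] at this
    exact (mul_eq_zero.1 this).imp_left (fun h => pow_eq_zero_iff (Nat.succ_ne_zero m) |>.1 h)
  obtain ⟨z, -, hz1, hz2⟩ := isPreconnected_closed_iff.1 (hI.image Γ hΓ) _ _ (hcl f) (hcl g)
    (by rintro _ ⟨u, hu, rfl⟩; exact hor u hu) ⟨Γ s, ⟨s, hs, rfl⟩, hs0⟩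
    ⟨Γ t, ⟨t, ht, rfl⟩, (hor t ht).resolve_left h0⟩
  exact hfg _ hz1 hz2

end Local

end

/-! ### Restriction to lines, roots near a point, homogenization. -/

section

open MvPolynomial Filter Topology

/-- The restriction of a polynomial to a line. -/
theorem exists_polynomial_line {σ : Type} [Fintype σ] (F : MvPolynomial σ ℂ) (x v : σ → ℂ) :
    ∃ q : Polynomial ℂ, q.natDegree ≤ F.totalDegree ∧
      (∀ t, q.eval t = eval (fun i => x i + t * v i) F) ∧
      ∀ t, q.derivative.eval t = ∑ i, v i * eval (fun i => x i + t * v i) (pderiv i F) := by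
  let l : σ → Polynomial ℂ := fun i => Polynomial.C (x i) + Polynomial.C (v i) * Polynomial.X
  have hl : ∀ i t, (l i).eval t = x i + t * v i := fun i t => by
    simp only [l, Polynomial.eval_add, Polynomial.eval_mul, Polynomial.eval_C, Polynomial.eval_X]
    ring
  have hl' : ∀ i t, (Polynomial.derivative (l i)).eval t = v i := fun i t => by
    simp only [l, Polynomial.derivative_add, Polynomial.derivative_C, Polynomial.derivative_mul,
      Polynomial.derivative_X, zero_mul, zero_add, mul_one, Polynomial.eval_C]
  have h0 : ∀ (p : MvPolynomial σ ℂ) (t : ℂ),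
      (aeval l p).eval t = eval (fun i => x i + t * v i) p := by
    intro p t
    induction p using MvPolynomial.induction_on with
    | C a => simp
    | add p q hp hq => simp only [map_add, Polynomial.eval_add, hp, hq]
    | mul_X p i hp => simp only [map_mul, Polynomial.eval_mul, hp, aeval_X, eval_X, hl]
  refine ⟨aeval l F, ?_, h0 F, fun t => ?_⟩
  · have := aeval_natDegree_le F (n := 1) (m := F.totalDegree) le_rfl l fun i => by
        simp only [l]; rw [add_comm]; exact Polynomial.natDegree_linear_le
    simpa using this
  · induction F using MvPolynomial.induction_on with
    | C a => simp
    | add p q hp hq =>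
      simp only [map_add, Polynomial.eval_add, hp, hq, mul_add, Finset.sum_add_distrib]
    | mul_X p i hp =>
      classical
      have hterm : ∀ j, v j * eval (fun i => x i + t * v i) (pderiv j (p * X i))
          = (v j * eval (fun i => x i + t * v i) (pderiv j p)) * (x i + t * v i)
            + if j = i then v i * eval (fun i => x i + t * v i) p else 0 := by
        intro j
        rw [Derivation.leibniz, pderiv_X]
        split_ifs with hji
        · subst hji
          simp only [Pi.single_eq_same, smul_eq_mul, map_add, map_mul, map_one, eval_X]; ring
        · rw [Pi.single_eq_of_ne (Ne.symm hji)]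
          simp only [smul_eq_mul, map_add, map_mul, map_zero, eval_X]; ring
      simp only [hterm, Finset.sum_add_distrib, Finset.sum_ite_eq', Finset.mem_univ, if_true,
        ← Finset.sum_mul, ← hp]
      simp only [map_mul, Polynomial.derivative_mul, Polynomial.eval_add, Polynomial.eval_mul, h0,
        aeval_X, hl, hl']
      ring

theorem tendsto_eval {σ : Type} (F : MvPolynomial σ ℂ) {p : ℕ → σ → ℂ} {P : σ → ℂ}
    (h : ∀ i, Tendsto (fun N => p N i) atTop (𝓝 (P i))) :
    Tendsto (fun N => eval (p N) F) atTop (𝓝 (eval P F)) := by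
  have hc : Continuous fun x : σ → ℂ => eval x F := MvPolynomial.continuous_eval F
  exact (hc.tendsto P).comp (tendsto_pi_nhds.2 h)

/-- A polynomial of degree at most `n` has a root at distance at most `n |h(y) / h'(y)|` from `y`. -/
theorem exists_root_near {h : Polynomial ℂ} {n : ℕ} (hn : h.natDegree ≤ n) {y : ℂ}
    (hy : h.derivative.eval y ≠ 0) :
    ∃ z, h.eval z = 0 ∧ ‖z - y‖ ≤ n * ‖h.eval y / h.derivative.eval y‖ := by
  by_cases h0 : h.eval y = 0
  · exact ⟨y, h0, by simp [h0]⟩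
  by_contra! hcon
  -- `h' / h` at `y` is the sum of `1 / (y - z)` over at most `n` roots; were all roots too far from
  -- `y`, this sum would be too small.
  have hsum := (IsAlgClosed.splits h).eval_derivative_div_eval_of_ne_zero h0
  have hne : h ≠ 0 := fun e => h0 (by rw [e, Polynomial.eval_zero])
  have hq : 0 < ‖h.derivative.eval y / h.eval y‖ := norm_pos_iff.2 (div_ne_zero hy h0)
  have hroots : h.roots ≠ 0 := by
    intro e
    rw [e] at hsum
    simp only [Multiset.map_zero, Multiset.sum_zero] at hsum
    rw [hsum, norm_zero] at hq
    exact lt_irrefl _ hq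
  have hcard : 0 < Multiset.card h.roots := Multiset.card_pos.2 hroots
  have hcn : Multiset.card h.roots ≤ n := (Polynomial.card_roots' h).trans hn
  have hnpos : (0 : ℝ) < n := by exact_mod_cast hcard.trans_le hcn
  have hlt : ∀ z ∈ h.roots, ‖1 / (y - z)‖ < ‖h.derivative.eval y / h.eval y‖ / n := by
    intro z hz
    have hz0 : h.eval z = 0 := (Polynomial.mem_roots hne).1 hz
    have hzy := hcon z hz0
    rw [norm_div, norm_div, norm_one] at *
    rw [norm_sub_rev]
    have hA : 0 < ‖h.eval y‖ := norm_pos_iff.2 h0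
    have hB : 0 < ‖h.derivative.eval y‖ := norm_pos_iff.2 hy
    have hz' : 0 < ‖z - y‖ := lt_of_le_of_lt (by positivity) hzy
    rw [← mul_div_assoc, div_lt_iff₀ hB] at hzy
    rw [div_div, div_lt_div_iff₀ hz' (by positivity)]
    nlinarith
  have h1 : ‖h.derivative.eval y / h.eval y‖ ≤ (h.roots.map fun z => ‖1 / (y - z)‖).sum := by
    rw [hsum]
    refine (norm_multiset_sum_le _).trans ?_
    rw [Multiset.map_map]
    rfl
  have h2 : (h.roots.map fun z => ‖1 / (y - z)‖).sum
      < (h.roots.map fun _ => ‖h.derivative.eval y / h.eval y‖ / n).sum :=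
    Multiset.sum_lt_sum_of_nonempty hroots hlt
  rw [Multiset.map_const', Multiset.sum_replicate, nsmul_eq_mul] at h2
  have h3 : (Multiset.card h.roots : ℝ) * (‖h.derivative.eval y / h.eval y‖ / n)
      ≤ ‖h.derivative.eval y / h.eval y‖ := by
    rw [← mul_div_assoc, div_le_iff₀ hnpos, mul_comm]
    exact mul_le_mul_of_nonneg_left (by exact_mod_cast hcn) hq.le
  linarith

theorem homogenization_isHomogeneous (f : MvPolynomial (Fin 2) ℂ) :
    (homogenization f).IsHomogeneous f.totalDegree := by
  refine IsHomogeneous.sum _ _ _ fun m hm => ?_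
  have hle : m 0 + m 1 ≤ f.totalDegree := by
    have := le_totalDegree hm
    rwa [Finsupp.sum_fintype _ _ (fun _ => rfl), Fin.sum_univ_two] at this
  have := ((((isHomogeneous_C (Fin 3) (f.coeff m)).mul ((isHomogeneous_X ℂ (0 : Fin 3)).pow (m 0))).mul
    ((isHomogeneous_X ℂ (1 : Fin 3)).pow (m 1))).mul
    ((isHomogeneous_X ℂ (2 : Fin 3)).pow (f.totalDegree - (m 0 + m 1))))
  convert this using 1
  omega

theorem eval_homogenization (f : MvPolynomial (Fin 2) ℂ) (x y : ℂ) :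
    eval ![x, y, 1] (homogenization f) = eval ![x, y] f := by
  rw [homogenization, map_sum, eval_eq']
  refine Finset.sum_congr rfl fun m _ => ?_
  simp [Fin.prod_univ_two, mul_assoc]

theorem eval_smul_of_isHomogeneous {σ : Type} {F : MvPolynomial σ ℂ} {n : ℕ} (hF : F.IsHomogeneous n)
    (t : ℂ) (p : σ → ℂ) : eval (fun i => t * p i) F = t ^ n * eval p F := by
  rw [eval_eq, eval_eq, Finset.mul_sum]
  refine Finset.sum_congr rfl fun m hm => ?_
  have hd : ∑ i ∈ m.support, m i = n := by
    have := hF (mem_support_iff.1 hm)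
    rwa [show (1 : σ → ℕ) = fun _ => 1 from rfl, ← Finsupp.degree_eq_weight_one,
      Finsupp.degree_apply] at this
  simp only [mul_pow, Finset.prod_mul_distrib, Finset.prod_pow_eq_pow_sum, hd]
  ring

theorem eval_pderiv_homogenization (f : MvPolynomial (Fin 2) ℂ) (x y : ℂ) :
    eval ![x, y, 1] (pderiv 0 (homogenization f)) = eval ![x, y] (pderiv 0 f) ∧
    eval ![x, y, 1] (pderiv 1 (homogenization f)) = eval ![x, y] (pderiv 1 f) := by
  have key : ∀ a b : ℂ, a * eval ![x, y, 1] (pderiv 0 (homogenization f))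
      + b * eval ![x, y, 1] (pderiv 1 (homogenization f))
      = a * eval ![x, y] (pderiv 0 f) + b * eval ![x, y] (pderiv 1 f) := by
    intro a b
    obtain ⟨q, -, hq, hq'⟩ := exists_polynomial_line (homogenization f) ![x, y, 1] ![a, b, 0]
    obtain ⟨q₁, -, hq₁, hq₁'⟩ := exists_polynomial_line f ![x, y] ![a, b]
    have : q = q₁ := Polynomial.funext fun t => by
      rw [hq, hq₁]
      have e1 : (fun i => (![x, y, 1] : Fin 3 → ℂ) i + t * (![a, b, 0] : Fin 3 → ℂ) i)
          = ![x + t * a, y + t * b, 1] := by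
        ext i; fin_cases i <;> simp
      have e2 : (fun i => (![x, y] : Fin 2 → ℂ) i + t * (![a, b] : Fin 2 → ℂ) i)
          = ![x + t * a, y + t * b] := by
        ext i; fin_cases i <;> simp
      rw [e1, e2, eval_homogenization]
    have h := hq' 0
    rw [this, hq₁' 0] at h
    simp only [zero_mul, add_zero, Fin.sum_univ_three, Fin.sum_univ_two] at h
    simpa using h.symm
  exact ⟨by simpa using key 1 0, by simpa using key 0 1⟩

end

/-! ### A branch of the curve with a finite asymptote. -/

section

open MvPolynomial Filter Topology

theorem eval_scale {H : MvPolynomial (Fin 3) ℂ} {e : ℕ} (hH : H.IsHomogeneous e) (a b Y : ℂ) {t : ℂ}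
    (ht : t ≠ 0) : eval ![t * a - Y * b, t * b + Y * a, 1] H
      = t ^ e * eval ![a - Y * b * t⁻¹, b + Y * a * t⁻¹, t⁻¹] H := by
  rw [← eval_smul_of_isHomogeneous hH]
  congr 2
  ext i
  fin_cases i
  · simp; field_simp
  · simp; field_simp
  · simp [ht]

theorem tendsto_natCast_inv : Tendsto (fun N : ℕ => (N : ℂ)⁻¹) atTop (𝓝 0) :=
  tendsto_inv_atTop_nhds_zero_nat

theorem tendsto_eval_scale (H : MvPolynomial (Fin 3) ℂ) (a b : ℂ) {Y : ℕ → ℂ} {y : ℂ}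
    (hY : Tendsto Y atTop (𝓝 y)) :
    Tendsto (fun N : ℕ => eval ![a - Y N * b * (N : ℂ)⁻¹, b + Y N * a * (N : ℂ)⁻¹, (N : ℂ)⁻¹] H) atTop
      (𝓝 (eval ![a, b, 0] H)) := by
  apply tendsto_eval
  intro i
  fin_cases i
  · simpa using ((hY.mul_const b).mul tendsto_natCast_inv).const_sub a
  · simpa using ((hY.mul_const a).mul tendsto_natCast_inv).const_add b
  · simpa using tendsto_natCast_inv

/-- The branch of the curve `f = 0` at a point at infinity at which the tangent is not the line at
infinity. -/
theorem exists_branch_at_infinity {f : MvPolynomial (Fin 2) ℂ} {n : ℕ} (hn : f.totalDegree = n + 1)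
    {a b c : ℂ} (h0 : eval ![a, b, 0] (homogenization f) = 0)
    (hc : c = -b * eval ![a, b, 0] (pderiv 0 (homogenization f))
      + a * eval ![a, b, 0] (pderiv 1 (homogenization f))) (hc0 : c ≠ 0) :
    ∃ (y : ℂ) (Y : ℕ → ℂ), Tendsto Y atTop (𝓝 y) ∧
      (∀ᶠ N : ℕ in atTop, eval ![N * a - Y N * b, N * b + Y N * a] f = 0) ∧
      Tendsto (fun N : ℕ => (-b * eval ![N * a - Y N * b, N * b + Y N * a] (pderiv 0 f)
        + a * eval ![N * a - Y N * b, N * b + Y N * a] (pderiv 1 f)) / (N : ℂ) ^ n) atTop (𝓝 c) ∧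
      Tendsto (fun N : ℕ => N * ((a * eval ![N * a - Y N * b, N * b + Y N * a] (pderiv 0 f)
        + b * eval ![N * a - Y N * b, N * b + Y N * a] (pderiv 1 f)) / (N : ℂ) ^ n)) atTop (𝓝 0) := by
  have hH : (homogenization f).IsHomogeneous (n + 1) := hn ▸ homogenization_isHomogeneous f
  have hHi : ∀ i, (pderiv i (homogenization f)).IsHomogeneous n := fun i => by
    simpa using hH.pderiv (i := i)
  have hN : ∀ᶠ N : ℕ in atTop, (N : ℂ) ≠ 0 := by
    filter_upwards [eventually_gt_atTop 0] with N hN using by exact_mod_cast hN.ne'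
  have hx : ∀ (N : ℕ) (Y : ℂ), (N : ℂ) ≠ 0 → eval ![N * a - Y * b, N * b + Y * a] (pderiv 0 f)
      = (N : ℂ) ^ n * eval ![a - Y * b * (N : ℂ)⁻¹, b + Y * a * (N : ℂ)⁻¹, (N : ℂ)⁻¹]
        (pderiv 0 (homogenization f)) := fun N Y h => by
    rw [← (eval_pderiv_homogenization f _ _).1, eval_scale (hHi 0) a b Y h]
  have hy : ∀ (N : ℕ) (Y : ℂ), (N : ℂ) ≠ 0 → eval ![N * a - Y * b, N * b + Y * a] (pderiv 1 f)
      = (N : ℂ) ^ n * eval ![a - Y * b * (N : ℂ)⁻¹, b + Y * a * (N : ℂ)⁻¹, (N : ℂ)⁻¹]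
        (pderiv 1 (homogenization f)) := fun N Y h => by
    rw [← (eval_pderiv_homogenization f _ _).2, eval_scale (hHi 1) a b Y h]
  have hFY : ∀ {Y : ℕ → ℂ} {y : ℂ}, Tendsto Y atTop (𝓝 y) →
      Tendsto (fun N : ℕ => (-b * eval ![N * a - Y N * b, N * b + Y N * a] (pderiv 0 f)
        + a * eval ![N * a - Y N * b, N * b + Y N * a] (pderiv 1 f)) / (N : ℂ) ^ n) atTop (𝓝 c) := by
    intro Y y hY
    rw [hc]
    refine (((tendsto_eval_scale _ a b hY).const_mul (-b)).add
      ((tendsto_eval_scale _ a b hY).const_mul a)).congr' ?_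
    filter_upwards [hN] with N hN
    rw [hx N _ hN, hy N _ hN]
    field_simp
  let e₂ := eval ![a, b, 0] (pderiv 2 (homogenization f))
  -- In the coordinates `x (a, b) + y (-b, a)` the tangent line at `(a : b : 0)` has the equation `c
  -- y + e₂ = 0`, so this is the height of the asymptote.
  let y : ℂ := -e₂ / c
  -- The branch is built from roots, close to `y`, of `f` restricted to the lines through `N (a, b)`
  -- with direction `(-b, a)`.
  choose h hdeg hh hh' using fun N : ℕ => exists_polynomial_line f ![N * a, N * b] ![-b, a]
  have hvec : ∀ (N : ℕ) (t : ℂ), (fun i => (![N * a, N * b] : Fin 2 → ℂ) i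
      + t * (![-b, a] : Fin 2 → ℂ) i) = ![N * a - t * b, N * b + t * a] := by
    intro N t; ext i; fin_cases i
    · simp; ring
    · simp
  have hder : Tendsto (fun N : ℕ => (h N).derivative.eval y / (N : ℂ) ^ n) atTop (𝓝 c) := by
    refine (hFY (tendsto_const_nhds (x := y))).congr fun N => ?_
    rw [hh', hvec, Fin.sum_univ_two]; rfl
  -- The asymptote is the line `(a, b, 0) + t (-y b, y a, 1)` at `t = 1 / N`. By the choice of `y`
  -- the homogenization vanishes to second order along it at `t = 0`, which gains a factor `1 / N`.
  have hval : Tendsto (fun N : ℕ => (h N).eval y / (N : ℂ) ^ n) atTop (𝓝 0) := by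
    obtain ⟨q, -, hq, hq'⟩ := exists_polynomial_line (homogenization f) ![a, b, 0] ![-(y * b), y * a, 1]
    have hq0 : q.eval 0 = 0 := by
      rw [hq]; simpa using h0
    have hq0' : q.derivative.eval 0 = 0 := by
      rw [hq', Fin.sum_univ_three]
      have hy' : c * y = -e₂ := mul_div_cancel₀ _ hc0
      simp only [zero_mul, add_zero]
      change -(y * b) * eval ![a, b, 0] (pderiv 0 (homogenization f))
        + y * a * eval ![a, b, 0] (pderiv 1 (homogenization f)) + 1 * e₂ = 0
      linear_combination hy' - y * hc
    have hd := (q.hasDerivAt 0).tendsto_slope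
    rw [hq0'] at hd
    have hinv : Tendsto (fun N : ℕ => (N : ℂ)⁻¹) atTop (𝓝[≠] 0) :=
      tendsto_nhdsWithin_iff.2 ⟨tendsto_natCast_inv, by
        filter_upwards [hN] with N hN using inv_ne_zero hN⟩
    refine (hd.comp hinv).congr' ?_
    filter_upwards [hN] with N hN
    rw [Function.comp, slope_def_field, hq0, sub_zero, sub_zero, hq, hh, hvec,
      ← eval_homogenization, eval_scale hH a b y hN, pow_succ]
    have e : (fun i => (![a, b, 0] : Fin 3 → ℂ) i + (N : ℂ)⁻¹ * (![-(y * b), y * a, 1] : Fin 3 → ℂ) i)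
        = ![a - y * b * (N : ℂ)⁻¹, b + y * a * (N : ℂ)⁻¹, (N : ℂ)⁻¹] := by
      ext i; fin_cases i
      · simp; ring
      · simp; ring
      · simp
    rw [e]
    field_simp
  have hder0 : ∀ᶠ N : ℕ in atTop, (h N).derivative.eval y ≠ 0 := by
    filter_upwards [hder.eventually_ne hc0] with N hN h0
    exact hN (by rw [h0, zero_div])
  have hroot : ∀ N : ℕ, ∃ z, (h N).derivative.eval y ≠ 0 → (h N).eval z = 0 ∧
      ‖z - y‖ ≤ ((n + 1 : ℕ) : ℝ) * ‖(h N).eval y / (h N).derivative.eval y‖ := by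
    intro N
    by_cases hd : (h N).derivative.eval y = 0
    · exact ⟨0, fun h => absurd hd h⟩
    · obtain ⟨z, hz⟩ := exists_root_near ((hdeg N).trans hn.le) hd
      exact ⟨z, fun _ => hz⟩
  choose Y hYr using hroot
  have hY : Tendsto Y atTop (𝓝 y) := by
    rw [tendsto_iff_norm_sub_tendsto_zero]
    have hlim : Tendsto (fun N : ℕ => ((n + 1 : ℕ) : ℝ) * ‖(h N).eval y / (h N).derivative.eval y‖)
        atTop (𝓝 0) := by
      have := ((hval.div hder hc0).norm).const_mul ((n + 1 : ℕ) : ℝ)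
      rw [zero_div, norm_zero, mul_zero] at this
      refine this.congr' ?_
      filter_upwards [hN] with N hN
      simp only [Pi.div_apply]
      rw [div_div_div_cancel_right₀ (pow_ne_zero n hN)]
    refine squeeze_zero' (Eventually.of_forall fun N => norm_nonneg _) ?_ hlim
    filter_upwards [hder0] with N hN using (hYr N hN).2
  have hf0 : ∀ᶠ N : ℕ in atTop, eval ![N * a - Y N * b, N * b + Y N * a] f = 0 := by
    filter_upwards [hder0] with N hN
    have := (hYr N hN).1
    rwa [hh, hvec] at this
  refine ⟨y, Y, hY, hf0, hFY hY, ?_⟩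
  -- Euler's relation at a point of the curve gives `N` times the derivative along `(a, b)` as minus
  -- `Y` times the derivative along `(-b, a)`, minus the `z` derivative; after scaling the limit is
  -- `-y c - e₂ = 0`.
  have hlim : Tendsto (fun N : ℕ => -(Y N) * ((-b * eval ![N * a - Y N * b, N * b + Y N * a] (pderiv 0 f)
        + a * eval ![N * a - Y N * b, N * b + Y N * a] (pderiv 1 f)) / (N : ℂ) ^ n)
        - eval ![a - Y N * b * (N : ℂ)⁻¹, b + Y N * a * (N : ℂ)⁻¹, (N : ℂ)⁻¹]
          (pderiv 2 (homogenization f))) atTop (𝓝 0) := by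
    have := (hY.neg.mul (hFY hY)).sub (tendsto_eval_scale (pderiv 2 (homogenization f)) a b hY)
    have e : -y * c - eval ![a, b, 0] (pderiv 2 (homogenization f)) = 0 := by
      have : -y * c = e₂ := by simp only [y]; field_simp
      rw [this, sub_self]
    rwa [e] at this
  refine hlim.congr' ?_
  filter_upwards [hN, hf0] with N hN hf
  have hE := congrArg (eval ![N * a - Y N * b, N * b + Y N * a, 1]) hH.sum_X_mul_pderiv
  rw [Fin.sum_univ_three, map_nsmul, eval_homogenization, hf, smul_zero] at hE
  simp only [map_add, map_mul, eval_X] at hE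
  rw [(eval_pderiv_homogenization f _ _).1, (eval_pderiv_homogenization f _ _).2,
    eval_scale (hHi 2) a b (Y N) hN] at hE
  have hE' : (N * a - Y N * b) * eval ![N * a - Y N * b, N * b + Y N * a] (pderiv 0 f)
    + (N * b + Y N * a) * eval ![N * a - Y N * b, N * b + Y N * a] (pderiv 1 f)
    + 1 * ((N : ℂ) ^ n * eval ![a - Y N * b * (N : ℂ)⁻¹, b + Y N * a * (N : ℂ)⁻¹, (N : ℂ)⁻¹]
      (pderiv 2 (homogenization f))) = 0 := hE
  have hNn := pow_ne_zero n hN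
  generalize eval ![N * a - Y N * b, N * b + Y N * a] (pderiv 0 f) = u₀ at hE' ⊢
  generalize eval ![N * a - Y N * b, N * b + Y N * a] (pderiv 1 f) = u₁ at hE' ⊢
  generalize eval ![a - Y N * b * (N : ℂ)⁻¹, b + Y N * a * (N : ℂ)⁻¹, (N : ℂ)⁻¹]
    (pderiv 2 (homogenization f)) = u₂ at hE' ⊢
  field_simp
  linear_combination -hE'

end

/-! ### Complexification of the symmetry on tangent circles. -/

section

open MvPolynomial

/-- The points of a tangent circle are rational in `p` and `l`, with only powers of `l` as
denominators. -/
theorem exists_clear_denominators (G : MvPolynomial (Fin 2) ℂ) (q : Fin 2 → MvPolynomial (Fin 2) ℂ) :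
    ∃ (N : ℕ) (H : Polynomial (MvPolynomial (Fin 2) ℂ)), ∀ (p : Fin 2 → ℂ) (l : ℂ), l ≠ 0 →
      l ^ N * eval (fun i => p i + eval p (q i) / l) G = H.eval₂ (eval p) l := by
  induction G using MvPolynomial.induction_on with
  | C a => exact ⟨0, Polynomial.C (C a), fun p l _ => by simp⟩
  | add F G hF hG =>
    obtain ⟨N, H, hH⟩ := hF
    obtain ⟨M, K, hK⟩ := hG
    refine ⟨N + M, H * Polynomial.X ^ M + K * Polynomial.X ^ N, fun p l hl => ?_⟩
    rw [Polynomial.eval₂_add, Polynomial.eval₂_mul, Polynomial.eval₂_mul, Polynomial.eval₂_X_pow,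
      Polynomial.eval₂_X_pow, ← hH p l hl, ← hK p l hl, map_add, pow_add]
    ring
  | mul_X F i hF =>
    obtain ⟨N, H, hH⟩ := hF
    refine ⟨N + 1, H * (Polynomial.C (X i) * Polynomial.X + Polynomial.C (q i)), fun p l hl => ?_⟩
    rw [Polynomial.eval₂_mul, ← hH p l hl, Polynomial.eval₂_add, Polynomial.eval₂_mul,
      Polynomial.eval₂_C, Polynomial.eval₂_C, Polynomial.eval₂_X, map_mul, eval_X, eval_X, pow_succ]
    field_simp

/-- Even powers of `l` are polynomials in `p`, so every polynomial expression is linear in `l`. -/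
theorem exists_eval₂_eq_add_mul (H : Polynomial (MvPolynomial (Fin 2) ℂ))
    (w : MvPolynomial (Fin 2) ℂ) : ∃ A B : MvPolynomial (Fin 2) ℂ, ∀ (p : Fin 2 → ℂ) (l : ℂ),
      l ^ 2 = eval p w → H.eval₂ (eval p) l = eval p A + l * eval p B := by
  induction H using Polynomial.induction_on with
  | C a => exact ⟨a, 0, fun p l _ => by simp⟩
  | add P Q hP hQ =>
    obtain ⟨A, B, hAB⟩ := hP
    obtain ⟨A', B', hAB'⟩ := hQ
    refine ⟨A + A', B + B', fun p l hl => ?_⟩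
    rw [Polynomial.eval₂_add, hAB p l hl, hAB' p l hl, map_add, map_add]; ring
  | monomial n a hn =>
    obtain ⟨A, B, hAB⟩ := hn
    refine ⟨w * B, A, fun p l hl => ?_⟩
    rw [pow_succ, ← mul_assoc, Polynomial.eval₂_mul, hAB p l hl, Polynomial.eval₂_X, map_mul, ← hl]
    ring

/-- The point at angle `θ` of the circle of radius `r` which touches the curve `f = 0` at `p`;
here `l` is a square root of `gradSq f`. -/
def larmorPoint (f : MvPolynomial (Fin 2) ℂ) (r θ : ℝ) (p : Fin 2 → ℂ) (l : ℂ) : Fin 2 → ℂ :=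
  ![p 0 + r * ((Real.cos θ - 1) * eval p (pderiv 0 f) - Real.sin θ * eval p (pderiv 1 f)) / l,
    p 1 + r * ((Real.cos θ - 1) * eval p (pderiv 1 f) + Real.sin θ * eval p (pderiv 0 f)) / l]

theorem exists_larmorPoint_poly (f G : MvPolynomial (Fin 2) ℂ) (r θ : ℝ) :
    ∃ (N : ℕ) (H : Polynomial (MvPolynomial (Fin 2) ℂ)), ∀ (p : Fin 2 → ℂ) (l : ℂ), l ≠ 0 →
      l ^ N * eval (larmorPoint f r θ p l) G = H.eval₂ (eval p) l := by
  obtain ⟨N, H, hH⟩ := exists_clear_denominators G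
    ![C (r : ℂ) * (C ((Real.cos θ : ℂ) - 1) * pderiv 0 f - C (Real.sin θ : ℂ) * pderiv 1 f),
      C (r : ℂ) * (C ((Real.cos θ : ℂ) - 1) * pderiv 1 f + C (Real.sin θ : ℂ) * pderiv 0 f)]
  refine ⟨N, H, fun p l hl => ?_⟩
  rw [← hH p l hl]
  congr 3
  ext i
  fin_cases i <;> simp [larmorPoint]

/-- At a real point of tangency the gradient is `l J v`, with `l` the normal derivative; the choice
of the root `l` is the choice of one of the two tangent circles. -/
theorem toC2_circle {f : MvPolynomial (Fin 2) ℂ} {x v : ℂ} {r : ℝ} (hv : ‖v‖ = 1)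
    (h : dirEval f (x + r * (Complex.I * v)) v = 0)
    (hl : dirEval f (x + r * (Complex.I * v)) (Complex.I * v) ≠ 0) (θ : ℝ) :
    toC2 (x + r * (Complex.exp (θ * Complex.I) * (Complex.I * v)))
      = larmorPoint f r θ (toC2 (x + r * (Complex.I * v)))
        (dirEval f (x + r * (Complex.I * v)) (Complex.I * v)) := by
  obtain ⟨e0, e1⟩ := eval_pderiv_of_dirEval hv h
  rw [larmorPoint, e0, e1]
  generalize dirEval f (x + r * (Complex.I * v)) (Complex.I * v) = l at hl
  ext i
  fin_cases i
  · simp [toC2, Complex.exp_ofReal_mul_I_re, Complex.exp_ofReal_mul_I_im]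
    field_simp
    ring
  · simp [toC2, Complex.exp_ofReal_mul_I_re, Complex.exp_ofReal_mul_I_im]
    field_simp
    ring

/-- The symmetry of `G` with respect to the tangent circles extends to the complex curve `f = 0`, up
to the choice of the square root of `gradSq f`. -/
theorem IsFrenet.symmetric_complex {γ τ : ℝ → ℂ} {k : ℝ → ℝ} {s₀ s₁ r : ℝ}
    (h : IsFrenet γ τ k (Set.Ioo s₀ s₁)) (h01 : s₀ < s₁)
    (hρ : ∀ s ∈ Set.Ioo s₀ s₁, 1 - r * k s ≠ 0) {f G : MvPolynomial (Fin 2) ℂ}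
    (hf : Irreducible f) (hsmooth : IsSmoothAffineCurve f)
    (hf0 : ∀ s ∈ Set.Ioo s₀ s₁, eval (toC2 (parallel γ τ r s)) f = 0)
    (hsym : ∀ s ∈ Set.Ioo s₀ s₁, IsSymmetricOnCircle G r (γ s) (Complex.I * τ s)) (θ : ℝ)
    {p : Fin 2 → ℂ} (hp : eval p f = 0) {l : ℂ} (hl : l ^ 2 = eval p (gradSq f)) (hl0 : l ≠ 0) :
    eval (larmorPoint f r θ p l) G = eval (larmorPoint f r (-θ) p l) G ∨
    eval (larmorPoint f r θ p (-l)) G = eval (larmorPoint f r (-θ) p (-l)) G := by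
  obtain ⟨N, H, hH⟩ := exists_larmorPoint_poly f G r θ
  obtain ⟨M, K, hK⟩ := exists_larmorPoint_poly f G r (-θ)
  have hT : ∀ (p : Fin 2 → ℂ) (l : ℂ), l ≠ 0 →
      (H * Polynomial.X ^ M - K * Polynomial.X ^ N).eval₂ (eval p) l
      = l ^ (N + M) * (eval (larmorPoint f r θ p l) G - eval (larmorPoint f r (-θ) p l) G) := by
    intro p l hl
    rw [Polynomial.eval₂_sub, Polynomial.eval₂_mul, Polynomial.eval₂_mul, Polynomial.eval₂_X_pow,
      Polynomial.eval₂_X_pow, ← hH p l hl, ← hK p l hl, pow_add]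
    ring
  -- The defect of symmetry is `A + l B`. It vanishes on the real arc, so its norm `A ^ 2 - gradSq f
  -- * B ^ 2` vanishes on the complex curve. This norm is the product of the defects for `l` and
  -- `-l`, whence the alternative.
  obtain ⟨A, B, hAB⟩ := exists_eval₂_eq_add_mul (H * Polynomial.X ^ M - K * Polynomial.X ^ N) (gradSq f)
  have hdvd : f ∣ A ^ 2 - gradSq f * B ^ 2 := by
    refine h.dvd_of_eval_parallel h01 hρ hf hf0 fun s hs => ?_
    have ht := h.dirEval_tangent hρ hf0 hs
    have hv := h.norm_tangent s hs
    have hw := dirEval_sq hv ht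
    have hl0 : dirEval f (parallel γ τ r s) (Complex.I * τ s) ≠ 0 := by
      intro h0
      obtain ⟨e0, e1⟩ := eval_pderiv_of_dirEval hv ht
      rw [h0] at e0 e1
      obtain ⟨j, hj⟩ := hsmooth _ (hf0 s hs)
      fin_cases j
      · exact hj (by simpa using e0)
      · exact hj (by simpa using e1)
    have e := hAB _ _ hw
    have hs1 := toC2_circle hv ht hl0 θ
    have hs2 := toC2_circle hv ht hl0 (-θ)
    have hsy := hsym s hs θ
    rw [hT _ _ hl0] at e
    rw [hs1, ← neg_mul, ← Complex.ofReal_neg, hs2] at hsy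
    simp only [parallel] at e hsy hw ⊢
    rw [hsy, sub_self, mul_zero] at e
    simp only [map_sub, map_mul, map_pow, ← hw]
    linear_combination -(eval (toC2 (γ s + r * (Complex.I * τ s))) A
      - dirEval f (γ s + r * (Complex.I * τ s)) (Complex.I * τ s)
        * eval (toC2 (γ s + r * (Complex.I * τ s))) B) * e
  have h1 := hAB p l hl
  have h2 := hAB p (-l) (by rw [neg_sq, hl])
  rw [hT p l hl0] at h1
  rw [hT p (-l) (neg_ne_zero.2 hl0)] at h2
  have h3 : eval p A ^ 2 - l ^ 2 * eval p B ^ 2 = 0 := by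
    obtain ⟨q, hq⟩ := hdvd
    have := congrArg (eval p) hq
    rw [map_mul, hp, zero_mul] at this
    simpa only [map_sub, map_mul, map_pow, ← hl] using this
  have h4 : (eval p A + l * eval p B) * (eval p A + -l * eval p B) = 0 := by
    linear_combination h3
  rw [← h1, ← h2] at h4
  have hp1 : l ^ (N + M) ≠ 0 := pow_ne_zero _ hl0
  have hp2 : (-l) ^ (N + M) ≠ 0 := pow_ne_zero _ (neg_ne_zero.2 hl0)
  rcases mul_eq_zero.1 h4 with h5 | h5
  · exact Or.inl (sub_eq_zero.1 ((mul_eq_zero.1 h5).resolve_left hp1))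
  · exact Or.inr (sub_eq_zero.1 ((mul_eq_zero.1 h5).resolve_left hp2))

end

/-! ### Growth of a polynomial along a direction. -/

section

open MvPolynomial Filter Topology

/-- The polynomial `G (x (a, b) + y (-b, a))` as a polynomial in `x` over the polynomials in `y`. -/
def rotated (a b : ℂ) (G : MvPolynomial (Fin 2) ℂ) : Polynomial (Polynomial ℂ) :=
  aeval ![Polynomial.X * Polynomial.C (Polynomial.C a) - Polynomial.C (Polynomial.X * Polynomial.C b),
    Polynomial.X * Polynomial.C (Polynomial.C b) + Polynomial.C (Polynomial.X * Polynomial.C a)] G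

theorem evalEval_rotated (a b : ℂ) (G : MvPolynomial (Fin 2) ℂ) (x y : ℂ) :
    (rotated a b G).evalEval y x = eval ![x * a - y * b, x * b + y * a] G := by
  rw [rotated]
  induction G using MvPolynomial.induction_on with
  | C c =>
    rw [algHom_C, eval_C, Polynomial.algebraMap_apply, Polynomial.algebraMap_apply]
    simp
  | add p q hp hq => rw [map_add, map_add, Polynomial.evalEval_add, hp, hq]
  | mul_X p i hp =>
    rw [map_mul (aeval _), map_mul (eval _), Polynomial.evalEval_mul, hp, aeval_X, eval_X]
    fin_cases i
    · simp [Polynomial.evalEval]; left; ring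
    · simp [Polynomial.evalEval]; left; ring

theorem tendsto_evalEval {Q : Polynomial (Polynomial ℂ)} {n : ℕ} (hn : Q.natDegree ≤ n)
    {x y : ℕ → ℂ} {η : ℂ} (hx : Tendsto (fun N => x N / N) atTop (𝓝 1)) (hy : Tendsto y atTop (𝓝 η)) :
    Tendsto (fun N => Q.evalEval (y N) (x N) / (N : ℂ) ^ n) atTop (𝓝 ((Q.coeff n).eval η)) := by
  have hlim : Tendsto (fun N : ℕ => ∑ k ∈ Finset.range (n + 1),
      (Q.coeff k).eval (y N) * (x N / N) ^ k * ((N : ℂ)⁻¹) ^ (n - k)) atTop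
      (𝓝 (∑ k ∈ Finset.range (n + 1), (Q.coeff k).eval η * 1 ^ k * 0 ^ (n - k))) := by
    refine tendsto_finsetSum _ fun k _ => ?_
    exact ((((Q.coeff k).continuous.tendsto η).comp hy).mul (hx.pow k)).mul
      (tendsto_natCast_inv.pow (n - k))
  have hval : ∑ k ∈ Finset.range (n + 1), (Q.coeff k).eval η * 1 ^ k * 0 ^ (n - k)
      = (Q.coeff n).eval η := by
    rw [Finset.sum_range_succ, Finset.sum_eq_zero]
    · simp
    · intro k hk
      have : n - k ≠ 0 := by have := Finset.mem_range.1 hk; omega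
      rw [zero_pow this, mul_zero]
  rw [hval] at hlim
  refine hlim.congr' ?_
  filter_upwards [eventually_gt_atTop 0] with N hN
  have hN0 : (N : ℂ) ≠ 0 := by exact_mod_cast hN.ne'
  rw [Polynomial.evalEval, Polynomial.eval_eq_sum_range' (Nat.lt_succ_of_le hn),
    Polynomial.eval_finsetSum, Finset.sum_div]
  refine Finset.sum_congr rfl fun k hk => ?_
  obtain ⟨j, rfl⟩ := Nat.exists_eq_add_of_le (Nat.lt_succ_iff.1 (Finset.mem_range.1 hk))
  rw [Nat.add_sub_cancel_left, Polynomial.eval_mul, Polynomial.eval_pow, Polynomial.eval_C, pow_add,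
    div_pow, inv_pow]
  field_simp

theorem tendsto_mul_eval_sub (g : Polynomial ℂ) {c y y' : ℕ → ℂ} {η : ℂ} (hy : Tendsto y atTop (𝓝 η))
    (hy' : Tendsto y' atTop (𝓝 η)) (hc : Tendsto (fun N => c N * (y N - y' N)) atTop (𝓝 0)) :
    Tendsto (fun N => c N * (g.eval (y N) - g.eval (y' N))) atTop (𝓝 0) := by
  induction g using Polynomial.induction_on with
  | C a => simp
  | add p q hp hq =>
    simpa [Polynomial.eval_add, add_sub_add_comm, mul_add] using hp.add hq
  | monomial n a hn =>
    have := (hn.mul hy).add ((((Polynomial.continuous (Polynomial.C a * Polynomial.X ^ n)).tendsto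
      η).comp hy').mul hc)
    simp only [zero_mul, mul_zero, add_zero] at this
    refine this.congr fun N => ?_
    simp only [Polynomial.eval_mul, Polynomial.eval_C, Polynomial.eval_pow, Polynomial.eval_X,
      Function.comp]
    ring

/-- For a bounded difference of abscissae tending to `ξ`, `x ^ (K + 1) - x' ^ (K + 1)` grows like
`(K + 1) ξ N ^ K`. The ordinates differ by `o(1 / N)`, so they contribute `o(N ^ K)`, as do the
lower terms of `Q`. -/
theorem tendsto_evalEval_sub {Q : Polynomial (Polynomial ℂ)} {K : ℕ} (hK : Q.natDegree = K + 1)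
    {x x' y y' : ℕ → ℂ} {η ξ : ℂ} (hx : Tendsto (fun N => x N / N) atTop (𝓝 1))
    (hx' : Tendsto (fun N => x' N / N) atTop (𝓝 1)) (hxx : Tendsto (fun N => x N - x' N) atTop (𝓝 ξ))
    (hy : Tendsto y atTop (𝓝 η)) (hy' : Tendsto y' atTop (𝓝 η))
    (hyy : Tendsto (fun N => N * (y N - y' N)) atTop (𝓝 0)) :
    Tendsto (fun N => (Q.evalEval (y N) (x N) - Q.evalEval (y' N) (x' N)) / (N : ℂ) ^ K) atTop
      (𝓝 ((K + 1) * ξ * Q.leadingCoeff.eval η)) := by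
  have herase : Q.eraseLead.natDegree ≤ K := by
    have := Polynomial.eraseLead_natDegree_le Q; omega
  have h1 := (tendsto_evalEval herase hx hy).sub (tendsto_evalEval herase hx' hy')
  rw [sub_self] at h1
  have h2 : Tendsto (fun N : ℕ => (x N - x' N) * ∑ i ∈ Finset.range (K + 1),
      (x N / N) ^ i * (x' N / N) ^ (K + 1 - 1 - i)) atTop (𝓝 ((K + 1) * ξ)) := by
    have := hxx.mul (tendsto_finsetSum (Finset.range (K + 1)) fun i _ =>
      (hx.pow i).mul (hx'.pow (K + 1 - 1 - i)))
    simp only [one_pow, mul_one, Finset.sum_const, Finset.card_range, nsmul_eq_mul] at this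
    convert this using 2
    push_cast; ring
  have h3 := ((Q.leadingCoeff.continuous.tendsto η).comp hy).mul h2
  have h4 := (tendsto_mul_eval_sub Q.leadingCoeff hy hy' hyy).mul (hx'.pow (K + 1))
  have h5 := (h1.add h3).add h4
  have e : (0 : ℂ) + Q.leadingCoeff.eval η * ((K + 1) * ξ) + 0 * 1 ^ (K + 1)
      = (K + 1) * ξ * Q.leadingCoeff.eval η := by ring
  rw [e] at h5
  refine h5.congr' ?_
  filter_upwards [eventually_gt_atTop 0] with N hN
  have hN0 : (N : ℂ) ≠ 0 := by exact_mod_cast hN.ne'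
  have hQ : ∀ u v : ℂ, Q.evalEval u v = Q.eraseLead.evalEval u v
      + Q.leadingCoeff.eval u * v ^ (K + 1) := by
    intro u v
    conv_lhs => rw [← Polynomial.eraseLead_add_C_mul_X_pow Q, hK]
    simp [Polynomial.evalEval]
  have hgeom : (x N - x' N) * ∑ i ∈ Finset.range (K + 1),
      (x N / N) ^ i * (x' N / N) ^ (K + 1 - 1 - i) = (x N ^ (K + 1) - x' N ^ (K + 1)) / (N : ℂ) ^ K := by
    have := (Commute.all (x N / N) (x' N / N)).mul_geom_sum₂ (K + 1)
    rw [← sub_div, div_pow, div_pow, ← sub_div, pow_succ (N : ℂ), ← div_div] at this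
    field_simp at this ⊢
    linear_combination this
  simp only [Function.comp]
  rw [hQ, hQ, hgeom, div_pow, pow_succ (N : ℂ)]
  field_simp
  ring

end

/-! ### A finite asymptote forces independence of one coordinate. -/

section

open MvPolynomial Filter Topology

theorem larmorPoint_rotated {f : MvPolynomial (Fin 2) ℂ} {a b d x y u v : ℂ} (hd : a ^ 2 + b ^ 2 = d)
    (hd0 : d ≠ 0)
    (hu : u = -b * eval ![x * a - y * b, x * b + y * a] (pderiv 0 f)
      + a * eval ![x * a - y * b, x * b + y * a] (pderiv 1 f))
    (hv : v = a * eval ![x * a - y * b, x * b + y * a] (pderiv 0 f)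
      + b * eval ![x * a - y * b, x * b + y * a] (pderiv 1 f)) (r θ : ℝ) (l : ℂ) :
    larmorPoint f r θ ![x * a - y * b, x * b + y * a] l =
      ![(x + r / d * ((Real.cos θ - 1) * (v / l) - Real.sin θ * (u / l))) * a
        - (y + r / d * ((Real.cos θ - 1) * (u / l) + Real.sin θ * (v / l))) * b,
        (x + r / d * ((Real.cos θ - 1) * (v / l) - Real.sin θ * (u / l))) * b
        + (y + r / d * ((Real.cos θ - 1) * (u / l) + Real.sin θ * (v / l))) * a] := by
  have h0 : eval ![x * a - y * b, x * b + y * a] (pderiv 0 f) = (a * v - b * u) / d := by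
    rw [eq_div_iff hd0, hu, hv, ← hd]; ring
  have h1 : eval ![x * a - y * b, x * b + y * a] (pderiv 1 f) = (b * v + a * u) / d := by
    rw [eq_div_iff hd0, hu, hv, ← hd]; ring
  rw [larmorPoint, h0, h1]
  ext i
  fin_cases i
  · simp; ring
  · simp; ring

/-- For the points at angles `θ` and `-θ`, the abscissae differ by a quantity tending to `-2 (r / d)
sin θ κ`, while the ordinates differ by a multiple of `V = o(1 / N)`. -/
theorem tendsto_rotated_sub {G : MvPolynomial (Fin 2) ℂ} {a b d : ℂ} {K : ℕ}
    (hK : (rotated a b G).natDegree = K + 1) {Y U V : ℕ → ℂ} {y κ : ℂ} (hY : Tendsto Y atTop (𝓝 y))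
    (hU : Tendsto U atTop (𝓝 κ)) (hV : Tendsto (fun N => N * V N) atTop (𝓝 0)) (r θ : ℝ) :
    Tendsto (fun N : ℕ => (
      eval ![(N + r / d * ((Real.cos θ - 1) * V N - Real.sin θ * U N)) * a
        - (Y N + r / d * ((Real.cos θ - 1) * U N + Real.sin θ * V N)) * b,
        (N + r / d * ((Real.cos θ - 1) * V N - Real.sin θ * U N)) * b
        + (Y N + r / d * ((Real.cos θ - 1) * U N + Real.sin θ * V N)) * a] G -
      eval ![(N + r / d * ((Real.cos (-θ) - 1) * V N - Real.sin (-θ) * U N)) * a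
        - (Y N + r / d * ((Real.cos (-θ) - 1) * U N + Real.sin (-θ) * V N)) * b,
        (N + r / d * ((Real.cos (-θ) - 1) * V N - Real.sin (-θ) * U N)) * b
        + (Y N + r / d * ((Real.cos (-θ) - 1) * U N + Real.sin (-θ) * V N)) * a] G) / (N : ℂ) ^ K) atTop
      (𝓝 ((K + 1) * (-(2 * (r / d) * Real.sin θ * κ)) *
        (rotated a b G).leadingCoeff.eval (y + r / d * ((Real.cos θ - 1) * κ)))) := by
  have hN : ∀ᶠ N : ℕ in atTop, (N : ℂ) ≠ 0 := by
    filter_upwards [eventually_gt_atTop 0] with N hN using by exact_mod_cast hN.ne'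
  have hV0 : Tendsto V atTop (𝓝 0) := by
    have := tendsto_natCast_inv.mul hV
    rw [mul_zero] at this
    refine this.congr' ?_
    filter_upwards [hN] with N hN
    rw [inv_mul_cancel_left₀ hN]
  have hx : ∀ c s : ℂ, Tendsto (fun N : ℕ => (N + r / d * (c * V N - s * U N)) / N) atTop (𝓝 1) := by
    intro c s
    have := (((hV0.const_mul c).sub (hU.const_mul s)).const_mul (r / d)).mul tendsto_natCast_inv
    rw [mul_zero] at this
    have := this.const_add 1
    rw [add_zero] at this
    refine this.congr' ?_
    filter_upwards [hN] with N hN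
    field_simp
  have hy : ∀ c s : ℂ, Tendsto (fun N : ℕ => Y N + r / d * (c * U N + s * V N)) atTop
      (𝓝 (y + r / d * (c * κ))) := by
    intro c s
    have := hY.add (((hU.const_mul c).add (hV0.const_mul s)).const_mul (r / d : ℂ))
    rwa [mul_zero, add_zero] at this
  simp only [← evalEval_rotated]
  have hcos : Real.cos (-θ) = Real.cos θ := Real.cos_neg θ
  have hsin : ((Real.sin (-θ) : ℝ) : ℂ) = -Real.sin θ := by rw [Real.sin_neg]; push_cast; rfl
  rw [hcos, hsin]
  refine tendsto_evalEval_sub hK (hx _ _) (hx _ _) ?_ (hy _ _) (hy _ _) ?_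
  · have := hU.const_mul (-(2 * (r / d) * Real.sin θ))
    rw [neg_mul] at this
    refine this.congr fun N => ?_
    ring
  · have := hV.const_mul (2 * (r / d) * Real.sin θ)
    rw [mul_zero] at this
    refine this.congr fun N => ?_
    ring

theorem sqrt_one_add_tendsto {e : ℕ → ℂ} (he : Tendsto e atTop (𝓝 0)) :
    ∃ s : ℕ → ℂ, Tendsto s atTop (𝓝 1) ∧ ∀ N, s N ^ 2 = 1 + e N := by
  refine ⟨fun N => (1 + e N) ^ (((2 : ℕ) : ℂ)⁻¹), ?_, fun N => Complex.cpow_nat_inv_pow _ two_ne_zero⟩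
  have h1 : Tendsto (fun N => 1 + e N) atTop (𝓝 1) := by simpa using he.const_add 1
  have := h1.cpow (tendsto_const_nhds (x := (((2 : ℕ) : ℂ)⁻¹))) (by simp)
  simpa using this

/-- If `G` is symmetric with respect to the circles tangent to the curve `f = 0`, and this curve has a
branch at infinity in the direction `(a, b)` with a finite asymptote, then `G` does not depend on the
coordinate along `(a, b)`. -/
theorem natDegree_rotated_eq_zero {f G : MvPolynomial (Fin 2) ℂ} {r : ℝ} (hr : r ≠ 0) {a b c d : ℂ}
    (hd : a ^ 2 + b ^ 2 = d) (hd0 : d ≠ 0) (hc0 : c ≠ 0) {n : ℕ} {y : ℂ} {Y : ℕ → ℂ}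
    (hY : Tendsto Y atTop (𝓝 y))
    (hf0 : ∀ᶠ N : ℕ in atTop, eval ![N * a - Y N * b, N * b + Y N * a] f = 0)
    (hu : Tendsto (fun N : ℕ => (-b * eval ![N * a - Y N * b, N * b + Y N * a] (pderiv 0 f)
        + a * eval ![N * a - Y N * b, N * b + Y N * a] (pderiv 1 f)) / (N : ℂ) ^ n) atTop (𝓝 c))
    (hv : Tendsto (fun N : ℕ => N * ((a * eval ![N * a - Y N * b, N * b + Y N * a] (pderiv 0 f)
        + b * eval ![N * a - Y N * b, N * b + Y N * a] (pderiv 1 f)) / (N : ℂ) ^ n)) atTop (𝓝 0))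
    (hsym : ∀ (θ : ℝ) (p : Fin 2 → ℂ), eval p f = 0 → ∀ l : ℂ, l ^ 2 = eval p (gradSq f) → l ≠ 0 →
      eval (larmorPoint f r θ p l) G = eval (larmorPoint f r (-θ) p l) G ∨
      eval (larmorPoint f r θ p (-l)) G = eval (larmorPoint f r (-θ) p (-l)) G) :
    (rotated a b G).natDegree = 0 := by
  by_contra hne
  obtain ⟨K, hK⟩ := Nat.exists_eq_succ_of_ne_zero hne
  have hN : ∀ᶠ N : ℕ in atTop, (N : ℂ) ≠ 0 := by
    filter_upwards [eventually_gt_atTop 0] with N hN using by exact_mod_cast hN.ne'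
  let u : ℕ → ℂ := fun N => -b * eval ![N * a - Y N * b, N * b + Y N * a] (pderiv 0 f)
        + a * eval ![N * a - Y N * b, N * b + Y N * a] (pderiv 1 f)
  let v : ℕ → ℂ := fun N => a * eval ![N * a - Y N * b, N * b + Y N * a] (pderiv 0 f)
        + b * eval ![N * a - Y N * b, N * b + Y N * a] (pderiv 1 f)
  have hNe : Tendsto (fun N : ℕ => N * (v N / u N)) atTop (𝓝 0) := by
    have := hv.div hu hc0
    rw [zero_div] at this
    refine this.congr' ?_
    filter_upwards [hN] with N hN
    change N * (v N / (N : ℂ) ^ n) / (u N / (N : ℂ) ^ n) = _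
    rw [mul_div_assoc, div_div_div_cancel_right₀ (pow_ne_zero n hN)]
  have he : Tendsto (fun N : ℕ => v N / u N) atTop (𝓝 0) := by
    have := tendsto_natCast_inv.mul hNe
    rw [mul_zero] at this
    refine this.congr' ?_
    filter_upwards [hN] with N hN
    rw [inv_mul_cancel_left₀ hN]
  obtain ⟨s, hs, hs2⟩ := sqrt_one_add_tendsto (e := fun N => (v N / u N) ^ 2) (by simpa using he.pow 2)
  obtain ⟨κ, hκ⟩ := IsAlgClosed.exists_pow_nat_eq d (n := 2) two_pos
  have hκ0 : κ ≠ 0 := by rintro rfl; exact hd0 (by rw [← hκ]; simp)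
  have hu0 : ∀ᶠ N in atTop, u N ≠ 0 := by
    filter_upwards [hu.eventually_ne hc0] with N hN h0
    exact hN (by change u N / _ = 0; rw [h0, zero_div])
  have hs0 : ∀ᶠ N in atTop, s N ≠ 0 := hs.eventually_ne one_ne_zero
  -- Since `gradSq f = (u ^ 2 + v ^ 2) / d` and `κ ^ 2 = d`, this is a square root of `gradSq f`
  -- with `u / l` tending to `κ`.
  let l : ℕ → ℂ := fun N => u N / κ * s N
  have hul : Tendsto (fun N => u N / l N) atTop (𝓝 κ) := by
    have := (tendsto_const_nhds (x := κ)).div hs one_ne_zero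
    rw [div_one] at this
    refine this.congr' ?_
    filter_upwards [hu0, hs0] with N h1 h2
    simp only [Pi.div_apply, l]; field_simp
  have hvl : Tendsto (fun N : ℕ => N * (v N / l N)) atTop (𝓝 0) := by
    have := hNe.mul hul
    rw [zero_mul] at this
    refine this.congr' ?_
    filter_upwards [hu0, hs0] with N h1 h2
    simp only [l]; field_simp
  have hl2 : ∀ᶠ N : ℕ in atTop, l N ^ 2 = eval ![N * a - Y N * b, N * b + Y N * a] (gradSq f) := by
    filter_upwards [hu0] with N h1
    have e1 : l N ^ 2 = (u N ^ 2 + v N ^ 2) / d := by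
      simp only [l, mul_pow, hs2, div_pow, hκ]; field_simp
    rw [e1, div_eq_iff hd0, gradSq, map_add, map_pow, map_pow, ← hd]
    simp only [u, v]; ring
  -- Which of the roots `l`, `-l` gives the symmetry may change with `N`; the product of the two
  -- differences vanishes in any case, and so does its limit.
  have key : ∀ θ : ℝ, Real.sin θ ≠ 0 →
      (rotated a b G).leadingCoeff.eval (y + r / d * ((Real.cos θ - 1) * κ)) *
      (rotated a b G).leadingCoeff.eval (y + r / d * ((Real.cos θ - 1) * -κ)) = 0 := by
    intro θ hθ
    have hul' : Tendsto (fun N => u N / -l N) atTop (𝓝 (-κ)) :=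
      hul.neg.congr fun N => by rw [div_neg]
    have hvl' : Tendsto (fun N : ℕ => N * (v N / -l N)) atTop (𝓝 0) := by
      have := hvl.neg
      rw [neg_zero] at this
      exact this.congr fun N => by rw [div_neg, mul_neg]
    have hT := (tendsto_rotated_sub (d := d) hK hY hul hvl r θ).mul
      (tendsto_rotated_sub (d := d) hK hY hul' hvl' r θ)
    have h0 := tendsto_nhds_unique_of_eventuallyEq hT (tendsto_const_nhds (x := (0 : ℂ))) (by
      filter_upwards [hu0, hs0, hl2, hf0] with N h1 h2 h3 h4
      have hl0 : l N ≠ 0 := mul_ne_zero (div_ne_zero h1 hκ0) h2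
      have h5 := hsym θ _ h4 (l N) h3 hl0
      simp only [larmorPoint_rotated hd hd0 (u := u N) (v := v N) rfl rfl] at h5
      refine mul_eq_zero.2 (h5.imp (fun h => ?_) (fun h => ?_))
      · exact div_eq_zero_iff.2 (Or.inl (sub_eq_zero.2 h))
      · exact div_eq_zero_iff.2 (Or.inl (sub_eq_zero.2 h)))
    have hK1 : (K + 1 : ℂ) ≠ 0 := by exact_mod_cast Nat.succ_ne_zero K
    have hrd : (r / d : ℂ) ≠ 0 := div_ne_zero (by exact_mod_cast hr) hd0
    have hsc : (Real.sin θ : ℂ) ≠ 0 := by exact_mod_cast hθ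
    have hp : ((K + 1 : ℂ) * (2 * (r / d) * Real.sin θ * κ)) ^ 2 ≠ 0 :=
      pow_ne_zero 2 (mul_ne_zero hK1 (mul_ne_zero (mul_ne_zero (mul_ne_zero two_ne_zero hrd) hsc) hκ0))
    apply mul_left_cancel₀ hp
    linear_combination -h0
  have hG0 : (rotated a b G).leadingCoeff ≠ 0 := by
    intro h0
    rw [Polynomial.leadingCoeff_eq_zero] at h0
    exact hne (by rw [h0, Polynomial.natDegree_zero])
  set g := (rotated a b G).leadingCoeff with hg
  have hrk : (r / d * κ : ℂ) ≠ 0 := mul_ne_zero (div_ne_zero (by exact_mod_cast hr) hd0) hκ0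
  -- As `θ` varies, `cos θ - 1` takes all values in `(-2, 0)`, so a product of two affine
  -- substitutions of the leading coefficient has infinitely many zeros.
  have hprod : g.comp (Polynomial.C (r / d * κ) * Polynomial.X + Polynomial.C y) *
      g.comp (Polynomial.C (r / d * -κ) * Polynomial.X + Polynomial.C y) = 0 := by
    refine Polynomial.eq_zero_of_infinite_isRoot _ (Set.Infinite.mono ?_
      ((Set.Ioo_infinite (show (-2 : ℝ) < 0 by norm_num)).image Complex.ofReal_injective.injOn))
    rintro _ ⟨t, ht, rfl⟩
    have hcos : Real.cos (Real.arccos (1 + t)) = 1 + t :=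
      Real.cos_arccos (by linarith [ht.1]) (by linarith [ht.2])
    have hsin : Real.sin (Real.arccos (1 + t)) ≠ 0 := by
      rw [Real.sin_arccos]
      refine (Real.sqrt_pos.2 ?_).ne'
      nlinarith [ht.1, ht.2]
    have := key _ hsin
    rw [hcos] at this
    change Polynomial.eval _ _ = 0
    simp only [Polynomial.eval_mul, Polynomial.eval_comp, Polynomial.eval_add, Polynomial.eval_C,
      Polynomial.eval_X]
    rwa [show (r / d * κ * t + y : ℂ) = y + r / d * (((1 + t : ℝ) - 1) * κ) by push_cast; ring,
      show (r / d * -κ * t + y : ℂ) = y + r / d * (((1 + t : ℝ) - 1) * -κ) by push_cast; ring]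
  have hcomp : ∀ e : ℂ, e ≠ 0 → g.comp (Polynomial.C e * Polynomial.X + Polynomial.C y) = 0 → g = 0 := by
    intro e he h
    refine Polynomial.funext fun t => ?_
    have := congrArg (Polynomial.eval ((t - y) / e)) h
    simp only [Polynomial.eval_comp, Polynomial.eval_add, Polynomial.eval_mul, Polynomial.eval_C,
      Polynomial.eval_X] at this
    rw [mul_div_cancel₀ _ he, sub_add_cancel] at this
    simpa using this
  rcases mul_eq_zero.1 hprod with h | h
  · exact hG0 (hcomp _ hrk h)
  · exact hG0 (hcomp _ (by rw [mul_neg]; exact neg_ne_zero.2 hrk) h)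

end

/-! ### Tangency with the line at infinity. -/

section

open MvPolynomial

variable {γ τ : ℝ → ℂ} {k : ℝ → ℝ} {s₀ s₁ r : ℝ}

/-- Otherwise `G = 0` is a finite union of complex lines with direction `(a, b)`, and by
connectedness the arc lies on one of them. The first two derivatives along the arc, with `k ≠ 0`,
annihilate the linear form on both `τ` and `J τ`, which is impossible for `a ^ 2 + b ^ 2 ≠ 0`. -/
theorem IsFrenet.natDegree_rotated_ne_zero (h : IsFrenet γ τ k (Set.Ioo s₀ s₁)) (h01 : s₀ < s₁)
    (hρ : ∀ s ∈ Set.Ioo s₀ s₁, 1 - r * k s ≠ 0) (hk : ∀ s ∈ Set.Ioo s₀ s₁, k s ≠ 0)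
    {G : MvPolynomial (Fin 2) ℂ} (hG : G ≠ 0)
    (hG0 : ∀ s ∈ Set.Ioo s₀ s₁, eval (toC2 (parallel γ τ r s)) G = 0) {a b : ℂ}
    (hd : a ^ 2 + b ^ 2 ≠ 0) : (rotated a b G).natDegree ≠ 0 := by
  intro hdeg
  obtain ⟨g, hg⟩ := Polynomial.natDegree_eq_zero.1 hdeg
  have hGg : ∀ x y : ℂ, eval ![x * a - y * b, x * b + y * a] G = g.eval y := fun x y => by
    rw [← evalEval_rotated, ← hg, Polynomial.evalEval_C]
  have hGz : ∀ p : Fin 2 → ℂ, eval p G = g.eval ((a * p 1 - b * p 0) / (a ^ 2 + b ^ 2)) := fun p => by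
    rw [← hGg ((a * p 0 + b * p 1) / (a ^ 2 + b ^ 2))]
    congr 2
    ext i
    fin_cases i
    · simp; field_simp; ring
    · simp; field_simp; ring
  have hg0 : g ≠ 0 := by
    rintro rfl
    exact hG (MvPolynomial.funext fun p => by rw [hGz]; simp)
  obtain ⟨s, hs⟩ := Set.nonempty_Ioo.2 h01
  let L : MvPolynomial (Fin 2) ℂ := C a * X 1 - C b * X 0
  have hL : ∀ p, eval p L = a * p 1 - b * p 0 := fun p => by simp [L]
  have hL' : ∀ (e z w : ℂ), dirEval (L - C e) z w = a * w.im - b * w.re := fun e z w => by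
    simp [dirEval, L, pderiv_X]; ring
  have hconst : ∀ t ∈ Set.Ioo s₀ s₁, eval (toC2 (parallel γ τ r t)) L
      = eval (toC2 (parallel γ τ r s)) L := by
    intro t ht
    have hcont : ContinuousOn (fun t => eval (toC2 (parallel γ τ r t)) L / (a ^ 2 + b ^ 2))
        (Set.Ioo s₀ s₁) :=
      ((continuous_eval L).comp_continuousOn h.continuousOn_parallel).div_const _
    have := eq_of_finite_values (f := fun t => eval (toC2 (parallel γ τ r t)) L / (a ^ 2 + b ^ 2))
      isPreconnected_Ioo hcont (V := {z | z ∈ g.roots.toFinset}) g.roots.toFinset.finite_toSet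
      (fun t ht => by
        change _ ∈ g.roots.toFinset
        rw [Multiset.mem_toFinset, Polynomial.mem_roots hg0, Polynomial.IsRoot, hL, ← hGz]
        exact hG0 t ht) ht hs
    exact (div_left_inj' hd).1 this
  have hL0 : ∀ t ∈ Set.Ioo s₀ s₁, eval (toC2 (parallel γ τ r t))
      (L - C (eval (toC2 (parallel γ τ r s)) L)) = 0 := fun t ht => by
    rw [map_sub, eval_C, hconst t ht, sub_self]
  have h1 := h.dirEval_tangent hρ hL0 hs
  have h2 := h.dirEval₂_tangent hρ hL0 hs
  have h3 : dirEval₂ (L - C (eval (toC2 (parallel γ τ r s)) L)) (parallel γ τ r s) (τ s) (τ s) = 0 := by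
    simp [dirEval₂, dirEval, L, pderiv_X]
  have hkc : (k s : ℂ) ≠ 0 := by exact_mod_cast hk s hs
  rw [h3, mul_zero, zero_add] at h2
  have h4 := (mul_eq_zero.1 h2).resolve_left hkc
  rw [hL'] at h1 h4
  simp only [Complex.mul_re, Complex.mul_im, Complex.I_re, Complex.I_im, zero_mul, one_mul, zero_sub,
    zero_add, Complex.ofReal_neg] at h4
  have hτ := sq_re_add_sq_im (h.norm_tangent s hs)
  apply hd
  linear_combination (-(a ^ 2 + b ^ 2)) * hτ + (a * (τ s).im - b * (τ s).re) * h1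
    + (a * (τ s).re + b * (τ s).im) * h4

/-- At non-isotropic non-singular points at infinity, the curve that contains the parallel curve is
tangent to the line at infinity. -/
theorem IsFrenet.isTangentToLineAtInfinity (h : IsFrenet γ τ k (Set.Ioo s₀ s₁)) (h01 : s₀ < s₁)
    (hr : r ≠ 0) (hρ : ∀ s ∈ Set.Ioo s₀ s₁, 1 - r * k s ≠ 0) (hk : ∀ s ∈ Set.Ioo s₀ s₁, k s ≠ 0)
    {f G : MvPolynomial (Fin 2) ℂ} (hf : Irreducible f) (hsmooth : IsSmoothAffineCurve f)
    (hf0 : ∀ s ∈ Set.Ioo s₀ s₁, eval (toC2 (parallel γ τ r s)) f = 0) (hG : G ≠ 0)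
    (hG0 : ∀ s ∈ Set.Ioo s₀ s₁, eval (toC2 (parallel γ τ r s)) G = 0)
    (hsym : ∀ s ∈ Set.Ioo s₀ s₁, IsSymmetricOnCircle G r (γ s) (Complex.I * τ s))
    {P : Fin 3 → ℂ} (hP0 : P ≠ 0) (hP2 : P 2 = 0) (hP : IsNonsingularPoint (homogenization f) P)
    (hiso : ¬ IsIsotropic P) : IsTangentToLineAtInfinity (homogenization f) P := by
  obtain ⟨a, b, rfl⟩ : ∃ a b, P = ![a, b, 0] := ⟨P 0, P 1, by
    ext i; fin_cases i
    · rfl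
    · rfl
    · exact hP2⟩
  -- The isotropic points are the zeros of `a ^ 2 + b ^ 2` at infinity.
  have hd : a ^ 2 + b ^ 2 ≠ 0 := by
    intro hd
    have hab : (b - Complex.I * a) * (b + Complex.I * a) = 0 := by
      linear_combination hd - a ^ 2 * Complex.I_sq
    have ha : a ≠ 0 := by
      rintro rfl
      have hb : b = 0 := by simpa using hd
      exact hP0 (by ext i; fin_cases i <;> simp [hb])
    refine hiso ⟨a, ha, (mul_eq_zero.1 hab).imp (fun h => ?_) (fun h => ?_)⟩
    · ext i; fin_cases i
      · simp
      · simp; linear_combination h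
      · simp
    · ext i; fin_cases i
      · simp
      · simp; linear_combination h
      · simp
  have hdeg : f.totalDegree ≠ 0 := by
    intro h0
    rw [totalDegree_eq_zero_iff_eq_C] at h0
    have hc : f.coeff 0 ≠ 0 := fun hc => hf.ne_zero (by rw [h0, hc, C_0])
    exact hf.not_isUnit (by rw [h0]; exact (isUnit_iff_ne_zero.2 hc).map C)
  obtain ⟨n, hn⟩ := Nat.exists_eq_succ_of_ne_zero hdeg
  have hE := congrArg (eval ![a, b, 0]) (homogenization_isHomogeneous f).sum_X_mul_pderiv
  rw [map_nsmul, hP.1, smul_zero, Fin.sum_univ_three] at hE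
  simp only [map_add, map_mul, eval_X] at hE
  have hE' : a * eval ![a, b, 0] (pderiv 0 (homogenization f))
      + b * eval ![a, b, 0] (pderiv 1 (homogenization f)) = 0 := by simpa using hE
  -- Euler's relation kills the derivative along `(a, b)`. If the derivative along `(-b, a)`
  -- vanishes too, only the `z` derivative is left and the tangent is `z = 0`; otherwise there is a
  -- branch with a finite asymptote.
  by_cases hc : -b * eval ![a, b, 0] (pderiv 0 (homogenization f))
      + a * eval ![a, b, 0] (pderiv 1 (homogenization f)) = 0
  · have h0 : eval ![a, b, 0] (pderiv 0 (homogenization f)) = 0 := by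
      apply mul_left_cancel₀ hd
      linear_combination a * hE' - b * hc
    have h1 : eval ![a, b, 0] (pderiv 1 (homogenization f)) = 0 := by
      apply mul_left_cancel₀ hd
      linear_combination b * hE' + a * hc
    intro Q hQ
    rw [Fin.sum_univ_three, h0, h1, hQ]; ring
  · obtain ⟨y, Y, hY, hYf, hu, hv⟩ := exists_branch_at_infinity hn hP.1 rfl hc
    exact absurd (natDegree_rotated_eq_zero (G := G) hr rfl hd hc hY hYf hu hv
      fun θ p hp l hl hl0 => h.symmetric_complex h01 hρ hf hsmooth hf0 hsym θ hp hl hl0)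
      (h.natDegree_rotated_ne_zero h01 hρ hk hG hG0 hd)

end

/-! ### Structure of the parallel curve of an entire smooth piece. -/

section

open MvPolynomial

theorem IsSymmetricOnCircle.sub_C {F : MvPolynomial (Fin 2) ℂ} {r : ℝ} {x n : ℂ}
    (h : IsSymmetricOnCircle F r x n) (c : ℂ) : IsSymmetricOnCircle (F - C c) r x n := fun θ => by
  rw [map_sub, map_sub, h θ, eval_C, eval_C]

/-- A curve whose curvature is constantly `1 / r` lies on a circle of radius `|r|`. -/
theorem IsFrenet.exists_center {γ τ : ℝ → ℂ} {k : ℝ → ℝ} {s₀ s₁ r : ℝ}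
    (h : IsFrenet γ τ k (Set.Ioo s₀ s₁)) (h01 : s₀ < s₁)
    (hρ : ∀ s ∈ Set.Ioo s₀ s₁, 1 - r * k s = 0) :
    ∃ o : ℂ, ∀ s ∈ Set.Ioo s₀ s₁, ‖γ s - o‖ = |r| := by
  obtain ⟨t, ht⟩ := Set.nonempty_Ioo.2 h01
  have hd : ∀ s ∈ Set.Ioo s₀ s₁, HasDerivAt (parallel γ τ r) 0 s := fun s hs => by
    simpa [hρ s hs] using h.hasDerivAt_parallel r hs
  refine ⟨parallel γ τ r t, fun s hs => ?_⟩
  have := isOpen_Ioo.is_const_of_deriv_eq_zero isPreconnected_Ioo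
    (fun s hs => (hd s hs).differentiableAt.differentiableWithinAt) (fun s hs => (hd s hs).deriv) hs ht
  rw [← this, parallel, sub_add_cancel_left, norm_neg, norm_mul, norm_mul, Complex.norm_I,
    h.norm_tangent s hs, Complex.norm_real, Real.norm_eq_abs, one_mul, mul_one]

namespace PiecewiseSmoothBoundary

variable {Ω : Set ℂ} (B : PiecewiseSmoothBoundary Ω)

theorem continuousOn_parallel (i : Fin B.n) (r : ℝ) :
    ContinuousOn (parallel B.curve (B.tangent i) r) (B.interval i) :=
  (B.smooth i).continuousOn.add
    (continuousOn_const.mul (continuousOn_const.mul (B.contDiffOn_tangent i).continuousOn))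

variable {B}

/-- The structure of the parallel curves of a piece on which the curvature is not constantly `1 / r`,
for a non-constant polynomial `F` which is symmetric on the circles about the points of the piece. -/
theorem exists_minimalDefiningPolynomial {i : Fin B.n} {r : ℝ} (hr : r ≠ 0)
    {F : MvPolynomial (Fin 2) ℂ} (hF : ∃ z z' : ℂ, eval (toC2 z) F ≠ eval (toC2 z') F)
    (hsym : ∀ s ∈ B.openInterval i, IsSymmetricOnCircle F r (B.curve s) (Complex.I * B.tangent i s))
    (hk : ∀ s ∈ B.openInterval i, B.curvature i s ≠ 0)
    (hρ : ∃ s ∈ B.openInterval i, 1 - r * B.curvature i s ≠ 0) :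
    ∃ f : MvPolynomial (Fin 2) ℝ,
      IsMinimalDefiningPolynomial f (parallel B.curve (B.tangent i) r '' B.interval i) ∧
      IsSmoothAffineCurve (complexify f) ∧
      ∀ P : Fin 3 → ℂ, P ≠ 0 → P 2 = 0 →
        IsNonsingularPoint (homogenization (complexify f)) P → ¬ IsIsotropic P →
          IsTangentToLineAtInfinity (homogenization (complexify f)) P := by
  have hfr := B.isFrenet i
  obtain ⟨s, hs, hρs⟩ := hρ
  have hcont : ContinuousAt (fun s => ((1 - r * B.curvature i s : ℝ) : ℂ)) s :=
    Complex.continuous_ofReal.continuousAt.comp (continuousAt_const.sub (continuousAt_const.mul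
      ((B.continuousOn_curvature i).continuousAt (B.interval_mem_nhds i hs))))
  obtain ⟨s₀, s₁, h01, hsub, hne⟩ := exists_Ioo_ne_zero hs hcont (by exact_mod_cast hρs)
  have hρ : ∀ t ∈ Set.Ioo s₀ s₁, 1 - r * B.curvature i t ≠ 0 := fun t ht h0 =>
    hne t ht (by rw [h0, Complex.ofReal_zero])
  set c := eval (toC2 (parallel B.curve (B.tangent i) r s)) F with hc
  have hG : F - C c ≠ 0 := by
    intro h0
    obtain ⟨z, z', hz⟩ := hF
    rw [sub_eq_zero.1 h0, eval_C, eval_C] at hz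
    exact hz rfl
  have hG0 : ∀ t ∈ B.openInterval i,
      eval (toC2 (parallel B.curve (B.tangent i) r t)) (F - C c) = 0 := fun t ht => by
    rw [map_sub, eval_C, hc, hfr.eval_parallel_eq hr hsym ht hs, sub_self]
  have hGsym : ∀ t ∈ B.openInterval i,
      IsSymmetricOnCircle (F - C c) r (B.curve t) (Complex.I * B.tangent i t) :=
    fun t ht => (hsym t ht).sub_C c
  obtain ⟨f, m, g, hf, hfg, hg0, hsmooth, t₀, t₁, ht, htsub, hf0⟩ := (hfr.mono hsub).exists_component
    h01 hr hρ hG (fun t ht => hG0 t (hsub ht)) (fun t ht => hGsym t (hsub ht))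
  have hcl : closure (B.openInterval i) = B.interval i := closure_Ioo (B.node_lt i).ne
  have hG1 : ∀ t ∈ B.interval i,
      eval (toC2 (parallel B.curve (B.tangent i) r t)) (F - C c) = 0 := by
    intro t ht
    have := Set.EqOn.of_subset_closure (s := B.openInterval i) (t := B.interval i)
      (f := fun t => eval (toC2 (parallel B.curve (B.tangent i) r t)) (F - C c)) (g := fun _ => 0)
      hG0 ((continuous_eval _).comp_continuousOn (B.continuousOn_parallel i r)) continuousOn_const
      (B.openInterval_subset i) hcl.ge
    exact this ht
  obtain ⟨u, hu⟩ := Set.nonempty_Ioo.2 ht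
  -- So far `f` vanishes on a short arc only. Since `f` and `g` have no common zeros, connectedness
  -- excludes a change of component, also across points where `r k = 1`.
  have hall : ∀ t ∈ B.interval i,
      eval (toC2 (parallel B.curve (B.tangent i) r t)) (complexify f) = 0 := fun t ht' =>
    eval_eq_zero_of_isPreconnected (m := m) hg0 isPreconnected_Icc (B.continuousOn_parallel i r)
      (by rw [← hfg]; exact hG1) (B.openInterval_subset i (hsub (htsub hu))) (hf0 u hu) ht'
  have hft := (hfr.mono hsub).mono htsub
  have hρt : ∀ t ∈ Set.Ioo t₀ t₁, 1 - r * B.curvature i t ≠ 0 := fun t ht => hρ t (htsub ht)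
  refine ⟨f, ⟨hf, vanishingIdeal_eq_span hf ?_ ?_⟩, hsmooth, fun P hP0 hP2 hP hiso => ?_⟩
  · exact (hft.infinite_parallel ht hρt).mono (Set.image_mono (Set.image_mono
      ((htsub.trans hsub).trans (B.openInterval_subset i))))
  · rintro _ ⟨_, ⟨t, ht, rfl⟩, rfl⟩
    exact hall t ht
  · exact hft.isTangentToLineAtInfinity ht hr hρt (fun t ht => hk t (hsub (htsub ht))) hf hsmooth hf0 hG
      (fun t ht => hG0 t (hsub (htsub ht))) (fun t ht => hGsym t (hsub (htsub ht))) hP0 hP2 hP hiso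

end PiecewiseSmoothBoundary

end

end MagneticBilliard

end

/-! ### The main theorem. -/

open MagneticBilliard in
theorem mainTheorem1 (β : ℝ) (hβ : 0 < β) (Ω : Set ℂ) (hΩo : IsOpen Ω) (hΩne : Ω.Nonempty)
    (hΩc : Convex ℝ Ω) (hΩb : Bornology.IsBounded Ω) (B : PiecewiseSmoothBoundary Ω)
    (hcurv : ∀ i, ∀ s ∈ B.interval i, β ≤ B.curvature i s)
    (Φ : ℂ → ℂ → ℝ) (hΦ : IsPolynomialIntegral β B Φ)
    (hΦnc : ∃ x ∈ Ω, ∃ y ∈ Ω, ∃ v w : ℂ, ‖v‖ = 1 ∧ ‖w‖ = 1 ∧ Φ x v ≠ Φ y w) :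
    (∃ (o : ℂ) (d : ℝ), 0 < d ∧ frontier Ω = Metric.sphere o d) ∨
      ∀ i, ¬ IsCircular (B.piece i) ∧
        ∀ σ : ℝ, σ = 1 ∨ σ = -1 →
          ∃ f : MvPolynomial (Fin 2) ℝ,
            IsMinimalDefiningPolynomial f (parallelCurve β B i σ) ∧
            IsSmoothAffineCurve (complexify f) ∧
            ∀ P : Fin 3 → ℂ, P ≠ 0 → P 2 = 0 →
              IsNonsingularPoint (homogenization (complexify f)) P → ¬ IsIsotropic P →
                IsTangentToLineAtInfinity (homogenization (complexify f)) P := by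
  obtain ⟨F, hF⟩ := hΦ.exists_mvPolynomial hβ hΩo hΩne hΩc
  have hsymm := fun i s (hs : s ∈ B.openInterval i) => hΦ.isSymmetricOnCircle hF i hs
  have hnc : ∃ z z' : ℂ, MvPolynomial.eval (toC2 z) F ≠ MvPolynomial.eval (toC2 z') F := by
    obtain ⟨x, hx, y, hy, v, w, hv, hw, hne⟩ := hΦnc
    refine ⟨larmorCenter β x v, larmorCenter β y w, fun h => hne ?_⟩
    rw [← hF x (subset_closure hx) v hv, ← hF y (subset_closure hy) w hw] at h
    exact_mod_cast h
  refine or_iff_not_imp_left.2 fun hcirc i => ⟨?_, fun σ hσ => ?_⟩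
  · rintro ⟨o, d, hd, hsub⟩
    exact hcirc (frontier_eq_sphere_of_arc hβ hΩo hΩne hΩb hcurv hsymm hnc (B.node_lt i) subset_rfl hd
      fun s hs => mem_sphere_iff_norm.1 (hsub ⟨s, B.openInterval_subset i hs, rfl⟩))
  · have hσ1 : |σ| = 1 := by rcases hσ with rfl | rfl <;> simp
    have hr : σ * (1 / β) ≠ 0 :=
      mul_ne_zero (by rcases hσ with rfl | rfl <;> norm_num) (one_div_pos.2 hβ).ne'
    rw [parallelCurve_eq]
    refine PiecewiseSmoothBoundary.exists_minimalDefiningPolynomial hr hnc ?_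
      (fun s hs => (hβ.trans_le (hcurv i s (B.openInterval_subset i hs))).ne') ?_
    · rcases hσ with rfl | rfl
      · simpa only [one_mul] using hsymm i
      · simpa only [neg_one_mul] using fun s hs => (hsymm i s hs).neg
    -- If the signed radius times the curvature is identically 1, the parallel curve is a point and
    -- the piece is an arc of a circle of radius `1 / β`, which is the excluded case.
    · by_contra! hρ
      obtain ⟨o, ho⟩ := (B.isFrenet i).exists_center (B.node_lt i) hρ
      rw [abs_mul, hσ1, one_mul] at ho
      exact hcirc (frontier_eq_sphere_of_arc hβ hΩo hΩne hΩb hcurv hsymm hnc (B.node_lt i) subset_rfl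
        (abs_pos.2 (one_div_pos.2 hβ).ne') ho)
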